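/- Work on $\mathbb{R}^3$ with $\langle x\rangle=(1+|x|^2)^{1/2}$, and set $$\|v\|_{\dot X}^2=\sup_{R>0}\frac1{R^2}\int_{|x|=R}|v|^2\,dS,\qquad \|v\|_Y^2=\sup_{R>0}\frac1{\langle R\rangle}\int_{|x|\le R}|v|^2\,dx,$$ let $Y^*$ be the predual of $Y$, with norm $\|f\|_{Y^*}=\sup\{\int|fg|\,dx:\ \|g\|_Y\le1\}$ (equal to $+\infty$ if $f\notin Y^*$), and let $\|w\|_{\ell^1L^\infty}=\sum_{j\ge0}\|w\|_{L^\infty(A_j)}$ with $A_0=\{|x|\le1\}$ and $A_j=\{2^{j-1}\le|x|\le2^j\}$ for $j\ge1$. Let $\alpha,M,\delta>0$. There is $\sigma_0=\sigma_0(\alpha,M,\delta)>0$ such that for every $\sigma\in(0,\sigma_0]$ there is a constant $C=C(\alpha,M,\sigma,\delta)>0$ with the following property. Let $a:\mathbb{R}^3\to\mathbb{R}$ be weakly differentiable (that is, $a,\nabla a\in L^1_{\mathrm{loc}}$) with $$\alpha\le a(x)\le M\ \text{ for a.e. }x,\qquad \|\langle x\rangle a^{-1}a'_-\|_{\ell^1L^\infty}\le\tfrac14,$$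 where $a'_-=\max\{-\partial_r a,0\}$ is the negative part of the radial derivative $\partial_ra=\frac{x}{|x|}\cdot\nabla a$. Let $b(x,\partial)v=b_0v+\sum_{j=1}^3b_j\,\partial_jv$ be a first-order operator with measurable coefficients $b_0,\dots,b_3:\mathbb{R}^3\to\mathbb{C}$ such that, for every $v\in H^2(\mathbb{R}^3;\mathbb{C})$ and almost every $x$, $$|b(x,\partial)v|\le\sigma\big(\langle x\rangle^{-2-\delta}|v|+\langle x\rangle^{-1-\delta}|\nabla v|\big).$$ Then for all $z\in\mathbb{C}$ with $\operatorname{Im}z\ge0$ and all $v\in H^2(\mathbb{R}^3;\mathbb{C})$ (represented by its continuous representative, so that the integrals over spheres are defined) $$\|v\|_{\dot X}+\|zv\|_Y+\|\nabla v\|_Y\le C\,\|(\Delta+z^2a+b(x,\partial))v\|_{Y^*}.$$ -/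

import Mathlib

open MeasureTheory Set
open scoped ENNReal ContDiff

noncomputable section

namespace Morawetz

/-- Euclidean three-space. -/
abbrev E3 := EuclideanSpace ℝ (Fin 3)

/-- The Japanese bracket `⟨r⟩ = (1 + r²)^{1/2}` of a real number. -/
def bra (r : ℝ) : ℝ := Real.sqrt (1 + r ^ 2)

/-- `g` is the weak partial derivative `∂ᵢ u` of `u` on `ℝ³`: both are locally integrable and
`∫ u ∂ᵢφ = - ∫ g φ` for every real test function `φ ∈ C_c^∞(ℝ³)`. -/
structure IsWeakPartial {F : Type*} [NormedAddCommGroup F] [NormedSpace ℝ F]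
    (i : Fin 3) (u g : E3 → F) : Prop where
  locInt : LocallyIntegrable u volume
  locInt_deriv : LocallyIntegrable g volume
  integral_eq : ∀ φ : E3 → ℝ, ContDiff ℝ ∞ φ → HasCompactSupport φ →
    ∫ x, (fderiv ℝ φ x (EuclideanSpace.single i 1)) • u x = - ∫ x, φ x • g x

/-- `v ∈ H²(ℝ³; ℂ)`, with first weak derivatives `Dv i = ∂ᵢ v` and second weak derivatives
`D2v i j = ∂ⱼ ∂ᵢ v`, all of them in `L²`. -/
structure IsH2 (v : E3 → ℂ) (Dv : Fin 3 → E3 → ℂ) (D2v : Fin 3 → Fin 3 → E3 → ℂ) : Prop where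
  memLp : MemLp v 2 volume
  memLp_D : ∀ i, MemLp (Dv i) 2 volume
  memLp_D2 : ∀ i j, MemLp (D2v i j) 2 volume
  weak_D : ∀ i, IsWeakPartial i v (Dv i)
  weak_D2 : ∀ i j, IsWeakPartial j (Dv i) (D2v i j)

/-- The gradient as a `ℂ³`-valued function, with the Euclidean (Hermitian) norm on `ℂ³`. -/
def grad (Dv : Fin 3 → E3 → ℂ) (x : E3) : EuclideanSpace ℂ (Fin 3) :=
  WithLp.toLp 2 (fun i => Dv i x)

/-- The Laplacian as the trace of the Hessian. -/
def laplacian (D2v : Fin 3 → Fin 3 → E3 → ℂ) (x : E3) : ℂ := ∑ i, D2v i i x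

/-- The surface integral `∫_{|x| = R} |v|² dS` over the sphere of radius `R > 0`, written as
`R² ∫_{𝕊²} |v(Rθ)|² dθ` with the standard surface measure `dθ` of the unit sphere. -/
def sphereIntegralSq (v : E3 → ℂ) (R : ℝ) : ℝ≥0∞ :=
  ENNReal.ofReal (R ^ 2) *
    ∫⁻ θ : Metric.sphere (0 : E3) 1, ‖v (R • (θ : E3))‖ₑ ^ 2 ∂((volume : Measure E3).toSphere)

/-- `‖v‖_Ẋ = (sup_{R > 0} R⁻² ∫_{|x| = R} |v|² dS)^{1/2}`, with values in `[0, ∞]`. -/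
def normXdot (v : E3 → ℂ) : ℝ≥0∞ :=
  (⨆ (R : ℝ) (_ : 0 < R), ENNReal.ofReal (1 / R ^ 2) * sphereIntegralSq v R) ^ (1 / 2 : ℝ)

/-- `‖v‖_Y = (sup_{R > 0} ⟨R⟩⁻¹ ∫_{|x| ≤ R} |v|² dx)^{1/2}`, with values in `[0, ∞]`. -/
def normY {F : Type*} [NormedAddCommGroup F] (v : E3 → F) : ℝ≥0∞ :=
  (⨆ (R : ℝ) (_ : 0 < R),
    ENNReal.ofReal (1 / bra R) * ∫⁻ x in Metric.closedBall (0 : E3) R, ‖v x‖ₑ ^ 2) ^ (1 / 2 : ℝ)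

/-- The norm of the predual `Y*` of `Y`, given by duality with the unit ball of `Y`:
`‖f‖_{Y*} = sup {∫ |f g| : ‖g‖_Y ≤ 1}`. It is `∞` if `f` is not in `Y*`. -/
def normYstar (f : E3 → ℂ) : ℝ≥0∞ :=
  ⨆ (g : E3 → ℂ) (_ : AEStronglyMeasurable g volume) (_ : normY g ≤ 1),
    ∫⁻ x, ‖f x‖ₑ * ‖g x‖ₑ

/-- The dyadic shells `A₀ = {|x| ≤ 1}` and `A_j = {2^{j-1} ≤ |x| ≤ 2^j}` for `j ≥ 1`. -/
def shell : ℕ → Set E3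
  | 0 => {x | ‖x‖ ≤ 1}
  | j + 1 => {x | (2 : ℝ) ^ j ≤ ‖x‖ ∧ ‖x‖ ≤ (2 : ℝ) ^ (j + 1)}

/-- The dyadic norm `‖w‖_{ℓ¹L^∞} = ∑_{j ≥ 0} ‖w‖_{L^∞(A_j)}`. -/
def normL1Linfty (w : E3 → ℝ) : ℝ≥0∞ :=
  ∑' j : ℕ, eLpNorm w ∞ (volume.restrict (shell j))

/-- The negative part `a'_- = max {-∂_r a, 0}` of the radial derivative `∂_r a = (x/|x|)·∇a`,
where `Da` is the gradient of `a`. -/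
def radialDerivNeg (Da : Fin 3 → E3 → ℝ) (x : E3) : ℝ :=
  max (-∑ i, (x i / ‖x‖) * Da i x) 0

/-- The first-order operator `b(x,∂)v = b₀ v + ∑ⱼ bⱼ ∂ⱼ v`, applied to a function `v` with
gradient `Dv`. -/
def firstOrder (b₀ : E3 → ℂ) (b₁ : Fin 3 → E3 → ℂ) (v : E3 → ℂ) (Dv : Fin 3 → E3 → ℂ)
    (x : E3) : ℂ :=
  b₀ x * v x + ∑ j, b₁ j x * Dv j x

/-- The bound `|b(x,∂)v| ≤ σ (⟨x⟩^{-2-δ} |v| + ⟨x⟩^{-1-δ} |∇v|)` almost everywhere, for all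
functions `v ∈ H²`. -/
def FirstOrderBound (σ δ : ℝ) (b₀ : E3 → ℂ) (b₁ : Fin 3 → E3 → ℂ) : Prop :=
  ∀ (v : E3 → ℂ) (Dv : Fin 3 → E3 → ℂ) (D2v : Fin 3 → Fin 3 → E3 → ℂ), IsH2 v Dv D2v →
    ∀ᵐ x, ‖firstOrder b₀ b₁ v Dv x‖ ≤
      σ * (bra ‖x‖ ^ (-2 - δ) * ‖v x‖ + bra ‖x‖ ^ (-1 - δ) * ‖grad Dv x‖)

end Morawetz

end

/-! The proof is the Morawetz multiplier method, with one multiplier for each dyadic scale.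

Write q_ρ = (|x|² + ρ²)^{-1/2}, and let w be real and κ ≥ 0. Testing Δw + κaw against 2q_ρ(x·∇w + w)
produces the positive terms ρ²q_ρ³(|∇w|² + κaw²) + 3ρ²q_ρ⁵w² (`integral_morawetz`,
`integral_coeff`). On |x| ≤ R with ρ = R these control the scale invariant energy R⁻¹∫|∇w|² +
κR⁻¹∫aw² + R⁻³∫w². The only term without a sign is κq_ρ(x·∇a)w². The ℓ¹L^∞ hypothesis gives c_j ≥ 0
with sum at most 1/4 and ⟨x⟩a'_- ≤ c_j a on the j-th shell. Adding the multipliers with ρ = 2^j and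
coefficient 20c_j creates on that shell a positive term large enough to pay for a'_-, while |x|
times the total weight stays at most 6 (`le_sum_morawetzDensity`). Hence the local energy at every
radius is at most 36∫|Δw + κaw|W, where W is the sum of the |∂_i w| and |w|/|x|
(`IsCoeff.ballEnergy_le`). The identities are proved for test functions and pass to H² by density;
Hardy's inequality handles w/|x|.

For complex z take κ = max(Re z², 0), so that Δ + κa is real and acts on Re v and Im v separately.
The remainder (z² - κ)av is a source. Testing the equation with v itself and using Cauchy–Schwarz
bounds its pairing with W by a multiple of |z|∫|F||v|, where F = Δv + z²av (`IsCoeff.source_le`).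
This is a pairing of F with zv, which the left-hand side of the theorem controls.

Energy bounds at all radii give the Ẋ norm by a trace inequality, the Y norms of ∇v and W, and, with
the energy identity on large balls, the Y norm of zv. Finally F differs from the right-hand side f
by the first-order terms. Since δ > 0, the weight ⟨x⟩^{-1-δ} makes their pairings at most a multiple
of σ times squared Y norms. For v in H² these norms are finite, so small σ allows absorption
(`absorb`), leaving a bound by the Y* norm of f. -/

noncomputable section

/-! ### Convergence in L². -/

namespace Morawetz

open Filter Topology

/-- Convergence of a sequence of real functions in `L²(ℝ³)`. -/
structure TendstoL2 (f : ℕ → E3 → ℝ) (g : E3 → ℝ) : Prop where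
  memLp : ∀ n, MemLp (f n) 2 volume
  memLp_lim : MemLp g 2 volume
  tendsto : Tendsto (fun n => eLpNorm (f n - g) 2 volume) atTop (𝓝 0)

namespace TendstoL2

variable {f f' : ℕ → E3 → ℝ} {g g' : E3 → ℝ}

lemma const (hg : MemLp g 2 volume) : TendstoL2 (fun _ => g) g :=
  ⟨fun _ => hg, hg, by simp⟩

lemma of_bound (hf : ∀ n, MemLp (f n) 2 volume) (hg : MemLp g 2 volume) (u : ℕ → ℝ≥0∞)
    (hu : Tendsto u atTop (𝓝 0)) (h : ∀ n, eLpNorm (f n - g) 2 volume ≤ u n) : TendstoL2 f g :=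
  ⟨hf, hg, tendsto_of_tendsto_of_tendsto_of_le_of_le tendsto_const_nhds hu
    (fun _ => zero_le) h⟩

lemma add (h : TendstoL2 f g) (h' : TendstoL2 f' g') :
    TendstoL2 (fun n x => f n x + f' n x) (fun x => g x + g' x) := by
  refine of_bound (fun n => (h.memLp n).add (h'.memLp n)) (h.memLp_lim.add h'.memLp_lim)
    (fun n => eLpNorm (f n - g) 2 volume + eLpNorm (f' n - g') 2 volume)
    (by simpa using h.tendsto.add h'.tendsto) fun n => ?_
  have : (fun x => f n x + f' n x) - (fun x => g x + g' x) = (f n - g) + (f' n - g') := by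
    ext x; simp only [Pi.sub_apply, Pi.add_apply]; ring
  rw [this]
  exact eLpNorm_add_le ((h.memLp n).sub h.memLp_lim).1 ((h'.memLp n).sub h'.memLp_lim).1
    (by norm_num)

lemma sum {ι : Type*} (s : Finset ι) {f : ι → ℕ → E3 → ℝ} {g : ι → E3 → ℝ}
    (h : ∀ i ∈ s, TendstoL2 (f i) (g i)) :
    TendstoL2 (fun n x => ∑ i ∈ s, f i n x) (fun x => ∑ i ∈ s, g i x) := by
  classical
  induction s using Finset.induction_on with
  | empty => simpa using const (g := fun _ => (0 : ℝ)) (MemLp.zero)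
  | insert i s hi ih =>
    simp only [Finset.sum_insert hi]
    exact (h i (by simp)).add (ih fun j hj => h j (by simp [hj]))

lemma abs (h : TendstoL2 f g) : TendstoL2 (fun n x => |f n x|) (fun x => |g x|) := by
  refine of_bound (fun n => (h.memLp n).abs) h.memLp_lim.abs _ h.tendsto fun n => ?_
  refine eLpNorm_mono fun x => ?_
  simpa using abs_abs_sub_abs_le_abs_sub (f n x) (g x)

/-- Multiplication by uniformly bounded, pointwise convergent multipliers. -/
lemma bdd_mul (h : TendstoL2 f g) {m : ℕ → E3 → ℝ} {m' : E3 → ℝ} {C : ℝ}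
    (hm : ∀ n, AEStronglyMeasurable (m n) volume) (hb : ∀ n, ∀ᵐ x, |m n x| ≤ C)
    (hl : ∀ᵐ x, Tendsto (fun n => m n x) atTop (𝓝 (m' x))) :
    TendstoL2 (fun n x => m n x * f n x) (fun x => m' x * g x) := by
  have hm' : AEStronglyMeasurable m' volume := aestronglyMeasurable_of_tendsto_ae atTop hm hl
  have hb' : ∀ᵐ x, |m' x| ≤ C := by
    filter_upwards [hl, ae_all_iff.2 hb] with x hx hx'
    exact le_of_tendsto hx.abs (Eventually.of_forall hx')
  have hmem : ∀ n, MemLp (fun x => m n x * f n x) 2 volume := fun n =>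
    MemLp.of_le_mul (c := C) (h.memLp n) ((hm n).mul (h.memLp n).1) (by
      filter_upwards [hb n] with x hx
      rw [norm_mul]; gcongr; simpa using hx)
  have hmem' : MemLp (fun x => m' x * g x) 2 volume :=
    MemLp.of_le_mul (c := C) h.memLp_lim (hm'.mul h.memLp_lim.1) (by
      filter_upwards [hb'] with x hx
      rw [norm_mul]; gcongr; simpa using hx)
  -- The difference of the products is m_n(f_n - g) + (m_n - m')g. The uniform bound handles the
  -- first summand; the second is dominated convergence with majorant 2C|g|.
  have key : Tendsto (fun n => eLpNorm (fun x => (m n x - m' x) * g x) 2 volume) atTop (𝓝 0) := by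
    have h2 : Tendsto (fun n => ∫⁻ x, ‖(m n x - m' x) * g x‖ₑ ^ (2 : ℝ)) atTop
        (𝓝 (∫⁻ _ : E3, 0)) := by
      refine tendsto_lintegral_of_dominated_convergence' (fun x => ‖(2 * C) * g x‖ₑ ^ (2 : ℝ))
        (fun n => ?_) (fun n => ?_) ?_ ?_
      · exact ((((hm n).sub hm').mul h.memLp_lim.1).enorm).pow_const _
      · filter_upwards [hb n, hb'] with x hx hx'
        gcongr
        rw [enorm_le_iff_norm_le, norm_mul, norm_mul]
        gcongr
        rw [Real.norm_eq_abs, Real.norm_eq_abs]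
        calc |m n x - m' x| ≤ |m n x| + |m' x| := abs_sub _ _
          _ ≤ 2 * C := by linarith
          _ ≤ |2 * C| := le_abs_self _
      · have := (h.memLp_lim.const_mul (2 * C))
        have h3 := lintegral_rpow_enorm_lt_top_of_eLpNorm_lt_top (by norm_num) (by norm_num) this.2
        simpa using h3.ne
      · filter_upwards [hl] with x hx
        have : Tendsto (fun n => ‖(m n x - m' x) * g x‖ₑ) atTop (𝓝 ‖(m' x - m' x) * g x‖ₑ) :=
          ((hx.sub_const _).mul_const _).enorm
        simp only [sub_self, zero_mul, enorm_zero] at this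
        have h4 := ((ENNReal.continuous_rpow_const (y := 2)).tendsto 0).comp this
        simpa [Function.comp_def] using h4
    have h5 := ((ENNReal.continuous_rpow_const (y := 1 / 2)).tendsto _).comp h2
    simp only [lintegral_zero] at h5
    have h6 : (0 : ℝ≥0∞) ^ (1 / 2 : ℝ) = 0 := by simp
    rw [h6] at h5
    refine h5.congr fun n => ?_
    rw [eLpNorm_eq_lintegral_rpow_enorm_toReal (by norm_num) (by norm_num)]
    simp
  refine of_bound hmem hmem'
    (fun n => ENNReal.ofReal C * eLpNorm (f n - g) 2 volume
      + eLpNorm (fun x => (m n x - m' x) * g x) 2 volume) ?_ fun n => ?_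
  · have := (ENNReal.Tendsto.const_mul h.tendsto (Or.inr (ENNReal.ofReal_ne_top (r := C)))).add key
    simpa using this
  · have : (fun x => m n x * f n x) - (fun x => m' x * g x)
        = (fun x => m n x * (f n - g) x) + (fun x => (m n x - m' x) * g x) := by
      ext x; simp only [Pi.sub_apply, Pi.add_apply]; ring
    rw [this]
    refine (eLpNorm_add_le ((hm n).mul ((h.memLp n).sub h.memLp_lim).1)
      (((hm n).sub hm').mul h.memLp_lim.1) (by norm_num)).trans (add_le_add ?_ le_rfl)
    refine eLpNorm_le_mul_eLpNorm_of_ae_le_mul (c := C) ?_ 2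
    filter_upwards [hb n] with x hx
    rw [Pi.mul_apply, norm_mul]; gcongr; simpa using hx

lemma weight (h : TendstoL2 f g) {m : E3 → ℝ} {C : ℝ} (hm : AEStronglyMeasurable m volume)
    (hb : ∀ᵐ x, |m x| ≤ C) : TendstoL2 (fun n x => m x * f n x) (fun x => m x * g x) :=
  h.bdd_mul (fun _ => hm) (fun _ => hb) (Eventually.of_forall fun _ => tendsto_const_nhds)

lemma const_mul (h : TendstoL2 f g) (c : ℝ) :
    TendstoL2 (fun n x => c * f n x) (fun x => c * g x) :=
  h.weight (C := |c|) aestronglyMeasurable_const (Eventually.of_forall fun _ => le_rfl)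

lemma integral_mul (h : TendstoL2 f g) (h' : TendstoL2 f' g') :
    Tendsto (fun n => ∫ x, f n x * f' n x) atTop (𝓝 (∫ x, g x * g' x)) := by
  have conv : ∀ {f : ℕ → E3 → ℝ} {g : E3 → ℝ} (h : TendstoL2 f g),
      Tendsto (fun n => (h.memLp n).toLp (f n)) atTop (𝓝 (h.memLp_lim.toLp g)) := fun h => by
    rw [Lp.tendsto_Lp_iff_tendsto_eLpNorm'']
    exact h.tendsto
  have e : ∀ {u v : E3 → ℝ} (hu : MemLp u 2 volume) (hv : MemLp v 2 volume),
      inner ℝ (hu.toLp u) (hv.toLp v) = ∫ x, u x * v x := fun hu hv => by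
    rw [L2.inner_def]
    refine integral_congr_ae ?_
    filter_upwards [hu.coeFn_toLp, hv.coeFn_toLp] with x h1 h2
    rw [h1, h2]; simp [mul_comm]
  have := (conv h).inner (𝕜 := ℝ) (conv h')
  simpa only [e] using this

end TendstoL2

end Morawetz

/-! ### Mollification in L². -/

namespace Morawetz

open Filter Topology
open scoped Convolution

/-- Translations are continuous in `L²`. -/
lemma tendsto_eLpNorm_translate_sub {f : E3 → ℝ} (hf : MemLp f 2 volume) :
    Tendsto (fun t : E3 => eLpNorm (fun x => f (x - t) - f x) 2 volume) (𝓝 0) (𝓝 0) := by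
  let τ : E3 → C(E3, E3) := fun t => ⟨fun x => x - t, by fun_prop⟩
  have hτ : Continuous τ := by
    apply ContinuousMap.continuous_of_continuous_uncurry
    change Continuous fun p : E3 × E3 => p.2 - p.1
    fun_prop
  have hmp : ∀ t, MeasurePreserving (τ t) (volume : Measure E3) volume := fun t =>
    measurePreserving_sub_right volume t
  have h1 : Tendsto (fun t => Lp.compMeasurePreserving (τ t) (hmp t) (hf.toLp f)) (𝓝 0)
      (𝓝 (Lp.compMeasurePreserving (τ 0) (hmp 0) (hf.toLp f))) :=
    tendsto_const_nhds.compMeasurePreservingLp (hτ.tendsto 0) hmp (hmp 0) (by norm_num)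
  simp only [Lp.toLp_compMeasurePreserving] at h1
  rw [Lp.tendsto_Lp_iff_tendsto_eLpNorm''] at h1
  refine h1.congr fun t => ?_
  congr 1
  ext x
  simp [τ]

/-- A kernel of total mass one moves `f` in `L²` at most as much as the translations by vectors
in its support. -/
lemma eLpNorm_convolution_sub_le {ρ f : E3 → ℝ} (hρc : Continuous ρ) (hρs : HasCompactSupport ρ)
    (hρ0 : ∀ x, 0 ≤ ρ x) (hρ1 : ∫ x, ρ x = 1) (hf : MemLp f 2 volume) {ε : ℝ≥0∞}
    (hε : ∀ t, ρ t ≠ 0 → eLpNorm (fun x => f (x - t) - f x) 2 volume ≤ ε) :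
    eLpNorm (fun x => (ρ ⋆[ContinuousLinearMap.lsmul ℝ ℝ, volume] f) x - f x) 2 volume ≤ ε := by
  have hρi : Integrable ρ volume := hρc.integrable_of_hasCompactSupport hρs
  have hρl : ∫⁻ t, ENNReal.ofReal (ρ t) = 1 := by
    rw [← ofReal_integral_eq_lintegral_ofReal hρi (Eventually.of_forall hρ0), hρ1]; simp
  have hsub : AEStronglyMeasurable (fun p : E3 × E3 => f (p.1 - p.2) - f p.1)
      (volume.prod volume) :=
    (hf.1.comp_quasiMeasurePreserving (quasiMeasurePreserving_sub volume volume)).sub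
      (hf.1.comp_quasiMeasurePreserving Measure.quasiMeasurePreserving_fst)
  have hconv := hρs.convolutionExists_left (ContinuousLinearMap.lsmul ℝ ℝ) hρc
    (hf.locallyIntegrable (by norm_num))
  have h1 : ∀ᵐ x, ‖(ρ ⋆[ContinuousLinearMap.lsmul ℝ ℝ, volume] f) x - f x‖ₑ ^ (2 : ℝ)
      ≤ ∫⁻ t, ENNReal.ofReal (ρ t) * ‖f (x - t) - f x‖ₑ ^ (2 : ℝ) := by
    filter_upwards [hsub.prodMk_left] with x hxm
    have e : (ρ ⋆[ContinuousLinearMap.lsmul ℝ ℝ, volume] f) x - f x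
        = ∫ t, ρ t * (f (x - t) - f x) := by
      have h2 : Integrable (fun t => ρ t * f (x - t)) volume := hconv x
      simp only [mul_sub]
      rw [integral_sub h2 (hρi.mul_const _), integral_mul_const, hρ1, one_mul, convolution_def]
      simp
    rw [e]
    -- Splitting ρ into two square roots lets Cauchy–Schwarz give Jensen's inequality for the
    -- probability density ρ.
    have h3 : ‖∫ t, ρ t * (f (x - t) - f x)‖ₑ ≤
        ∫⁻ t, ENNReal.ofReal (ρ t) ^ (1 / 2 : ℝ) *
          (ENNReal.ofReal (ρ t) ^ (1 / 2 : ℝ) * ‖f (x - t) - f x‖ₑ) := by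
      refine (enorm_integral_le_lintegral_enorm _).trans (lintegral_mono fun t => ?_)
      rw [enorm_mul, ← mul_assoc, ← ENNReal.rpow_add_of_nonneg _ _ (by norm_num) (by norm_num),
        Real.enorm_eq_ofReal (hρ0 t)]
      norm_num
    have hm : AEMeasurable (fun t => ENNReal.ofReal (ρ t) ^ (1 / 2 : ℝ)) volume :=
      (hρc.measurable.ennreal_ofReal.pow_const _).aemeasurable
    have h4 := ENNReal.lintegral_mul_le_Lp_mul_Lq volume Real.HolderConjugate.two_two hm
      (hm.mul hxm.enorm)
    have h5 := h3.trans h4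
    simp only [Pi.mul_apply, ← ENNReal.rpow_mul, ENNReal.mul_rpow_of_nonneg _ _ (zero_le_two (α := ℝ))]
      at h5
    norm_num [hρl] at h5
    calc _ ≤ ((∫⁻ t, ENNReal.ofReal (ρ t) * ‖f (x - t) - f x‖ₑ ^ (2 : ℝ)) ^ (1 / 2 : ℝ)) ^ (2 : ℝ) := by
          gcongr
          simpa using h5
      _ = _ := by rw [← ENNReal.rpow_mul]; norm_num
  have h2 : ∫⁻ x, ‖(ρ ⋆[ContinuousLinearMap.lsmul ℝ ℝ, volume] f) x - f x‖ₑ ^ (2 : ℝ) ≤ ε ^ (2 : ℝ) := by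
    refine (lintegral_mono_ae h1).trans ?_
    rw [lintegral_lintegral_swap]
    · calc _ ≤ ∫⁻ t, ENNReal.ofReal (ρ t) * ε ^ (2 : ℝ) := by
            refine lintegral_mono fun t => ?_
            dsimp only
            rw [lintegral_const_mul' _ _ ENNReal.ofReal_ne_top]
            by_cases ht : ρ t = 0
            · simp [ht]
            gcongr
            have := hε t ht
            rw [eLpNorm_eq_lintegral_rpow_enorm_toReal (by norm_num) (by norm_num)] at this
            calc _ = ((∫⁻ x, ‖f (x - t) - f x‖ₑ ^ (2 : ℝ)) ^ (1 / 2 : ℝ)) ^ (2 : ℝ) := by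
                  rw [← ENNReal.rpow_mul]; norm_num
              _ ≤ _ := by gcongr; simpa using this
        _ = ε ^ (2 : ℝ) := by
            rw [lintegral_mul_const _ hρc.measurable.ennreal_ofReal, hρl, one_mul]
    · exact (hρc.measurable.ennreal_ofReal.comp measurable_snd).aemeasurable.mul
        (hsub.enorm.pow_const _)
  rw [eLpNorm_eq_lintegral_rpow_enorm_toReal (by norm_num) (by norm_num)]
  simp only [ENNReal.toReal_ofNat]
  calc _ ≤ (ε ^ (2 : ℝ)) ^ (1 / 2 : ℝ) := by gcongr
    _ = ε := by rw [← ENNReal.rpow_mul]; norm_num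

/-- Smooth bump functions supported in balls that shrink to the origin. -/
def mollBump (n : ℕ) : ContDiffBump (0 : E3) :=
  ⟨1 / (2 * ((n : ℝ) + 1)), 1 / ((n : ℝ) + 1), by positivity, by
    apply one_div_lt_one_div_of_lt <;> [positivity; linarith [n.cast_nonneg (α := ℝ)]]⟩

lemma tendsto_mollBump_rOut : Tendsto (fun n => (mollBump n).rOut) atTop (𝓝 0) :=
  tendsto_one_div_add_atTop_nhds_zero_nat

/-- Mollification. -/
def moll (n : ℕ) (u : E3 → ℝ) : E3 → ℝ :=
  (mollBump n).normed volume ⋆[ContinuousLinearMap.lsmul ℝ ℝ, volume] u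

/-- The partial derivative of a differentiable function. -/
def pd (i : Fin 3) (f : E3 → ℝ) (x : E3) : ℝ := fderiv ℝ f x (EuclideanSpace.single i 1)

lemma contDiff_pd {f : E3 → ℝ} (hf : ContDiff ℝ ∞ f) (i : Fin 3) : ContDiff ℝ ∞ (pd i f) :=
  (hf.fderiv_right (m := ∞) (by norm_cast)).clm_apply contDiff_const

lemma hasCompactSupport_pd {f : E3 → ℝ} (hf : HasCompactSupport f) (i : Fin 3) :
    HasCompactSupport (pd i f) :=
  hf.fderiv_apply ℝ _

lemma contDiff_moll (n : ℕ) {u : E3 → ℝ} (hu : LocallyIntegrable u volume) :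
    ContDiff ℝ ∞ (moll n u) :=
  (mollBump n).hasCompactSupport_normed.contDiff_convolution_left _
    (mollBump n).contDiff_normed hu

/-- The derivative falls on the smooth kernel, and `y ↦ ρ (x - y)` is a test function for the weak
derivative. The sign from reflecting the kernel cancels the sign from integrating by parts. -/
lemma pd_moll (n : ℕ) {i : Fin 3} {u g : E3 → ℝ} (h : IsWeakPartial i u g) :
    pd i (moll n u) = moll n g := by
  ext x
  set ρ := (mollBump n).normed (volume : Measure E3) with hρ
  have hρd : ContDiff ℝ ∞ ρ := (mollBump n).contDiff_normed
  have hρs : HasCompactSupport ρ := (mollBump n).hasCompactSupport_normed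
  have h1 := hρs.hasFDerivAt_convolution_left (ContinuousLinearMap.lsmul ℝ ℝ) (μ := volume)
    (hρd.of_le (by norm_cast)) h.locInt x
  have hφd : ContDiff ℝ ∞ (fun y => ρ (x - y)) := hρd.comp (contDiff_const.sub contDiff_id)
  have hφs : HasCompactSupport (fun y => ρ (x - y)) :=
    hρs.comp_homeomorph (Homeomorph.subLeft x)
  have h2 := h.integral_eq _ hφd hφs
  have h3 : ∀ y, fderiv ℝ (fun y => ρ (x - y)) y (EuclideanSpace.single i 1)
      = - fderiv ℝ ρ (x - y) (EuclideanSpace.single i 1) := fun y => by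
    have : HasFDerivAt (fun y => ρ (x - y)) ((fderiv ℝ ρ (x - y)).comp
        (-(ContinuousLinearMap.id ℝ E3))) y :=
      (hρd.differentiable (by norm_num) (x - y)).hasFDerivAt.comp y
        ((hasFDerivAt_id y).const_sub x)
    rw [this.fderiv]; simp
  simp only [h3] at h2
  have hint := (hρs.fderiv ℝ).convolutionExists_left
    ((ContinuousLinearMap.lsmul ℝ ℝ : ℝ →L[ℝ] ℝ →L[ℝ] ℝ).precompL E3)
    (hρd.continuous_fderiv (by norm_num)) h.locInt x (μ := volume)
  have h4 : pd i (moll n u) x = ∫ t, fderiv ℝ ρ t (EuclideanSpace.single i 1) * u (x - t) := by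
    unfold pd moll
    rw [h1.fderiv, convolution_def, ContinuousLinearMap.integral_apply hint]
    simp
  have h5 : moll n g x = ∫ t, ρ t * g (x - t) := by
    unfold moll; rw [convolution_def]; simp [hρ]
  rw [h4, h5, ← integral_sub_left_eq_self (fun t => ρ t * g (x - t)) volume x,
    ← integral_sub_left_eq_self (fun t => fderiv ℝ ρ t (EuclideanSpace.single i 1) * u (x - t))
      volume x]
  simpa [integral_neg] using h2

lemma tendstoL2_moll {u : E3 → ℝ} (hu : MemLp u 2 volume) :
    TendstoL2 (fun n => moll n u) u := by
  have key : Tendsto (fun n => eLpNorm (moll n u - u) 2 volume) atTop (𝓝 0) := by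
    rw [ENNReal.tendsto_atTop_zero]
    intro ε hε
    have h1 := (tendsto_eLpNorm_translate_sub hu).eventually (Iic_mem_nhds hε)
    obtain ⟨δ, hδ, h2⟩ := Metric.eventually_nhds_iff.1 h1
    obtain ⟨N, hN⟩ := eventually_atTop.1 (tendsto_mollBump_rOut.eventually (Iio_mem_nhds hδ))
    refine ⟨N, fun n hn => eLpNorm_convolution_sub_le
      ((mollBump n).contDiff_normed (n := 0)).continuous
      (mollBump n).hasCompactSupport_normed (mollBump n).nonneg_normed (mollBump n).integral_normed
      hu fun t ht => h2 ?_⟩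
    have : t ∈ Function.support ((mollBump n).normed volume) := ht
    rw [ContDiffBump.support_normed_eq, Metric.mem_ball] at this
    exact this.trans (hN n hn)
  have hm : ∀ n, AEStronglyMeasurable (moll n u) volume := fun n =>
    (contDiff_moll n (hu.locallyIntegrable (by norm_num))).continuous.aestronglyMeasurable
  have hmem : ∀ n, MemLp (moll n u) 2 volume := fun n => by
    -- A translation moves u by at most twice its norm; this crude bound already places the
    -- mollification in L².
    have hle : eLpNorm (moll n u - u) 2 volume ≤ 2 * eLpNorm u 2 volume := by
      refine eLpNorm_convolution_sub_le
        ((mollBump n).contDiff_normed (n := 0)).continuous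
        (mollBump n).hasCompactSupport_normed (mollBump n).nonneg_normed
        (mollBump n).integral_normed hu fun t _ => ?_
      have hmp := measurePreserving_sub_right (volume : Measure E3) t
      refine (eLpNorm_sub_le (hu.comp_measurePreserving hmp).1 hu.1 (by norm_num)).trans ?_
      rw [two_mul]
      gcongr
      exact (eLpNorm_comp_measurePreserving hu.1 hmp).le
    have h2 : MemLp (moll n u - u) 2 volume :=
      ⟨(hm n).sub hu.1, hle.trans_lt (ENNReal.mul_lt_top (by norm_num) hu.2)⟩
    simpa using h2.add hu
  exact ⟨hmem, hu, key⟩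

end Morawetz

/-! ### Cutoffs and density of test functions in H². -/

namespace Morawetz

open Filter Topology
open scoped Convolution

/-- Real-valued functions in `H²(ℝ³)`, with their first and second weak derivatives. -/
structure IsRealH2 (w : E3 → ℝ) (Dw : Fin 3 → E3 → ℝ) (D2w : Fin 3 → Fin 3 → E3 → ℝ) : Prop where
  memLp : MemLp w 2 volume
  memLp_D : ∀ i, MemLp (Dw i) 2 volume
  memLp_D2 : ∀ i j, MemLp (D2w i j) 2 volume
  weak_D : ∀ i, IsWeakPartial i w (Dw i)
  weak_D2 : ∀ i j, IsWeakPartial j (Dw i) (D2w i j)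

/-- The cutoff `χ(x / (n + 1))`. -/
def cutoff (n : ℕ) (x : E3) : ℝ :=
  (⟨1, 2, one_pos, one_lt_two⟩ : ContDiffBump (0 : E3)) (((n : ℝ) + 1)⁻¹ • x)

lemma contDiff_cutoff (n : ℕ) : ContDiff ℝ ∞ (cutoff n) :=
  (ContDiffBump.contDiff _).comp (contDiff_const_smul _)

lemma hasCompactSupport_cutoff (n : ℕ) : HasCompactSupport (cutoff n) := by
  have h : ((n : ℝ) + 1)⁻¹ ≠ 0 := by positivity
  exact (ContDiffBump.hasCompactSupport _).comp_homeomorph (Homeomorph.smulOfNeZero _ h)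

lemma tendsto_scale (x : E3) : Tendsto (fun n : ℕ => ((n : ℝ) + 1)⁻¹ • x) atTop (𝓝 0) := by
  have := (tendsto_one_div_add_atTop_nhds_zero_nat (𝕜 := ℝ)).smul_const x
  simpa using this

lemma tendsto_cutoff (x : E3) : Tendsto (fun n => cutoff n x) atTop (𝓝 1) := by
  have h := ((ContDiffBump.contDiff (n := 0) (⟨1, 2, one_pos, one_lt_two⟩ :
    ContDiffBump (0 : E3))).continuous.tendsto 0).comp (tendsto_scale x)
  rwa [ContDiffBump.one_of_mem_closedBall _ (by simp)] at h

lemma abs_cutoff_le (n : ℕ) (x : E3) : |cutoff n x| ≤ 1 := by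
  unfold cutoff
  rw [abs_of_nonneg (ContDiffBump.nonneg _)]
  exact ContDiffBump.le_one _

lemma pd_comp_smul {f : E3 → ℝ} (hf : ContDiff ℝ ∞ f) (c : ℝ) (i : Fin 3) (x : E3) :
    pd i (fun y => f (c • y)) x = c * pd i f (c • x) := by
  have : HasFDerivAt (fun y => f (c • y)) ((fderiv ℝ f (c • x)).comp
      (c • (ContinuousLinearMap.id ℝ E3))) x :=
    (hf.differentiable (by norm_num) (c • x)).hasFDerivAt.comp x
      ((hasFDerivAt_id x).const_smul c)
  unfold pd
  rw [this.fderiv]; simp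

lemma exists_abs_le {f : E3 → ℝ} (hf : ContDiff ℝ ∞ f) (hs : HasCompactSupport f) :
    ∃ C, ∀ x, |f x| ≤ C := by
  obtain ⟨C, hC⟩ := hs.exists_bound_of_continuous hf.continuous
  exact ⟨C, hC⟩

/-- A rescaled bounded function with a prefactor `1 / (n + 1)` is bounded and tends to zero. -/
lemma scaled_bound {m : ℕ → E3 → ℝ} {g : E3 → ℝ} {C : ℝ} (hC : ∀ x, |g x| ≤ C)
    (hm : ∀ n x, |m n x| ≤ ((n : ℝ) + 1)⁻¹ * |g (((n : ℝ) + 1)⁻¹ • x)|) :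
    (∀ n x, |m n x| ≤ C) ∧ ∀ x, Tendsto (fun n => m n x) atTop (𝓝 0) := by
  have hC0 : 0 ≤ C := (abs_nonneg _).trans (hC 0)
  have h1 : ∀ n x, |m n x| ≤ ((n : ℝ) + 1)⁻¹ * C := fun n x =>
    (hm n x).trans (by gcongr; exact hC _)
  refine ⟨fun n x => (h1 n x).trans ?_, fun x => squeeze_zero_norm (fun n => h1 n x) ?_⟩
  · exact mul_le_of_le_one_left hC0 (inv_le_one_of_one_le₀ (by linarith [n.cast_nonneg (α := ℝ)]))
  · have := (tendsto_one_div_add_atTop_nhds_zero_nat (𝕜 := ℝ)).mul_const C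
    simpa using this

/-- All cutoffs are dilates of `cutoff 0`, so each derivative brings a factor 1/(n + 1). This makes
the terms in which a derivative hits the cutoff vanish in the limit. -/
lemma pd_cutoff (n : ℕ) (i : Fin 3) (x : E3) :
    pd i (cutoff n) x = ((n : ℝ) + 1)⁻¹ * pd i (cutoff 0) (((n : ℝ) + 1)⁻¹ • x) := by
  have := pd_comp_smul (contDiff_cutoff 0) ((n : ℝ) + 1)⁻¹ i x
  rw [← this]
  congr 1
  ext y; simp [cutoff]

lemma pd_pd_cutoff (n : ℕ) (i j : Fin 3) (x : E3) :
    pd j (pd i (cutoff n)) x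
      = ((n : ℝ) + 1)⁻¹ * (((n : ℝ) + 1)⁻¹ * pd j (pd i (cutoff 0)) (((n : ℝ) + 1)⁻¹ • x)) := by
  have h1 : pd i (cutoff n)
      = fun y => ((n : ℝ) + 1)⁻¹ * pd i (cutoff 0) (((n : ℝ) + 1)⁻¹ • y) := by
    ext y; exact pd_cutoff n i y
  rw [← pd_comp_smul (contDiff_pd (contDiff_cutoff 0) i), h1]
  unfold pd
  rw [fderiv_const_mul]
  · simp
  · exact (((contDiff_pd (contDiff_cutoff 0) i).comp (contDiff_const_smul _)).differentiable
      (by norm_num)) x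

lemma pd_mul {f g : E3 → ℝ} (hf : ContDiff ℝ ∞ f) (hg : ContDiff ℝ ∞ g) (i : Fin 3) (x : E3) :
    pd i (fun y => f y * g y) x = f x * pd i g x + g x * pd i f x := by
  unfold pd
  have := fderiv_fun_mul (hf.differentiable (by norm_num) x) (hg.differentiable (by norm_num) x)
  rw [this]; simp

lemma pd_add {f g : E3 → ℝ} (hf : ContDiff ℝ ∞ f) (hg : ContDiff ℝ ∞ g) (i : Fin 3) (x : E3) :
    pd i (fun y => f y + g y) x = pd i f x + pd i g x := by
  unfold pd
  have := fderiv_fun_add (hf.differentiable (by norm_num) x) (hg.differentiable (by norm_num) x)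
  rw [this]; simp

/-- Density of `C_c^∞` in `H²`. -/
theorem IsRealH2.exists_smooth_seq {w : E3 → ℝ} {Dw : Fin 3 → E3 → ℝ}
    {D2w : Fin 3 → Fin 3 → E3 → ℝ} (h : IsRealH2 w Dw D2w) :
    ∃ φ : ℕ → E3 → ℝ, (∀ n, ContDiff ℝ ∞ (φ n)) ∧ (∀ n, HasCompactSupport (φ n)) ∧
      TendstoL2 φ w ∧ (∀ i, TendstoL2 (fun n => pd i (φ n)) (Dw i)) ∧
      (∀ i j, TendstoL2 (fun n => pd j (pd i (φ n))) (D2w i j)) ∧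
      (Continuous w → ∀ x, Tendsto (fun n => φ n x) atTop (𝓝 (w x))) := by
  have loc : ∀ {u : E3 → ℝ}, MemLp u 2 volume → LocallyIntegrable u volume := fun hu =>
    hu.locallyIntegrable (by norm_num)
  choose C₁ hC₁ using fun i => exists_abs_le (contDiff_pd (contDiff_cutoff 0) i)
    (hasCompactSupport_pd (hasCompactSupport_cutoff 0) i)
  choose C₂ hC₂ using fun i j => exists_abs_le (contDiff_pd (contDiff_pd (contDiff_cutoff 0) i) j)
    (hasCompactSupport_pd (hasCompactSupport_pd (hasCompactSupport_cutoff 0) i) j)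
  have hc1 : ∀ i, (∀ n x, |pd i (cutoff n) x| ≤ C₁ i) ∧
      ∀ x, Tendsto (fun n => pd i (cutoff n) x) atTop (𝓝 0) := fun i => by
    refine scaled_bound (hC₁ i) fun n x => ?_
    rw [pd_cutoff, abs_mul, abs_of_nonneg (by positivity : (0 : ℝ) ≤ ((n : ℝ) + 1)⁻¹)]
  have hc2 : ∀ i j, (∀ n x, |pd j (pd i (cutoff n)) x| ≤ C₂ i j) ∧
      ∀ x, Tendsto (fun n => pd j (pd i (cutoff n)) x) atTop (𝓝 0) := fun i j => by
    refine scaled_bound (hC₂ i j) fun n x => ?_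
    have hn : (0 : ℝ) ≤ ((n : ℝ) + 1)⁻¹ := by positivity
    rw [pd_pd_cutoff, abs_mul, abs_mul, abs_of_nonneg hn]
    refine mul_le_mul_of_nonneg_left (mul_le_of_le_one_left (abs_nonneg _)
      (inv_le_one_of_one_le₀ (by linarith [n.cast_nonneg (α := ℝ)]))) hn
  have hme : ∀ {f : E3 → ℝ}, ContDiff ℝ ∞ f → AEStronglyMeasurable f volume := fun hf =>
    hf.continuous.aestronglyMeasurable
  have m0 : ∀ {u : E3 → ℝ}, MemLp u 2 volume →
      TendstoL2 (fun n x => cutoff n x * moll n u x) u := fun {u} hu => by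
    have := (tendstoL2_moll hu).bdd_mul (m := cutoff) (m' := fun _ => 1) (C := 1)
      (fun n => hme (contDiff_cutoff n)) (fun n => Eventually.of_forall (abs_cutoff_le n))
      (Eventually.of_forall tendsto_cutoff)
    simpa using this
  have m1 : ∀ {u : E3 → ℝ} (i : Fin 3), MemLp u 2 volume →
      TendstoL2 (fun n x => pd i (cutoff n) x * moll n u x) (fun _ => 0) := fun {u} i hu => by
    have := (tendstoL2_moll hu).bdd_mul (m := fun n => pd i (cutoff n)) (m' := fun _ => 0)
      (fun n => hme (contDiff_pd (contDiff_cutoff n) i))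
      (fun n => Eventually.of_forall ((hc1 i).1 n)) (Eventually.of_forall (hc1 i).2)
    simpa using this
  have m2 : ∀ {u : E3 → ℝ} (i j : Fin 3), MemLp u 2 volume →
      TendstoL2 (fun n x => pd j (pd i (cutoff n)) x * moll n u x) (fun _ => 0) :=
    fun {u} i j hu => by
      have := (tendstoL2_moll hu).bdd_mul (m := fun n => pd j (pd i (cutoff n))) (m' := fun _ => 0)
        (fun n => hme (contDiff_pd (contDiff_pd (contDiff_cutoff n) i) j))
        (fun n => Eventually.of_forall ((hc2 i j).1 n)) (Eventually.of_forall (hc2 i j).2)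
      simpa using this
  have s0 : ∀ n, ContDiff ℝ ∞ (moll n w) := fun n => contDiff_moll n (loc h.memLp)
  have s1 : ∀ n i, ContDiff ℝ ∞ (moll n (Dw i)) := fun n i => contDiff_moll n (loc (h.memLp_D i))
  have d1 : ∀ n i, pd i (fun x => cutoff n x * moll n w x)
      = fun x => cutoff n x * moll n (Dw i) x + pd i (cutoff n) x * moll n w x := fun n i => by
    ext x
    rw [pd_mul (contDiff_cutoff n) (s0 n), pd_moll n (h.weak_D i), mul_comm (moll n w x)]
  have d2 : ∀ n i j, pd j (pd i (fun x => cutoff n x * moll n w x))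
      = fun x => (cutoff n x * moll n (D2w i j) x + pd j (cutoff n) x * moll n (Dw i) x)
        + (pd i (cutoff n) x * moll n (Dw j) x + pd j (pd i (cutoff n)) x * moll n w x) :=
    fun n i j => by
      ext x
      rw [d1]
      have hA : ContDiff ℝ ∞ fun x => cutoff n x * moll n (Dw i) x :=
        (contDiff_cutoff n).mul (s1 n i)
      have hB : ContDiff ℝ ∞ fun x => pd i (cutoff n) x * moll n w x :=
        (contDiff_pd (contDiff_cutoff n) i).mul (s0 n)
      rw [pd_add hA hB, pd_mul (contDiff_cutoff n) (s1 n i),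
        pd_mul (contDiff_pd (contDiff_cutoff n) i) (s0 n), pd_moll n (h.weak_D2 i j),
        pd_moll n (h.weak_D j), mul_comm (moll n w x), mul_comm (moll n (Dw i) x)]
  refine ⟨fun n x => cutoff n x * moll n w x, fun n => (contDiff_cutoff n).mul (s0 n),
    fun n => (hasCompactSupport_cutoff n).mul_right, m0 h.memLp, fun i => ?_, fun i j => ?_,
    fun hw x => ?_⟩
  · simp only [d1]
    simpa using (m0 (h.memLp_D i)).add (m1 i h.memLp)
  · simp only [d2]
    simpa using ((m0 (h.memLp_D2 i j)).add (m1 j (h.memLp_D i))).add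
      ((m1 i (h.memLp_D j)).add (m2 i j h.memLp))
  -- Convergence at every point, not just almost everywhere, is needed later because spheres are
  -- null sets.
  · have := (tendsto_cutoff x).mul (ContDiffBump.convolution_tendsto_right_of_continuous
      (μ := (volume : Measure E3)) tendsto_mollBump_rOut hw x)
    simpa [moll] using this

end Morawetz

/-! ### Weighted divergence identities for test functions. -/

namespace Morawetz

open Filter Topology

/-- `f` has partial derivative `f'` at `x` in the `i`-th coordinate. -/
def HasPd (i : Fin 3) (f : E3 → ℝ) (f' : ℝ) (x : E3) : Prop :=
  HasLineDerivAt ℝ f f' x (EuclideanSpace.single i 1)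

namespace HasPd

variable {i : Fin 3} {f g : E3 → ℝ} {f' g' : ℝ} {x : E3}

lemma mul (hf : HasPd i f f' x) (hg : HasPd i g g' x) :
    HasPd i (fun y => f y * g y) (f' * g x + f x * g') x := by
  have := HasDerivAt.fun_mul hf hg
  simpa [HasPd, HasLineDerivAt] using this

lemma add (hf : HasPd i f f' x) (hg : HasPd i g g' x) :
    HasPd i (fun y => f y + g y) (f' + g') x := HasDerivAt.fun_add hf hg

lemma sub (hf : HasPd i f f' x) (hg : HasPd i g g' x) :
    HasPd i (fun y => f y - g y) (f' - g') x := HasDerivAt.fun_sub hf hg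

lemma const_mul (c : ℝ) (hf : HasPd i f f' x) : HasPd i (fun y => c * f y) (c * f') x :=
  HasDerivAt.const_mul c hf

lemma pow (hf : HasPd i f f' x) (n : ℕ) :
    HasPd i (fun y => f y ^ n) (n * f x ^ (n - 1) * f') x := by
  have := HasDerivAt.fun_pow hf n
  simpa [HasPd, HasLineDerivAt] using this

lemma coord (k : Fin 3) : HasPd i (fun y : E3 => y k) (if k = i then 1 else 0) x := by
  have h : HasFDerivAt (fun y : E3 => y k) (EuclideanSpace.proj k : E3 →L[ℝ] ℝ) x :=
    (EuclideanSpace.proj k : E3 →L[ℝ] ℝ).hasFDerivAt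
  have h2 := h.hasLineDerivAt (EuclideanSpace.single i 1)
  simpa [HasPd, Pi.single_apply] using h2

lemma of_contDiff (hf : ContDiff ℝ ∞ f) (i : Fin 3) (x : E3) : HasPd i f (pd i f x) x :=
  ((hf.differentiable (by norm_num)) x).hasFDerivAt.hasLineDerivAt _

lemma pd_eq (h : HasPd i f f' x) (hf : ContDiff ℝ ∞ f) : pd i f x = f' :=
  (of_contDiff hf i x).unique h

end HasPd

lemma norm_sq_eq (x : E3) : ‖x‖ ^ 2 = x 0 ^ 2 + x 1 ^ 2 + x 2 ^ 2 := by
  rw [EuclideanSpace.norm_sq_eq, Fin.sum_univ_three]; simp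

/-- The weight `(|x|² + ρ²)^{-1/2}`. -/
def wt (ρ : ℝ) (x : E3) : ℝ := (Real.sqrt (‖x‖ ^ 2 + ρ ^ 2))⁻¹

section wt

variable {ρ : ℝ} (hρ : 0 < ρ) (x : E3)
include hρ

lemma wt_pos : 0 < wt ρ x := by unfold wt; positivity

/-- The one algebraic relation between weight and radius. Together with the derivative of `wt`, it
reduces the divergence computations to polynomial identities. -/
lemma wt_sq_mul : wt ρ x ^ 2 * (‖x‖ ^ 2 + ρ ^ 2) = 1 := by
  have h : 0 < ‖x‖ ^ 2 + ρ ^ 2 := by positivity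
  rw [wt, inv_pow, Real.sq_sqrt h.le, inv_mul_cancel₀ h.ne']

lemma norm_mul_wt_le : ‖x‖ * wt ρ x ≤ 1 := by
  have h := wt_sq_mul hρ x
  have := wt_pos hρ x
  have h2 : (‖x‖ * wt ρ x) ^ 2 ≤ 1 := by nlinarith [sq_nonneg (wt ρ x * ρ)]
  exact (abs_le_one_iff_mul_self_le_one.2 (by nlinarith)).trans' (le_abs_self _)

lemma wt_mul_le : wt ρ x * ρ ≤ 1 := by
  have h := wt_sq_mul hρ x
  have h2 : (wt ρ x * ρ) ^ 2 ≤ 1 := by nlinarith [sq_nonneg (wt ρ x * ‖x‖)]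
  exact (abs_le_one_iff_mul_self_le_one.2 (by nlinarith)).trans' (le_abs_self _)

lemma contDiff_wt : ContDiff ℝ ∞ (wt ρ) := by
  refine ContDiff.inv (ContDiff.sqrt ((contDiff_norm_sq ℝ).add contDiff_const) fun x => ?_)
    fun x => ?_ <;> positivity

lemma hasPd_wt (i : Fin 3) : HasPd i (wt ρ) (-x i * wt ρ x ^ 3) x := by
  have h0 : 0 < ‖x‖ ^ 2 + ρ ^ 2 := by positivity
  have h1 : HasFDerivAt (fun y : E3 => ‖y‖ ^ 2) (2 • innerSL ℝ x) x :=
    (hasStrictFDerivAt_norm_sq x).hasFDerivAt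
  have h2 := (h1.hasLineDerivAt (EuclideanSpace.single i 1))
  have h3 : HasDerivAt (fun t : ℝ => ‖x + t • EuclideanSpace.single i (1 : ℝ)‖ ^ 2 + ρ ^ 2)
      (2 * x i) 0 := by
    have := HasDerivAt.add_const (ρ ^ 2) h2
    simpa [HasLineDerivAt, EuclideanSpace.inner_single_right] using this
  have h4 := (h3.sqrt (by simpa using h0.ne')).fun_inv (by simpa using (Real.sqrt_pos.2 h0).ne')
  have h5 : -x i * wt ρ x ^ 3 = -(2 * x i / (2 * √(‖x + (0 : ℝ) • EuclideanSpace.single i (1 : ℝ)‖ ^ 2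
      + ρ ^ 2))) / √(‖x + (0 : ℝ) • EuclideanSpace.single i (1 : ℝ)‖ ^ 2 + ρ ^ 2) ^ 2 := by
    simp only [zero_smul, add_zero, wt]
    have := (Real.sqrt_pos.2 h0).ne'
    field_simp
  rw [h5]
  exact h4

end wt

lemma integral_pd_eq_zero {F : E3 → ℝ} (hF : ContDiff ℝ ∞ F) (hs : HasCompactSupport F)
    (i : Fin 3) : ∫ x, pd i F x = 0 := by
  have h1 : Integrable (pd i F) volume :=
    (contDiff_pd hF i).continuous.integrable_of_hasCompactSupport (hasCompactSupport_pd hs i)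
  have h2 : Integrable F volume := hF.continuous.integrable_of_hasCompactSupport hs
  have := integral_mul_fderiv_eq_neg_fderiv_mul_of_integrable (μ := (volume : Measure E3))
    (f := fun _ => (1 : ℝ)) (g := F) (v := EuclideanSpace.single i 1) (by simp)
    (by simpa [pd, funext_iff] using (show Integrable (fun x => pd i F x) volume from h1)) (by simpa using h2) (fun x _ => by fun_prop)
    (fun x _ => hF.differentiable (by norm_num) x)
  simpa [pd] using this

/-- The divergence theorem for compactly supported vector fields. -/
lemma integral_sum_pd_eq_zero {F : Fin 3 → E3 → ℝ} (hF : ∀ i, ContDiff ℝ ∞ (F i))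
    (hs : ∀ i, HasCompactSupport (F i)) : ∫ x, ∑ i, pd i (F i) x = 0 := by
  rw [integral_finsetSum]
  · simp [integral_pd_eq_zero (hF _) (hs _)]
  · exact fun i _ =>
      (contDiff_pd (hF i) i).continuous.integrable_of_hasCompactSupport (hasCompactSupport_pd (hs i) i)

lemma pd_comm {φ : E3 → ℝ} (hφ : ContDiff ℝ ∞ φ) (i j : Fin 3) (x : E3) :
    pd j (pd i φ) x = pd i (pd j φ) x := by
  have h : ∀ i j, pd j (pd i φ) x = fderiv ℝ (fderiv ℝ φ) x (EuclideanSpace.single j 1)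
      (EuclideanSpace.single i 1) := fun i j => by
    have hd : DifferentiableAt ℝ (fderiv ℝ φ) x :=
      (hφ.fderiv_right (m := ∞) (by norm_cast)).differentiable (by norm_num) x
    change fderiv ℝ (fun y => fderiv ℝ φ y (EuclideanSpace.single i 1)) x _ = _
    rw [fderiv_clm_apply hd (by fun_prop)]
    simp
  rw [h, h]
  exact (hφ.contDiffAt.isSymmSndFDerivAt (by simp; norm_cast)).eq _ _

/-- `x · ∇φ`. -/
def radial (φ : E3 → ℝ) (x : E3) : ℝ := ∑ i, x i * pd i φ x

/-- `|∇φ|²`. -/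
def gradSq (φ : E3 → ℝ) (x : E3) : ℝ := ∑ i, pd i φ x ^ 2

/-- `Δφ`. -/
def lap (φ : E3 → ℝ) (x : E3) : ℝ := ∑ i, pd i (pd i φ) x

lemma contDiff_coord (i : Fin 3) : ContDiff ℝ ∞ (fun x : E3 => x i) :=
  (EuclideanSpace.proj i : E3 →L[ℝ] ℝ).contDiff

section smooth

variable {φ : E3 → ℝ} (hφ : ContDiff ℝ ∞ φ)
include hφ

lemma contDiff_radial : ContDiff ℝ ∞ (radial φ) :=
  ContDiff.sum fun i _ => (contDiff_coord i).mul (contDiff_pd hφ i)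

lemma contDiff_gradSq : ContDiff ℝ ∞ (gradSq φ) :=
  ContDiff.sum fun i _ => (contDiff_pd hφ i).pow 2

lemma contDiff_lap : ContDiff ℝ ∞ (lap φ) :=
  ContDiff.sum fun i _ => contDiff_pd (contDiff_pd hφ i) i

lemma hasPd_radial (i : Fin 3) (x : E3) :
    HasPd i (radial φ) (pd i φ x + ∑ k, x k * pd i (pd k φ) x) x := by
  have h : HasPd i (fun y => y 0 * pd 0 φ y + y 1 * pd 1 φ y + y 2 * pd 2 φ y) _ x :=
    (((HasPd.coord 0).mul (HasPd.of_contDiff (contDiff_pd hφ 0) i x)).add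
      ((HasPd.coord 1).mul (HasPd.of_contDiff (contDiff_pd hφ 1) i x))).add
      ((HasPd.coord 2).mul (HasPd.of_contDiff (contDiff_pd hφ 2) i x))
  convert h using 1
  · ext y; simp [radial, Fin.sum_univ_three]
  · rw [Fin.sum_univ_three]
    fin_cases i <;> simp <;> ring

lemma hasPd_gradSq (i : Fin 3) (x : E3) :
    HasPd i (gradSq φ) (2 * ∑ k, pd k φ x * pd i (pd k φ) x) x := by
  have h : HasPd i (fun y => pd 0 φ y ^ 2 + pd 1 φ y ^ 2 + pd 2 φ y ^ 2) _ x :=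
    (((HasPd.of_contDiff (contDiff_pd hφ 0) i x).pow 2).add
      ((HasPd.of_contDiff (contDiff_pd hφ 1) i x).pow 2)).add
      ((HasPd.of_contDiff (contDiff_pd hφ 2) i x).pow 2)
  convert h using 1
  · ext y; simp [gradSq, Fin.sum_univ_three]
  · rw [Fin.sum_univ_three]; push_cast; ring

end smooth

variable {φ : E3 → ℝ}

/-- The Morawetz identity for the multiplier `2 (|x|² + ρ²)^{-1/2} (x·∇φ + φ)`. -/
lemma integral_morawetz (hφ : ContDiff ℝ ∞ φ) (hs : HasCompactSupport φ) {ρ : ℝ} (hρ : 0 < ρ) :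
    ∫ x, (2 * lap φ x * (wt ρ x * (radial φ x + φ x))
      + ((wt ρ x + ‖x‖ ^ 2 * wt ρ x ^ 3) * gradSq φ x - 2 * wt ρ x ^ 3 * radial φ x ^ 2
        + 3 * ρ ^ 2 * wt ρ x ^ 5 * φ x ^ 2)) = 0 := by
  have hq := contDiff_wt hρ
  -- With q = `wt ρ`, the field 2q(x·∇φ + φ)∇φ - q|∇φ|²x leaves the cross term -2q³φ(x·∇φ) in its
  -- divergence. Adding q³φ²x cancels it, and div(q³x) = 3ρ²q⁵ supplies the positive zero-order
  -- term.
  let F : Fin 3 → E3 → ℝ := fun i x =>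
    2 * (wt ρ x * ((radial φ x + φ x) * pd i φ x)) - wt ρ x * (x i * gradSq φ x)
      + wt ρ x ^ 3 * (x i * φ x ^ 2)
  have hF : ∀ i, ContDiff ℝ ∞ (F i) := fun i =>
    ((contDiff_const.mul (hq.mul (((contDiff_radial hφ).add hφ).mul (contDiff_pd hφ i)))).sub
      (hq.mul ((contDiff_coord i).mul (contDiff_gradSq hφ)))).add
      ((hq.pow 3).mul ((contDiff_coord i).mul (hφ.pow 2)))
  have hp : ∀ i, ∀ x ∉ tsupport φ, pd i φ x = 0 := fun i x hx =>
    image_eq_zero_of_notMem_tsupport fun h =>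
      hx (tsupport_fderiv_apply_subset ℝ (EuclideanSpace.single i 1) h)
  have hFs : ∀ i, HasCompactSupport (F i) := fun i =>
    HasCompactSupport.intro hs fun x hx => by
      simp [F, hp _ x hx, image_eq_zero_of_notMem_tsupport hx, gradSq]
  rw [← integral_sum_pd_eq_zero hF hFs]
  refine integral_congr_ae (Eventually.of_forall fun x => ?_)
  have hd : ∀ i, pd i (F i) x = _ := fun i => HasPd.pd_eq
    ((((hasPd_wt hρ x i).mul (((hasPd_radial hφ i x).add (HasPd.of_contDiff hφ i x)).mul
      (HasPd.of_contDiff (contDiff_pd hφ i) i x))).const_mul 2 |>.sub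
      ((hasPd_wt hρ x i).mul ((HasPd.coord i).mul (hasPd_gradSq hφ i x)))).add
      (((hasPd_wt hρ x i).pow 3).mul ((HasPd.coord i).mul ((HasPd.of_contDiff hφ i x).pow 2))))
    (hF i)
  have hw := wt_sq_mul hρ x
  simp only [hd, Fin.sum_univ_three, lap, gradSq, radial, norm_sq_eq] at hw ⊢
  rw [pd_comm hφ 1 0, pd_comm hφ 2 0, pd_comm hφ 2 1]
  push_cast
  linear_combination (3 * wt ρ x ^ 3 * φ x ^ 2) * hw

/-- The divergence of `(|x|² + ρ²)^{-1} x φ²` integrates to zero. -/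
lemma integral_hardy (hφ : ContDiff ℝ ∞ φ) (hs : HasCompactSupport φ) {ρ : ℝ} (hρ : 0 < ρ) :
    ∫ x, ((3 * wt ρ x ^ 2 - 2 * ‖x‖ ^ 2 * wt ρ x ^ 4) * φ x ^ 2
      + 2 * wt ρ x ^ 2 * φ x * radial φ x) = 0 := by
  have hq := contDiff_wt hρ
  let F : Fin 3 → E3 → ℝ := fun i x => wt ρ x ^ 2 * (x i * φ x ^ 2)
  have hF : ∀ i, ContDiff ℝ ∞ (F i) := fun i =>
    (hq.pow 2).mul ((contDiff_coord i).mul (hφ.pow 2))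
  have hFs : ∀ i, HasCompactSupport (F i) := fun i =>
    HasCompactSupport.intro hs fun x hx => by
      simp [F, image_eq_zero_of_notMem_tsupport hx]
  rw [← integral_sum_pd_eq_zero hF hFs]
  refine integral_congr_ae (Eventually.of_forall fun x => ?_)
  have hd : ∀ i, pd i (F i) x = _ := fun i => HasPd.pd_eq
    (((hasPd_wt hρ x i).pow 2).mul ((HasPd.coord i).mul ((HasPd.of_contDiff hφ i x).pow 2)))
    (hF i)
  simp only [hd, Fin.sum_univ_three, radial, norm_sq_eq]
  push_cast
  ring

lemma radial_sq_le (x : E3) : radial φ x ^ 2 ≤ ‖x‖ ^ 2 * gradSq φ x := by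
  rw [EuclideanSpace.norm_sq_eq]
  simpa [radial, gradSq] using Finset.sum_mul_sq_le_sq_mul_sq Finset.univ (fun i => x i)
    (fun i => pd i φ x)

lemma gradSq_nonneg (x : E3) : 0 ≤ gradSq φ x := Finset.sum_nonneg fun _ _ => sq_nonneg _

/-- Regularised Hardy inequality, with a constant independent of ρ. In `integral_hardy` the
coefficient of φ² is at least q². Completing the square gives 2q²φ(x·∇φ) ≥ -q²φ²/2 - 2q²(x·∇φ)², and
the last term is at least -2|∇φ|². -/
lemma integral_wt_sq_le (hφ : ContDiff ℝ ∞ φ) (hs : HasCompactSupport φ) {ρ : ℝ} (hρ : 0 < ρ) :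
    ∫ x, wt ρ x ^ 2 * φ x ^ 2 ≤ 4 * ∫ x, gradSq φ x := by
  have hp : ∀ i, ∀ x ∉ tsupport φ, pd i φ x = 0 := fun i x hx =>
    image_eq_zero_of_notMem_tsupport fun h =>
      hx (tsupport_fderiv_apply_subset ℝ (EuclideanSpace.single i 1) h)
  have hcq := (contDiff_wt hρ).continuous
  have i1 : Integrable (fun x => wt ρ x ^ 2 * φ x ^ 2) volume :=
    ((hcq.pow 2).mul (hφ.continuous.pow 2)).integrable_of_hasCompactSupport
      (HasCompactSupport.intro hs fun x hx => by simp [image_eq_zero_of_notMem_tsupport hx])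
  have i2 : Integrable (gradSq φ) volume :=
    (contDiff_gradSq hφ).continuous.integrable_of_hasCompactSupport
      (HasCompactSupport.intro hs fun x hx => by simp [gradSq, hp _ x hx])
  have i3 : Integrable (fun x => (3 * wt ρ x ^ 2 - 2 * ‖x‖ ^ 2 * wt ρ x ^ 4) * φ x ^ 2
      + 2 * wt ρ x ^ 2 * φ x * radial φ x) volume := by
    have := (contDiff_radial hφ).continuous
    have := hφ.continuous
    refine Continuous.integrable_of_hasCompactSupport (by fun_prop)
      (HasCompactSupport.intro hs fun x hx => by simp [image_eq_zero_of_notMem_tsupport hx])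
  have h : ∫ x, ((1 / 2) * (wt ρ x ^ 2 * φ x ^ 2) - 2 * gradSq φ x) ≤ 0 := by
    rw [← integral_hardy hφ hs hρ]
    refine integral_mono ((i1.const_mul _).sub (i2.const_mul _)) i3 fun x => ?_
    have hw := wt_sq_mul hρ x
    have hr := radial_sq_le (φ := φ) x
    have hg := gradSq_nonneg (φ := φ) x
    have h1 : wt ρ x ^ 2 * radial φ x ^ 2 ≤ gradSq φ x := by
      have h2 : wt ρ x ^ 2 * ‖x‖ ^ 2 ≤ 1 := by nlinarith [sq_nonneg (wt ρ x * ρ)]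
      calc _ ≤ wt ρ x ^ 2 * (‖x‖ ^ 2 * gradSq φ x) := by gcongr
        _ = (wt ρ x ^ 2 * ‖x‖ ^ 2) * gradSq φ x := by ring
        _ ≤ _ := mul_le_of_le_one_left hg h2
    have h3 : ‖x‖ ^ 2 * wt ρ x ^ 4 * φ x ^ 2 ≤ wt ρ x ^ 2 * φ x ^ 2 := by
      have h2 : wt ρ x ^ 2 * ‖x‖ ^ 2 ≤ 1 := by nlinarith [sq_nonneg (wt ρ x * ρ)]
      calc _ = (wt ρ x ^ 2 * ‖x‖ ^ 2) * (wt ρ x ^ 2 * φ x ^ 2) := by ring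
        _ ≤ _ := mul_le_of_le_one_left (by positivity) h2
    nlinarith [sq_nonneg (wt ρ x * φ x / 2 + wt ρ x * radial φ x), h1, h3]
  rw [integral_sub (i1.const_mul _) (i2.const_mul _), integral_const_mul, integral_const_mul] at h
  linarith

/-- The radial identity for a weakly differentiable coefficient. -/
lemma integral_coeff (hφ : ContDiff ℝ ∞ φ) (hs : HasCompactSupport φ) {ρ : ℝ} (hρ : 0 < ρ)
    {a : E3 → ℝ} {Da : Fin 3 → E3 → ℝ} (ha : ∀ i, IsWeakPartial i a (Da i)) :
    Integrable (fun x => (2 * (wt ρ x * (radial φ x + φ x)) * φ x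
      + ρ ^ 2 * wt ρ x ^ 3 * φ x ^ 2) * a x) volume ∧
    Integrable (fun x => wt ρ x * φ x ^ 2 * ∑ i, x i * Da i x) volume ∧
    ∫ x, (2 * (wt ρ x * (radial φ x + φ x)) * φ x + ρ ^ 2 * wt ρ x ^ 3 * φ x ^ 2) * a x
      = - ∫ x, wt ρ x * φ x ^ 2 * ∑ i, x i * Da i x := by
  have hq := contDiff_wt hρ
  -- The divergence of qφ²x is the factor of a in the claim, since 3q - |x|²q³ = 2q + ρ²q³. Each
  -- component is a test function, so the weak derivatives of a apply directly.
  let F : Fin 3 → E3 → ℝ := fun i x => wt ρ x * (x i * φ x ^ 2)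
  have hF : ∀ i, ContDiff ℝ ∞ (F i) := fun i => hq.mul ((contDiff_coord i).mul (hφ.pow 2))
  have hFs : ∀ i, HasCompactSupport (F i) := fun i =>
    HasCompactSupport.intro hs fun x hx => by
      simp [F, image_eq_zero_of_notMem_tsupport hx]
  have j1 : ∀ i, Integrable (fun x => pd i (F i) x * a x) volume := fun i =>
    (ha 0).locInt.integrable_smul_left_of_hasCompactSupport (contDiff_pd (hF i) i).continuous
      (hasCompactSupport_pd (hFs i) i)
  have j2 : ∀ i, Integrable (fun x => F i x * Da i x) volume := fun i =>
    (ha i).locInt_deriv.integrable_smul_left_of_hasCompactSupport (hF i).continuous (hFs i)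
  have e1 : ∀ x, ∑ i, pd i (F i) x * a x
      = (2 * (wt ρ x * (radial φ x + φ x)) * φ x + ρ ^ 2 * wt ρ x ^ 3 * φ x ^ 2) * a x := by
    intro x
    have hd : ∀ i, pd i (F i) x = _ := fun i => HasPd.pd_eq
      ((hasPd_wt hρ x i).mul ((HasPd.coord i).mul ((HasPd.of_contDiff hφ i x).pow 2)))
      (hF i)
    have hw := wt_sq_mul hρ x
    simp only [hd, Fin.sum_univ_three, radial, norm_sq_eq] at hw ⊢
    push_cast
    linear_combination (-wt ρ x * φ x ^ 2 * a x) * hw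
  have e2 : ∀ x, ∑ i, F i x * Da i x = wt ρ x * φ x ^ 2 * ∑ i, x i * Da i x := by
    intro x
    rw [Finset.mul_sum]
    exact Finset.sum_congr rfl fun i _ => by simp only [F]; ring
  have k1 := integrable_finsetSum Finset.univ fun i _ => j1 i
  have k2 := integrable_finsetSum Finset.univ fun i _ => j2 i
  have s1 := integral_finsetSum Finset.univ fun i _ => j1 i
  have s2 := integral_finsetSum Finset.univ fun i _ => j2 i
  simp only [e1] at k1 s1
  simp only [e2] at k2 s2
  refine ⟨k1, k2, ?_⟩
  rw [s1, s2, ← Finset.sum_neg_distrib]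
  exact Finset.sum_congr rfl fun i _ => (ha i).integral_eq _ (hF i) (hFs i)

end Morawetz

/-! ### Hardy's inequality in H². -/

namespace Morawetz

open Filter Topology

variable {w : E3 → ℝ} {Dw : Fin 3 → E3 → ℝ} {D2w : Fin 3 → Fin 3 → E3 → ℝ}

namespace TendstoL2

variable {f : ℕ → E3 → ℝ} {g : E3 → ℝ}

lemma sub_const (h : TendstoL2 f g) {u : E3 → ℝ} (hu : MemLp u 2 volume) :
    TendstoL2 (fun n x => f n x - u x) (fun x => g x - u x) := by
  simpa [sub_eq_add_neg] using h.add ((const hu).const_mul (-1))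

lemma integral_sq (h : TendstoL2 f g) :
    Tendsto (fun n => ∫ x, f n x ^ 2) atTop (𝓝 (∫ x, g x ^ 2)) := by
  simpa [sq] using h.integral_mul h

lemma of_integral_sq (hf : ∀ n, MemLp (f n) 2 volume) (hg : MemLp g 2 volume)
    (h : Tendsto (fun n => ∫ x, (f n x - g x) ^ 2) atTop (𝓝 0)) : TendstoL2 f g := by
  refine ⟨hf, hg, ?_⟩
  have h1 : ∀ n, eLpNorm (f n - g) 2 volume
      = ENNReal.ofReal ((∫ x, (f n x - g x) ^ 2) ^ (1 / 2 : ℝ)) := fun n => by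
    rw [MemLp.eLpNorm_eq_integral_rpow_norm (by norm_num) (by norm_num) ((hf n).sub hg)]
    simp
  simp only [h1]
  have h2 := h.rpow_const (p := 1 / 2) (Or.inr (by norm_num))
  rw [Real.zero_rpow (by norm_num)] at h2
  simpa using ENNReal.tendsto_ofReal h2

end TendstoL2

lemma isWeakPartial_of_contDiff {f : E3 → ℝ} (hf : ContDiff ℝ ∞ f) (i : Fin 3) :
    IsWeakPartial i f (pd i f) where
  locInt := hf.continuous.locallyIntegrable
  locInt_deriv := (contDiff_pd hf i).continuous.locallyIntegrable
  integral_eq φ hφ hs := by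
    have hc := (contDiff_pd hφ i).continuous
    have hc' := (contDiff_pd hf i).continuous
    have h := integral_mul_fderiv_eq_neg_fderiv_mul_of_integrable (μ := (volume : Measure E3))
      (f := φ) (g := f) (v := EuclideanSpace.single i 1)
      ((hc.mul hf.continuous).integrable_of_hasCompactSupport (hasCompactSupport_pd hs i).mul_right)
      ((hφ.continuous.mul hc').integrable_of_hasCompactSupport hs.mul_right)
      ((hφ.continuous.mul hf.continuous).integrable_of_hasCompactSupport hs.mul_right)
      (fun x _ => hφ.differentiable (by norm_num) x) (fun x _ => hf.differentiable (by norm_num) x)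
    simp only [smul_eq_mul, pd]
    rw [h, neg_neg]

lemma memLp_of_smooth {φ : E3 → ℝ} (hφ : Continuous φ) (hs : HasCompactSupport φ) :
    MemLp φ 2 volume := hφ.memLp_of_hasCompactSupport hs

/-- Allows Hardy's inequality to be applied to the difference between an H² function and its smooth
approximants. -/
lemma isRealH2_of_smooth {φ : E3 → ℝ} (hφ : ContDiff ℝ ∞ φ) (hs : HasCompactSupport φ) :
    IsRealH2 φ (fun i => pd i φ) (fun i j => pd j (pd i φ)) where
  memLp := memLp_of_smooth hφ.continuous hs
  memLp_D i := memLp_of_smooth (contDiff_pd hφ i).continuous (hasCompactSupport_pd hs i)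
  memLp_D2 i j := memLp_of_smooth (contDiff_pd (contDiff_pd hφ i) j).continuous
    (hasCompactSupport_pd (hasCompactSupport_pd hs i) j)
  weak_D i := isWeakPartial_of_contDiff hφ i
  weak_D2 i j := isWeakPartial_of_contDiff (contDiff_pd hφ i) j

lemma IsWeakPartial.sub {i : Fin 3} {u v u' v' : E3 → ℝ} (h : IsWeakPartial i u u')
    (h' : IsWeakPartial i v v') :
    IsWeakPartial i (fun x => u x - v x) (fun x => u' x - v' x) where
  locInt := h.locInt.sub h'.locInt
  locInt_deriv := h.locInt_deriv.sub h'.locInt_deriv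
  integral_eq φ hφ hs := by
    have hc := (contDiff_pd hφ i).continuous
    have hcs := hasCompactSupport_pd hs i
    simp only [smul_sub]
    have e := integral_sub (h.locInt.integrable_smul_left_of_hasCompactSupport hc hcs)
      (h'.locInt.integrable_smul_left_of_hasCompactSupport hc hcs)
    simp only [pd] at e
    rw [e, integral_sub (h.locInt_deriv.integrable_smul_left_of_hasCompactSupport hφ.continuous hs)
        (h'.locInt_deriv.integrable_smul_left_of_hasCompactSupport hφ.continuous hs),
      h.integral_eq φ hφ hs, h'.integral_eq φ hφ hs]
    ring

lemma IsRealH2.sub {u : E3 → ℝ} {Du : Fin 3 → E3 → ℝ} {D2u : Fin 3 → Fin 3 → E3 → ℝ}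
    (h : IsRealH2 w Dw D2w) (h' : IsRealH2 u Du D2u) :
    IsRealH2 (fun x => w x - u x) (fun i x => Dw i x - Du i x)
      (fun i j x => D2w i j x - D2u i j x) :=
  ⟨h.memLp.sub h'.memLp, fun i => (h.memLp_D i).sub (h'.memLp_D i),
    fun i j => (h.memLp_D2 i j).sub (h'.memLp_D2 i j), fun i => (h.weak_D i).sub (h'.weak_D i),
    fun i j => (h.weak_D2 i j).sub (h'.weak_D2 i j)⟩

lemma wt_le_inv {ρ : ℝ} (hρ : 0 < ρ) (x : E3) : |wt ρ x| ≤ ρ⁻¹ := by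
  rw [abs_of_pos (wt_pos hρ x), ← one_div, le_div_iff₀ hρ]
  exact wt_mul_le hρ x

lemma tendsto_integral_gradSq {φ : ℕ → E3 → ℝ}
    (h1 : ∀ i, TendstoL2 (fun n => pd i (φ n)) (Dw i)) :
    Tendsto (fun n => ∫ x, gradSq (φ n) x) atTop (𝓝 (∑ i, ∫ x, Dw i x ^ 2)) := by
  have : ∀ n, ∫ x, gradSq (φ n) x = ∑ i, ∫ x, pd i (φ n) x ^ 2 := fun n => by
    unfold gradSq
    exact integral_finsetSum _ fun i _ => ((h1 i).memLp n).integrable_sq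
  simp only [this]
  exact tendsto_finsetSum _ fun i _ => (h1 i).integral_sq

/-- Hardy's inequality. -/
theorem IsRealH2.hardy (h : IsRealH2 w Dw D2w) :
    MemLp (fun x => w x / ‖x‖) 2 volume ∧
      ∫ x, (w x / ‖x‖) ^ 2 ≤ 4 * ∑ i, ∫ x, Dw i x ^ 2 := by
  obtain ⟨φ, hφ, hs, h0, h1, -, -⟩ := h.exists_smooth_seq
  -- The bound is uniform in ρ, so Fatou's lemma along ρ = 1/(n + 1) reaches the singular weight
  -- 1/|x|.
  have hreg : ∀ ρ : ℝ, 0 < ρ → ∫ x, (wt ρ x * w x) ^ 2 ≤ 4 * ∑ i, ∫ x, Dw i x ^ 2 :=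
    fun ρ hρ => by
      have e := (h0.weight (contDiff_wt hρ).continuous.aestronglyMeasurable
        (Eventually.of_forall (wt_le_inv hρ))).integral_sq
      refine le_of_tendsto_of_tendsto' e ((tendsto_integral_gradSq h1).const_mul 4) fun n => ?_
      simpa [mul_pow] using integral_wt_sq_le (hφ n) (hs n) hρ
  have hm : AEStronglyMeasurable (fun x : E3 => w x / ‖x‖) volume :=
    (h.memLp.1.aemeasurable.div (by fun_prop)).aestronglyMeasurable
  have hne : ∀ᵐ x : E3, x ≠ 0 := by simp [ae_iff]
  set B := 4 * ∑ i, ∫ x, Dw i x ^ 2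
  have hpt : ∀ᵐ x : E3, Tendsto (fun n : ℕ => ENNReal.ofReal ((wt (1 / ((n : ℝ) + 1)) x * w x) ^ 2))
      atTop (𝓝 (ENNReal.ofReal ((w x / ‖x‖) ^ 2))) := by
    filter_upwards [hne] with x hx
    refine ENNReal.tendsto_ofReal (Tendsto.pow ?_ 2)
    rw [div_eq_inv_mul]
    refine Tendsto.mul_const _ ?_
    unfold wt
    rw [show ‖x‖⁻¹ = (Real.sqrt (‖x‖ ^ 2 + 0 ^ 2))⁻¹ by simp]
    refine Tendsto.inv₀ ?_ (by simpa using hx)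
    exact (((tendsto_one_div_add_atTop_nhds_zero_nat (𝕜 := ℝ)).pow 2).const_add _).sqrt
  have hl : ∫⁻ x, ENNReal.ofReal ((w x / ‖x‖) ^ 2) ≤ ENNReal.ofReal B := by
    calc ∫⁻ x, ENNReal.ofReal ((w x / ‖x‖) ^ 2)
        = ∫⁻ x, liminf (fun n : ℕ => ENNReal.ofReal ((wt (1 / ((n : ℝ) + 1)) x * w x) ^ 2)) atTop :=
          lintegral_congr_ae (by filter_upwards [hpt] with x hx using hx.liminf_eq.symm)
      _ ≤ liminf (fun n : ℕ => ∫⁻ x, ENNReal.ofReal ((wt (1 / ((n : ℝ) + 1)) x * w x) ^ 2)) atTop :=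
          lintegral_liminf_le' fun n => (((contDiff_wt (by positivity)).continuous.measurable.aemeasurable.mul
            h.memLp.1.aemeasurable).pow_const 2).ennreal_ofReal
      _ ≤ liminf (fun _ : ℕ => ENNReal.ofReal B) atTop := by
          refine liminf_le_liminf (Eventually.of_forall fun n => ?_)
          have hn : (0 : ℝ) < 1 / ((n : ℝ) + 1) := by positivity
          rw [← ofReal_integral_eq_lintegral_ofReal]
          · exact ENNReal.ofReal_le_ofReal (hreg _ hn)
          · exact (((TendstoL2.const h.memLp).weight (contDiff_wt hn).continuous.aestronglyMeasurable
              (Eventually.of_forall (wt_le_inv hn))).memLp_lim).integrable_sq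
          · exact Eventually.of_forall fun x => sq_nonneg _
      _ = ENNReal.ofReal B := by simp
  have hmem : MemLp (fun x => w x / ‖x‖) 2 volume := by
    rw [memLp_two_iff_integrable_sq hm]
    refine ⟨hm.pow 2, ?_⟩
    rw [hasFiniteIntegral_iff_ofReal (Eventually.of_forall fun x => sq_nonneg _)]
    exact hl.trans_lt ENNReal.ofReal_lt_top
  refine ⟨hmem, ?_⟩
  have hB : 0 ≤ B := mul_nonneg (by norm_num)
    (Finset.sum_nonneg fun i _ => integral_nonneg fun x => sq_nonneg _)
  rw [← ofReal_integral_eq_lintegral_ofReal hmem.integrable_sq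
    (Eventually.of_forall fun x => sq_nonneg _)] at hl
  exact (ENNReal.ofReal_le_ofReal_iff hB).1 hl

/-- Approximation in `H²` implies approximation of `w / |x|` in `L²`. -/
lemma IsRealH2.tendstoL2_div_norm (h : IsRealH2 w Dw D2w) {φ : ℕ → E3 → ℝ}
    (hφ : ∀ n, ContDiff ℝ ∞ (φ n)) (hs : ∀ n, HasCompactSupport (φ n))
    (h1 : ∀ i, TendstoL2 (fun n => pd i (φ n)) (Dw i)) :
    TendstoL2 (fun n x => φ n x / ‖x‖) (fun x => w x / ‖x‖) := by
  have hn := fun n => isRealH2_of_smooth (hφ n) (hs n)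
  refine TendstoL2.of_integral_sq (fun n => (hn n).hardy.1) h.hardy.1 ?_
  have hlim : Tendsto (fun n => 4 * ∑ i, ∫ x, (pd i (φ n) x - Dw i x) ^ 2) atTop (𝓝 0) := by
    have : Tendsto (fun n => 4 * ∑ i, ∫ x, (pd i (φ n) x - Dw i x) ^ 2) atTop
        (𝓝 (4 * ∑ i, ∫ x, (Dw i x - Dw i x) ^ 2)) :=
      (tendsto_finsetSum _ fun i _ => ((h1 i).sub_const (h.memLp_D i)).integral_sq).const_mul 4
    simpa using this
  refine squeeze_zero (fun n => integral_nonneg fun x => sq_nonneg _) (fun n => ?_) hlim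
  -- Hardy for φ_n - w converts convergence of the gradients into convergence of the quotients by
  -- |x|.
  have := ((hn n).sub h).hardy.2
  simpa only [sub_div] using this

end Morawetz

/-! ### The Morawetz estimate with dyadic multipliers. -/

namespace Morawetz

open Filter Topology

/-- The hypotheses on the coefficient `a`. -/
structure IsCoeff (α M : ℝ) (a : E3 → ℝ) (Da : Fin 3 → E3 → ℝ) : Prop where
  pos : 0 < α
  weak : ∀ i, IsWeakPartial i a (Da i)
  bounds : ∀ᵐ x, α ≤ a x ∧ a x ≤ M
  dyadic : normL1Linfty (fun x => bra ‖x‖ * (a x)⁻¹ * radialDerivNeg Da x) ≤ ENNReal.ofReal (1 / 4)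

lemma bra_pos (r : ℝ) : 0 < bra r := by unfold bra; positivity

lemma bra_sq (r : ℝ) : bra r ^ 2 = 1 + r ^ 2 := Real.sq_sqrt (by positivity)

lemma one_le_bra (r : ℝ) : 1 ≤ bra r := by
  have := bra_sq r
  nlinarith [bra_pos r, sq_nonneg r]

lemma le_bra (r : ℝ) : r ≤ bra r := by
  have := bra_sq r
  nlinarith [bra_pos r, sq_nonneg r]

variable {α M : ℝ} {a : E3 → ℝ} {Da : Fin 3 → E3 → ℝ}

lemma measurableSet_shell (j : ℕ) : MeasurableSet (shell j) := by
  cases j with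
  | zero => exact measurableSet_le measurable_norm measurable_const
  | succ j =>
    exact MeasurableSet.inter (measurableSet_le measurable_const measurable_norm)
      (measurableSet_le measurable_norm measurable_const)

/-- Dyadic bounds for the negative part of the radial derivative. -/
lemma IsCoeff.exists_dyadic (h : IsCoeff α M a Da) : ∃ c : ℕ → ℝ, (∀ j, 0 ≤ c j) ∧
    (∀ N, ∑ j ∈ Finset.range N, c j ≤ 1 / 4) ∧
    ∀ᵐ x, ∀ j, x ∈ shell j → bra ‖x‖ * radialDerivNeg Da x ≤ c j * a x := by
  set w : E3 → ℝ := fun x => bra ‖x‖ * (a x)⁻¹ * radialDerivNeg Da x with hw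
  have hfin : ∀ j, eLpNorm w ⊤ (volume.restrict (shell j)) ≠ ⊤ := fun j =>
    ((ENNReal.le_tsum j).trans_lt (h.dyadic.trans_lt ENNReal.ofReal_lt_top)).ne
  refine ⟨fun j => (eLpNorm w ⊤ (volume.restrict (shell j))).toReal,
    fun j => ENNReal.toReal_nonneg, fun N => ?_, ?_⟩
  · rw [← ENNReal.toReal_sum fun j _ => hfin j]
    have := (ENNReal.sum_le_tsum (Finset.range N)).trans h.dyadic
    have h2 := ENNReal.toReal_mono ENNReal.ofReal_ne_top this
    rwa [ENNReal.toReal_ofReal (by norm_num)] at h2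
  · have h1 : ∀ j, ∀ᵐ x, x ∈ shell j →
        ‖w x‖ₑ ≤ eLpNorm w ⊤ (volume.restrict (shell j)) := fun j => by
      rw [← ae_restrict_iff' (measurableSet_shell j), eLpNorm_exponent_top]
      exact ae_le_eLpNormEssSup
    filter_upwards [ae_all_iff.2 h1, h.bounds] with x hx hax j hj
    have ha : 0 < a x := h.pos.trans_le hax.1
    have h2 := ENNReal.toReal_mono (hfin j) (hx j hj)
    rw [toReal_enorm, Real.norm_eq_abs] at h2
    have h3 := (le_abs_self _).trans h2
    calc bra ‖x‖ * radialDerivNeg Da x = w x * a x := by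
          rw [hw]; field_simp
      _ ≤ _ := by gcongr

lemma exists_mem_shell {x : E3} {N : ℕ} (hx : ‖x‖ ≤ 2 ^ N) : ∃ j ≤ N, x ∈ shell j := by
  induction N with
  | zero => exact ⟨0, le_rfl, by simpa [shell] using hx⟩
  | succ N ih =>
    rcases le_total ‖x‖ (2 ^ N) with h | h
    · obtain ⟨j, hj, hx⟩ := ih h
      exact ⟨j, by omega, hx⟩
    · exact ⟨N + 1, le_rfl, h, hx⟩

/-- On the `j`-th shell the multiplier with parameter `2^j` compensates the decay of `a`. -/
lemma shell_weight {x : E3} {j : ℕ} (hx : x ∈ shell j) :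
    6 ≤ 20 * ((2 : ℝ) ^ j) ^ 2 * wt (2 ^ j) x ^ 3 * bra ‖x‖ := by
  have hρ : (0 : ℝ) < 2 ^ j := by positivity
  set ρ : ℝ := 2 ^ j with hρdef
  have hq := wt_pos hρ x
  have hw := wt_sq_mul hρ x
  have hb := bra_pos ‖x‖
  have hb2 := bra_sq ‖x‖
  have hn := norm_nonneg x
  have hx' : ‖x‖ ≤ ρ ∧ ρ ^ 2 ≤ 4 * bra ‖x‖ ^ 2 ∧ (ρ ^ 2 ≤ 4 * ‖x‖ ^ 2 ∨ ρ = 1) := by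
    cases j with
    | zero => 
      have : ‖x‖ ≤ 1 := hx
      have h1 : ρ = 1 := by simp [hρdef]
      rw [h1]
      exact ⟨this, by nlinarith, Or.inr rfl⟩
    | succ j =>
      obtain ⟨h1, h2⟩ : (2 : ℝ) ^ j ≤ ‖x‖ ∧ ‖x‖ ≤ (2 : ℝ) ^ (j + 1) := hx
      have h3 : ρ = 2 * 2 ^ j := by rw [hρdef, pow_succ]; ring
      have h4 : (0 : ℝ) < 2 ^ j := by positivity
      exact ⟨h2, by rw [h3]; nlinarith, Or.inl (by rw [h3]; nlinarith)⟩
  obtain ⟨h1, -, h3⟩ := hx'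
  set s := ‖x‖ ^ 2 + ρ ^ 2 with hs
  have hs0 : 0 < s := by positivity
  set A := 20 * ρ ^ 2 * wt ρ x ^ 3 * bra ‖x‖ with hA
  have hA0 : 0 < A := by positivity
  have hA2 : A ^ 2 * s ^ 3 = 400 * ρ ^ 4 * bra ‖x‖ ^ 2 := by
    have : wt ρ x ^ 6 * s ^ 3 = 1 := by
      calc wt ρ x ^ 6 * s ^ 3 = (wt ρ x ^ 2 * s) ^ 3 := by ring
        _ = 1 := by rw [hw]; norm_num
    rw [hA]
    linear_combination (400 * ρ ^ 4 * bra ‖x‖ ^ 2) * this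
  -- Squaring removes the roots: with u = |x|² and v = ρ² the claim becomes 36(u + v)³ ≤ 400v²(1 +
  -- u). For j ≥ 1 it follows from v/4 ≤ u ≤ v; for j = 0 from v = 1 and u ≤ 1.
  have key : 36 * s ^ 3 ≤ 400 * ρ ^ 4 * bra ‖x‖ ^ 2 := by
    rw [hb2, hs]
    have h1' : ‖x‖ ^ 2 ≤ ρ ^ 2 := by gcongr
    set u := ‖x‖ ^ 2 with hu
    set v := ρ ^ 2 with hv
    have hu0 : 0 ≤ u := sq_nonneg _
    have hv0 : 0 ≤ v := sq_nonneg _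
    have e : ρ ^ 4 = v ^ 2 := by rw [hv]; ring
    rw [e]
    rcases h3 with h3 | h3
    · have h5 : 0 ≤ (v - u) * (4 * u - v) := mul_nonneg (by linarith) (by linarith)
      have h6 : 36 * (u + v) ^ 3 ≤ 400 * v ^ 2 * u := by
        nlinarith [mul_nonneg hv0 h5, mul_nonneg hu0 h5, mul_nonneg hv0 (sq_nonneg (v-u)),
          mul_nonneg hu0 (sq_nonneg (v - u)), mul_nonneg (mul_nonneg hu0 hv0) (by linarith : 0 ≤ v - u)]
      nlinarith [sq_nonneg v]
    · have hv1 : v = 1 := by rw [hv, h3]; norm_num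
      rw [hv1] at h1' ⊢
      nlinarith [mul_nonneg hu0 hu0, mul_nonneg hu0 (by linarith : 0 ≤ 1 - u),
        mul_nonneg (mul_nonneg hu0 hu0) (by linarith : 0 ≤ 1 - u)]
  have h7 : 36 * s ^ 3 ≤ A ^ 2 * s ^ 3 := by rw [hA2]; exact key
  have h8 : 36 ≤ A ^ 2 := le_of_mul_le_mul_right h7 (by positivity)
  nlinarith

lemma neg_radialDerivNeg_le (x : E3) :
    -(‖x‖ * radialDerivNeg Da x) ≤ ∑ i, x i * Da i x := by
  rcases eq_or_ne x 0 with rfl | hx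
  · simp
  have hn : 0 < ‖x‖ := norm_pos_iff.2 hx
  have h1 : -∑ i, (x i / ‖x‖) * Da i x ≤ radialDerivNeg Da x := le_max_left _ _
  have h2 : ‖x‖ * ∑ i, (x i / ‖x‖) * Da i x = ∑ i, x i * Da i x := by
    rw [Finset.mul_sum]
    exact Finset.sum_congr rfl fun i _ => by field_simp
  nlinarith

/-- The integrand of the Morawetz estimate for the multiplier with parameter `ρ`. -/
def morawetzDensity (a : E3 → ℝ) (Da : Fin 3 → E3 → ℝ) (κ ρ : ℝ) (φ : E3 → ℝ) (x : E3) : ℝ :=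
  2 * (lap φ x + κ * a x * φ x) * (wt ρ x * (radial φ x + φ x))
    + ρ ^ 2 * wt ρ x ^ 3 * gradSq φ x + 3 * ρ ^ 2 * wt ρ x ^ 5 * φ x ^ 2
    + κ * ((ρ ^ 2 * wt ρ x ^ 3 * a x + wt ρ x * ∑ i, x i * Da i x) * φ x ^ 2)

variable {φ : E3 → ℝ}

lemma pd_eq_zero {x : E3} (hx : x ∉ tsupport φ) (i : Fin 3) : pd i φ x = 0 :=
  image_eq_zero_of_notMem_tsupport fun h =>
    hx (tsupport_fderiv_apply_subset ℝ (EuclideanSpace.single i 1) h)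

lemma notMem_tsupport_pd {x : E3} (hx : x ∉ tsupport φ) (i : Fin 3) : x ∉ tsupport (pd i φ) :=
  fun h => hx (tsupport_fderiv_apply_subset ℝ (EuclideanSpace.single i 1) h)

lemma lap_eq_zero {x : E3} (hx : x ∉ tsupport φ) : lap φ x = 0 :=
  Finset.sum_eq_zero fun i _ => pd_eq_zero (notMem_tsupport_pd hx i) i

lemma radial_eq_zero {x : E3} (hx : x ∉ tsupport φ) : radial φ x = 0 :=
  Finset.sum_eq_zero fun i _ => by rw [pd_eq_zero hx, mul_zero]

lemma gradSq_eq_zero {x : E3} (hx : x ∉ tsupport φ) : gradSq φ x = 0 :=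
  Finset.sum_eq_zero fun i _ => by rw [pd_eq_zero hx]; norm_num

/-- Adds κ times the coefficient identity to the Morawetz identity. The only loss is (x·∇φ)² ≤
|x|²|∇φ|², which leaves (q - |x|²q³)|∇φ|² = ρ²q³|∇φ|² with q = `wt ρ`. -/
lemma integral_morawetzDensity (hφ : ContDiff ℝ ∞ φ) (hs : HasCompactSupport φ)
    (ha : ∀ i, IsWeakPartial i a (Da i)) (κ : ℝ) {ρ : ℝ} (hρ : 0 < ρ) :
    Integrable (morawetzDensity a Da κ ρ φ) volume ∧
      ∫ x, morawetzDensity a Da κ ρ φ x ≤ 0 := by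
  obtain ⟨j1, j2, e⟩ := integral_coeff hφ hs hρ ha
  have hcq := (contDiff_wt hρ).continuous
  have hcr := (contDiff_radial hφ).continuous
  have hcg := (contDiff_gradSq hφ).continuous
  have hcl := (contDiff_lap hφ).continuous
  have hc := hφ.continuous
  set f1 : E3 → ℝ := fun x => 2 * lap φ x * (wt ρ x * (radial φ x + φ x))
    + (ρ ^ 2 * wt ρ x ^ 3 * gradSq φ x + 3 * ρ ^ 2 * wt ρ x ^ 5 * φ x ^ 2) with hf1
  have i1 : Integrable f1 volume :=
    Continuous.integrable_of_hasCompactSupport (by fun_prop) (HasCompactSupport.intro hs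
      fun x hx => by
        simp [hf1, lap_eq_zero hx, gradSq_eq_zero hx, image_eq_zero_of_notMem_tsupport hx])
  have i2 : Integrable (fun x => 2 * lap φ x * (wt ρ x * (radial φ x + φ x))
      + ((wt ρ x + ‖x‖ ^ 2 * wt ρ x ^ 3) * gradSq φ x - 2 * wt ρ x ^ 3 * radial φ x ^ 2
        + 3 * ρ ^ 2 * wt ρ x ^ 5 * φ x ^ 2)) volume :=
    Continuous.integrable_of_hasCompactSupport (by fun_prop) (HasCompactSupport.intro hs
      fun x hx => by
        simp [lap_eq_zero hx, gradSq_eq_zero hx, radial_eq_zero hx,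
          image_eq_zero_of_notMem_tsupport hx])
  have l1 : ∫ x, f1 x ≤ 0 := by
    rw [← integral_morawetz hφ hs hρ]
    refine integral_mono i1 i2 fun x => ?_
    have hw := wt_sq_mul hρ x
    have hq := wt_pos hρ x
    have hr := radial_sq_le (φ := φ) x
    have h1 : wt ρ x ^ 3 * radial φ x ^ 2 ≤ wt ρ x ^ 3 * (‖x‖ ^ 2 * gradSq φ x) := by gcongr
    have h2 : ρ ^ 2 * wt ρ x ^ 3 = wt ρ x - ‖x‖ ^ 2 * wt ρ x ^ 3 := by
      linear_combination (wt ρ x) * hw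
    simp only [hf1, h2]
    nlinarith
  have hE : morawetzDensity a Da κ ρ φ = fun x => f1 x
      + κ * ((2 * (wt ρ x * (radial φ x + φ x)) * φ x + ρ ^ 2 * wt ρ x ^ 3 * φ x ^ 2) * a x
        + wt ρ x * φ x ^ 2 * ∑ i, x i * Da i x) := by
    ext x; simp only [morawetzDensity, hf1]; ring
  have j12 : Integrable (fun x => (2 * (wt ρ x * (radial φ x + φ x)) * φ x
      + ρ ^ 2 * wt ρ x ^ 3 * φ x ^ 2) * a x + wt ρ x * φ x ^ 2 * ∑ i, x i * Da i x) volume :=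
    j1.add j2
  have e3 := integral_add i1 (j12.const_mul κ)
  rw [integral_const_mul, integral_add j1 j2, e, neg_add_cancel, mul_zero, add_zero] at e3
  rw [hE]
  exact ⟨i1.add (j12.const_mul κ), e3.trans_le l1⟩

/-- Collects the equation term and the x·∇a term under the total weight, since both are linear in
`wt`. The uncontrolled sign of x·∇a then has to be beaten only once. -/
lemma sum_morawetzDensity (a : E3 → ℝ) (Da : Fin 3 → E3 → ℝ) (κ R : ℝ) (φ : E3 → ℝ) (x : E3)
    (s : Finset ℕ) (d ρ : ℕ → ℝ) :
    morawetzDensity a Da κ R φ x + ∑ j ∈ s, d j * morawetzDensity a Da κ (ρ j) φ x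
      = 2 * (lap φ x + κ * (a x * φ x))
          * ((wt R x + ∑ j ∈ s, d j * wt (ρ j) x) * (radial φ x + φ x))
        + (R ^ 2 * wt R x ^ 3 * (gradSq φ x + κ * (a x * φ x ^ 2))
          + 3 * R ^ 2 * wt R x ^ 5 * φ x ^ 2)
        + ∑ j ∈ s, d j * (ρ j ^ 2 * wt (ρ j) x ^ 3 * gradSq φ x
            + 3 * ρ j ^ 2 * wt (ρ j) x ^ 5 * φ x ^ 2)
        + κ * φ x ^ 2 * (a x * ∑ j ∈ s, d j * (ρ j ^ 2 * wt (ρ j) x ^ 3)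
          + (wt R x + ∑ j ∈ s, d j * wt (ρ j) x) * ∑ i, x i * Da i x) := by
  unfold morawetzDensity
  set S := ∑ i, x i * Da i x
  set T := radial φ x + φ x
  have e : ∀ j, d j * (2 * (lap φ x + κ * a x * φ x) * (wt (ρ j) x * T)
      + ρ j ^ 2 * wt (ρ j) x ^ 3 * gradSq φ x + 3 * ρ j ^ 2 * wt (ρ j) x ^ 5 * φ x ^ 2
      + κ * ((ρ j ^ 2 * wt (ρ j) x ^ 3 * a x + wt (ρ j) x * S) * φ x ^ 2))
      = (2 * (lap φ x + κ * a x * φ x) * T + κ * φ x ^ 2 * S) * (d j * wt (ρ j) x)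
        + d j * (ρ j ^ 2 * wt (ρ j) x ^ 3 * gradSq φ x
          + 3 * ρ j ^ 2 * wt (ρ j) x ^ 5 * φ x ^ 2)
        + (κ * φ x ^ 2 * a x) * (d j * (ρ j ^ 2 * wt (ρ j) x ^ 3)) := fun j => by ring
  rw [Finset.sum_congr rfl fun j _ => e j, Finset.sum_add_distrib, Finset.sum_add_distrib,
    ← Finset.mul_sum, ← Finset.mul_sum]
  ring

/-- `|∂₁w| + |∂₂w| + |∂₃w| + |w| / |x|`. -/
def energyDensity (w : E3 → ℝ) (Dw : Fin 3 → E3 → ℝ) (x : E3) : ℝ :=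
  ∑ i, |Dw i x| + |w x / ‖x‖|

lemma energyDensity_nonneg (w : E3 → ℝ) (Dw : Fin 3 → E3 → ℝ) (x : E3) :
    0 ≤ energyDensity w Dw x :=
  add_nonneg (Finset.sum_nonneg fun _ _ => abs_nonneg _) (abs_nonneg _)

lemma IsRealH2.memLp_energyDensity {w : E3 → ℝ} {Dw : Fin 3 → E3 → ℝ}
    {D2w : Fin 3 → Fin 3 → E3 → ℝ} (h : IsRealH2 w Dw D2w) :
    MemLp (energyDensity w Dw) 2 volume :=
  (memLp_finsetSum Finset.univ fun i _ => (h.memLp_D i).abs).add h.hardy.1.abs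

/-- The factor |x| extracted here is what the total weight of the multipliers compensates. -/
lemma abs_radial_add_le {x : E3} (hx : x ≠ 0) :
    |radial φ x + φ x| ≤ ‖x‖ * energyDensity φ (fun i => pd i φ) x := by
  have hn : 0 < ‖x‖ := norm_pos_iff.2 hx
  have h1 : |radial φ x| ≤ ∑ i, ‖x‖ * |pd i φ x| := by
    refine (Finset.abs_sum_le_sum_abs _ _).trans (Finset.sum_le_sum fun i _ => ?_)
    rw [abs_mul]
    gcongr
    simpa using PiLp.norm_apply_le x i
  have h2 : |φ x| = ‖x‖ * |φ x / ‖x‖| := by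
    rw [abs_div, abs_norm]; field_simp
  calc |radial φ x + φ x| ≤ |radial φ x| + |φ x| := abs_add_le _ _
    _ ≤ ∑ i, ‖x‖ * |pd i φ x| + ‖x‖ * |φ x / ‖x‖| := by rw [← h2]; gcongr
    _ = _ := by rw [energyDensity, mul_add, Finset.mul_sum]

lemma IsCoeff.memLp_mul (h : IsCoeff α M a Da) {f : E3 → ℝ} (hf : MemLp f 2 volume) :
    MemLp (fun x => a x * f x) 2 volume :=
  ((TendstoL2.const hf).weight (C := M) (h.weak 0).locInt.aestronglyMeasurable (by
    filter_upwards [h.bounds] with x hx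
    rw [abs_of_pos (h.pos.trans_le hx.1)]; exact hx.2)).memLp_lim

/-- The pointwise lower bound behind the Morawetz estimate. -/
lemma le_sum_morawetzDensity {x : E3} (hx0 : x ≠ 0) (ha : 0 < a x) {κ : ℝ} (hκ : 0 ≤ κ) {R : ℝ}
    (hR : 0 < R) {c : ℕ → ℝ} (hc0 : ∀ j, 0 ≤ c j) (s : Finset ℕ) (hcs : ∑ j ∈ s, c j ≤ 1 / 4)
    {j : ℕ} (hjs : j ∈ s) (hj : x ∈ shell j) (hcx : bra ‖x‖ * radialDerivNeg Da x ≤ c j * a x) :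
    R ^ 2 * wt R x ^ 3 * (gradSq φ x + κ * (a x * φ x ^ 2)) + 3 * R ^ 2 * wt R x ^ 5 * φ x ^ 2
      - 12 * (|lap φ x + κ * (a x * φ x)| * energyDensity φ (fun i => pd i φ) x)
    ≤ morawetzDensity a Da κ R φ x
      + ∑ j ∈ s, 20 * c j * morawetzDensity a Da κ (2 ^ j) φ x := by
  have hn : 0 < ‖x‖ := norm_pos_iff.2 hx0
  rw [sum_morawetzDensity a Da κ R φ x s (fun j => 20 * c j) (fun j => 2 ^ j)]
  set T := radial φ x + φ x with hTdef
  set F := lap φ x + κ * (a x * φ x) with hFdef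
  set W := energyDensity φ (fun i => pd i φ) x with hWdef
  set S := ∑ i, x i * Da i x with hS
  set Q := wt R x + ∑ j ∈ s, 20 * c j * wt (2 ^ j) x with hQ
  have hpj : ∀ j : ℕ, 0 < wt (2 ^ j) x := fun j => wt_pos (by positivity) x
  have hQ0 : 0 ≤ Q := add_nonneg (wt_pos hR x).le (Finset.sum_nonneg fun j _ =>
    mul_nonneg (mul_nonneg (by norm_num) (hc0 j)) (hpj j).le)
  -- Each weight satisfies |x|q ≤ 1, so the bound is 1 + 20 · 1/4. This 6 is the one in
  -- `shell_weight`.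
  have hQn : ‖x‖ * Q ≤ 6 := by
    have h1 := norm_mul_wt_le hR x
    have h2 : ‖x‖ * ∑ j ∈ s, 20 * c j * wt (2 ^ j) x ≤ ∑ j ∈ s, 20 * c j := by
      rw [Finset.mul_sum]
      refine Finset.sum_le_sum fun j _ => ?_
      have h3 := norm_mul_wt_le (ρ := 2 ^ j) (by positivity) x
      have h4 := mul_le_mul_of_nonneg_left h3 (hc0 j)
      linarith
    have h3 : ∑ j ∈ s, 20 * c j ≤ 5 := by
      rw [← Finset.mul_sum]
      linarith
    rw [hQ, mul_add]
    linarith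
  have hW0 : 0 ≤ W := energyDensity_nonneg _ _ x
  have hQT : |Q * T| ≤ 6 * W := by
    rw [abs_mul, abs_of_nonneg hQ0]
    calc Q * |T| ≤ Q * (‖x‖ * W) := by gcongr; exact abs_radial_add_le hx0
      _ = (‖x‖ * Q) * W := by ring
      _ ≤ 6 * W := by gcongr
  have hFQT : -(12 * (|F| * W)) ≤ 2 * F * (Q * T) := by
    have h1 : |2 * F * (Q * T)| ≤ 12 * (|F| * W) := by
      rw [abs_mul, abs_mul, abs_two]
      have := mul_le_mul_of_nonneg_left hQT (abs_nonneg F)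
      linarith
    exact (abs_le.1 h1).1
  have p1 : 0 ≤ ∑ j ∈ s, 20 * c j * ((2 ^ j) ^ 2 * wt (2 ^ j) x ^ 3 * gradSq φ x
      + 3 * (2 ^ j) ^ 2 * wt (2 ^ j) x ^ 5 * φ x ^ 2) :=
    Finset.sum_nonneg fun j _ => by
      have := hc0 j
      have := hpj j
      have := gradSq_nonneg (φ := φ) x
      positivity
  -- Only the j-th summand is kept, where x lies in shell j. With m = 20·4^j·q³ and q the weight at
  -- scale 2^j, c_j m a ≥ m⟨x⟩a'_- ≥ 6a'_- ≥ |x|Q a'_- ≥ -Q(x·∇a).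
  have p2 : 0 ≤ a x * ∑ j ∈ s, 20 * c j * ((2 ^ j) ^ 2 * wt (2 ^ j) x ^ 3) + Q * S := by
    set m : ℝ := 20 * (2 ^ j) ^ 2 * wt (2 ^ j) x ^ 3 with hm
    have hm0 : 0 ≤ m := by
      have := hpj j
      positivity
    have h1 : c j * m ≤ ∑ j ∈ s, 20 * c j * ((2 ^ j) ^ 2 * wt (2 ^ j) x ^ 3) := by
      refine (Finset.single_le_sum (f := fun j => 20 * c j * ((2 ^ j) ^ 2 * wt (2 ^ j) x ^ 3))
        (fun j _ => ?_) hjs).trans' (le_of_eq (by rw [hm]; ring))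
      have := hc0 j
      have := hpj j
      positivity
    have h2 := mul_le_mul_of_nonneg_left h1 ha.le
    have h5 := mul_le_mul_of_nonneg_left (neg_radialDerivNeg_le (Da := Da) x) hQ0
    have hr0 : 0 ≤ radialDerivNeg Da x := le_max_right _ _
    have h6 := mul_le_mul_of_nonneg_right hQn hr0
    have h7 := mul_le_mul_of_nonneg_right (shell_weight hj) hr0
    have h8 := mul_le_mul_of_nonneg_left hcx hm0
    rw [← hS] at h5
    linarith
  have p3 := mul_nonneg (mul_nonneg hκ (sq_nonneg (φ x))) p2
  linarith

/-- The Morawetz estimate for test functions. -/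
theorem IsCoeff.morawetz_smooth (h : IsCoeff α M a Da) (hφ : ContDiff ℝ ∞ φ)
    (hs : HasCompactSupport φ) {κ : ℝ} (hκ : 0 ≤ κ) {R : ℝ} (hR : 0 < R) :
    ∫ x, (R ^ 2 * wt R x ^ 3 * (gradSq φ x + κ * (a x * φ x ^ 2))
      + 3 * R ^ 2 * wt R x ^ 5 * φ x ^ 2) ≤
    12 * ∫ x, |lap φ x + κ * (a x * φ x)| * energyDensity φ (fun i => pd i φ) x := by
  obtain ⟨c, hc0, hcs, hcx⟩ := h.exists_dyadic
  -- Compact support makes finitely many multipliers enough: shells 0 to N cover the support. The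
  -- constants do not depend on N, because the partial sums of c are at most 1/4.
  obtain ⟨N, hN⟩ : ∃ N : ℕ, ∀ x ∈ tsupport φ, ‖x‖ ≤ 2 ^ N := by
    obtain ⟨B, hB⟩ := hs.isBounded.exists_norm_le
    obtain ⟨N, hN⟩ := pow_unbounded_of_one_lt B (one_lt_two (α := ℝ))
    exact ⟨N, fun x hx => (hB x hx).trans hN.le⟩
  have h2 := isRealH2_of_smooth hφ hs
  have hcq := (contDiff_wt hR).continuous
  have hcg := (contDiff_gradSq hφ).continuous
  have hcl := (contDiff_lap hφ).continuous
  have hc := hφ.continuous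
  have hae : AEStronglyMeasurable a volume := (h.weak 0).locInt.aestronglyMeasurable
  have hlap : MemLp (lap φ) 2 volume :=
    memLp_of_smooth hcl (HasCompactSupport.intro hs fun x hx => lap_eq_zero hx)
  have hF : MemLp (fun x => lap φ x + κ * (a x * φ x)) 2 volume :=
    hlap.add ((h.memLp_mul h2.memLp).const_mul κ)
  have iR : Integrable (fun x => |lap φ x + κ * (a x * φ x)|
      * energyDensity φ (fun i => pd i φ) x) volume := hF.abs.integrable_mul h2.memLp_energyDensity
  have iL : Integrable (fun x => R ^ 2 * wt R x ^ 3 * (gradSq φ x + κ * (a x * φ x ^ 2))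
      + 3 * R ^ 2 * wt R x ^ 5 * φ x ^ 2) volume := by
    have k1 : Integrable (fun x => R ^ 2 * wt R x ^ 3 * gradSq φ x
        + 3 * R ^ 2 * wt R x ^ 5 * φ x ^ 2) volume :=
      Continuous.integrable_of_hasCompactSupport (by fun_prop) (HasCompactSupport.intro hs
        fun x hx => by simp [gradSq_eq_zero hx, image_eq_zero_of_notMem_tsupport hx])
    have k2 : Integrable (fun x => (R ^ 2 * wt R x ^ 3 * κ * φ x ^ 2) • a x) volume :=
      (h.weak 0).locInt.integrable_smul_left_of_hasCompactSupport (by fun_prop)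
        (HasCompactSupport.intro hs fun x hx => by simp [image_eq_zero_of_notMem_tsupport hx])
    refine (k1.add k2).congr (Eventually.of_forall fun x => ?_)
    simp only [Pi.add_apply, smul_eq_mul]; ring
  have d := fun {ρ : ℝ} (hρ : 0 < ρ) => integral_morawetzDensity hφ hs h.weak κ hρ
  have dj : ∀ j : ℕ, Integrable (fun x => 20 * c j * morawetzDensity a Da κ (2 ^ j) φ x) volume :=
    fun j => (d (by positivity)).1.const_mul _
  have iT : Integrable (fun x => morawetzDensity a Da κ R φ x
      + ∑ j ∈ Finset.range (N + 1), 20 * c j * morawetzDensity a Da κ (2 ^ j) φ x) volume :=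
    (d hR).1.add (integrable_finsetSum _ fun j _ => dj j)
  have hT : ∫ x, (morawetzDensity a Da κ R φ x
      + ∑ j ∈ Finset.range (N + 1), 20 * c j * morawetzDensity a Da κ (2 ^ j) φ x) ≤ 0 := by
    rw [integral_add (d hR).1 (integrable_finsetSum _ fun j _ => dj j),
      integral_finsetSum _ fun j _ => dj j]
    refine add_nonpos (d hR).2 (Finset.sum_nonpos fun j _ => ?_)
    rw [integral_const_mul]
    exact mul_nonpos_of_nonneg_of_nonpos (mul_nonneg (by norm_num) (hc0 j))
      (d (by positivity)).2
  have hne : ∀ᵐ x : E3, x ≠ 0 := by simp [ae_iff]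
  have hle : ∫ x, ((R ^ 2 * wt R x ^ 3 * (gradSq φ x + κ * (a x * φ x ^ 2))
      + 3 * R ^ 2 * wt R x ^ 5 * φ x ^ 2)
      - 12 * (|lap φ x + κ * (a x * φ x)| * energyDensity φ (fun i => pd i φ) x)) ≤ 0 := by
    refine (integral_mono_ae (iL.sub (iR.const_mul 12)) iT ?_).trans hT
    filter_upwards [hne, h.bounds, hcx] with x hx0 hax hcx
    by_cases hx : x ∈ tsupport φ
    · obtain ⟨j, hjN, hj⟩ := exists_mem_shell (hN x hx)
      exact le_sum_morawetzDensity hx0 (h.pos.trans_le hax.1) hκ hR hc0 _ (hcs (N + 1))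
        (Finset.mem_range.2 (by omega)) hj (hcx j hj)
    · simp [morawetzDensity, lap_eq_zero hx, gradSq_eq_zero hx, image_eq_zero_of_notMem_tsupport hx]
  rw [integral_sub iL (iR.const_mul 12), integral_const_mul] at hle
  linarith

end Morawetz

/-! ### Passage to H², Green's formula and traces on spheres. -/

namespace Morawetz

open Filter Topology

variable {w : E3 → ℝ} {Dw : Fin 3 → E3 → ℝ} {D2w : Fin 3 → Fin 3 → E3 → ℝ}
variable {α M : ℝ} {a : E3 → ℝ} {Da : Fin 3 → E3 → ℝ}

/-- The closed ball of radius `R` about the origin. -/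
abbrev cball (R : ℝ) : Set E3 := Metric.closedBall (0 : E3) R

/-- The scale invariant local energy on the ball of radius `R`. -/
def ballEnergy (a : E3 → ℝ) (κ R : ℝ) (w : E3 → ℝ) (Dw : Fin 3 → E3 → ℝ) : ℝ :=
  R⁻¹ * (∑ i, ∫ x in cball R, Dw i x ^ 2) + κ * R⁻¹ * (∫ x in cball R, a x * w x ^ 2)
    + (R ^ 3)⁻¹ * ∫ x in cball R, w x ^ 2

lemma TendstoL2.setIntegral {f : ℕ → E3 → ℝ} {g : E3 → ℝ} (h : TendstoL2 f g) {m : E3 → ℝ} {C : ℝ}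
    (hm : AEStronglyMeasurable m volume) (hb : ∀ᵐ x, |m x| ≤ C) (R : ℝ) :
    Tendsto (fun n => ∫ x in cball R, m x * f n x ^ 2) atTop
      (𝓝 (∫ x in cball R, m x * g x ^ 2)) := by
  have hB : MeasurableSet (cball R) := measurableSet_closedBall
  have h1 := (h.weight (m := (cball R).indicator m) (C := C) (hm.indicator hB) (by
    filter_upwards [hb] with x hx
    by_cases hxB : x ∈ cball R
    · simpa [hxB] using hx
    · simpa [hxB] using (abs_nonneg _).trans hx)).integral_mul h
  have e : ∀ u : E3 → ℝ, ∫ x in cball R, m x * u x ^ 2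
      = ∫ x, (cball R).indicator m x * u x * u x := fun u => by
    rw [← integral_indicator hB]
    refine integral_congr_ae (Eventually.of_forall fun x => ?_)
    by_cases hxB : x ∈ cball R
    · simp [hxB]; ring
    · simp [hxB]
  simpa only [e] using h1

/-- With t = R·`wt R x` the weights are t³/R and 3t⁵/R³. On the ball t² ≥ 1/2, hence t ≥ 7/10, which
is just enough for t³ ≥ 1/3 and t⁵ ≥ 1/6. -/
lemma inv_pow_le_wt {R : ℝ} (hR : 0 < R) {x : E3} (hx : x ∈ cball R) :
    R⁻¹ ≤ 3 * (R ^ 2 * wt R x ^ 3) ∧ (R ^ 3)⁻¹ ≤ 3 * (3 * R ^ 2 * wt R x ^ 5) := by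
  have hx' : ‖x‖ ≤ R := by simpa using hx
  have hw := wt_sq_mul hR x
  have hq := wt_pos hR x
  set t := R * wt R x with ht
  have ht0 : 0 < t := by positivity
  have h1 : 1 ≤ 2 * t ^ 2 := by
    have : ‖x‖ ^ 2 ≤ R ^ 2 := by gcongr
    nlinarith [sq_nonneg (wt R x)]
  have h2 : 7 / 10 ≤ t := by nlinarith
  have h3 : 1 / 3 ≤ t ^ 3 := by nlinarith
  have h5 : 1 / 6 ≤ t ^ 5 := by nlinarith
  have e1 : R ^ 2 * wt R x ^ 3 = t ^ 3 * R⁻¹ := by rw [ht]; field_simp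
  have e2 : R ^ 2 * wt R x ^ 5 = t ^ 5 * (R ^ 3)⁻¹ := by rw [ht]; field_simp
  have hR1 : 0 < R⁻¹ := by positivity
  have hR3 : 0 < (R ^ 3)⁻¹ := by positivity
  constructor
  · rw [e1]; nlinarith
  · rw [mul_assoc 3 (R ^ 2), e2]; nlinarith

/-- On the ball three times the Morawetz density dominates the energy density, and off the ball it
is nonnegative; 36 = 3 · 12. -/
lemma ballEnergy_smooth_le {φ : E3 → ℝ} (h : IsCoeff α M a Da) (hφ : ContDiff ℝ ∞ φ)
    (hs : HasCompactSupport φ) {κ : ℝ} (hκ : 0 ≤ κ) {R : ℝ} (hR : 0 < R) :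
    ballEnergy a κ R φ (fun i => pd i φ) ≤
      36 * ∫ x, |lap φ x + κ * (a x * φ x)| * energyDensity φ (fun i => pd i φ) x := by
  have h2 := isRealH2_of_smooth hφ hs
  have hcq := (contDiff_wt hR).continuous
  have hcg := (contDiff_gradSq hφ).continuous
  have hc := hφ.continuous
  have j1 : Integrable (gradSq φ) volume :=
    hcg.integrable_of_hasCompactSupport (HasCompactSupport.intro hs fun x hx => gradSq_eq_zero hx)
  have j2 : Integrable (fun x => a x * φ x ^ 2) volume := by
    refine ((h.memLp_mul h2.memLp).integrable_mul h2.memLp).congr (Eventually.of_forall fun x => ?_)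
    simp only [Pi.mul_apply]; ring
  have j3 : Integrable (fun x => φ x ^ 2) volume := h2.memLp.integrable_sq
  have e : ballEnergy a κ R φ (fun i => pd i φ) = ∫ x in cball R,
      (R⁻¹ * gradSq φ x + κ * R⁻¹ * (a x * φ x ^ 2) + (R ^ 3)⁻¹ * φ x ^ 2) := by
    have k1 := j1.integrableOn (s := cball R) |>.const_mul R⁻¹
    have k2 := j2.integrableOn (s := cball R) |>.const_mul (κ * R⁻¹)
    have k3 := j3.integrableOn (s := cball R) |>.const_mul (R ^ 3)⁻¹
    have k12 : Integrable (fun x => R⁻¹ * gradSq φ x + κ * R⁻¹ * (a x * φ x ^ 2))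
      (volume.restrict (cball R)) := k1.add k2
    rw [integral_add k12 k3, integral_add k1 k2, integral_const_mul, integral_const_mul,
      integral_const_mul, ballEnergy]
    unfold gradSq
    rw [integral_finsetSum _ fun i _ => ((h2.memLp_D i).integrable_sq.integrableOn)]
  have iL : Integrable (fun x => R ^ 2 * wt R x ^ 3 * (gradSq φ x + κ * (a x * φ x ^ 2))
      + 3 * R ^ 2 * wt R x ^ 5 * φ x ^ 2) volume := by
    have k1 : Integrable (fun x => R ^ 2 * wt R x ^ 3 * gradSq φ x
        + 3 * R ^ 2 * wt R x ^ 5 * φ x ^ 2) volume :=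
      Continuous.integrable_of_hasCompactSupport (by fun_prop) (HasCompactSupport.intro hs
        fun x hx => by simp [gradSq_eq_zero hx, image_eq_zero_of_notMem_tsupport hx])
    have k2 : Integrable (fun x => (R ^ 2 * wt R x ^ 3 * κ * φ x ^ 2) • a x) volume :=
      (h.weak 0).locInt.integrable_smul_left_of_hasCompactSupport (by fun_prop)
        (HasCompactSupport.intro hs fun x hx => by simp [image_eq_zero_of_notMem_tsupport hx])
    refine (k1.add k2).congr (Eventually.of_forall fun x => ?_)
    simp only [Pi.add_apply, smul_eq_mul]; ring
  have main := h.morawetz_smooth hφ hs hκ hR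
  have hpos : ∀ᵐ x, 0 ≤ R ^ 2 * wt R x ^ 3 * (gradSq φ x + κ * (a x * φ x ^ 2))
      + 3 * R ^ 2 * wt R x ^ 5 * φ x ^ 2 := by
    filter_upwards [h.bounds] with x hx
    have := h.pos.trans_le hx.1
    have := wt_pos hR x
    have := gradSq_nonneg (φ := φ) x
    positivity
  have step : ballEnergy a κ R φ (fun i => pd i φ) ≤ ∫ x in cball R,
      3 * (R ^ 2 * wt R x ^ 3 * (gradSq φ x + κ * (a x * φ x ^ 2))
        + 3 * R ^ 2 * wt R x ^ 5 * φ x ^ 2) := by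
    rw [e]
    refine integral_mono_ae ?_ (iL.integrableOn.const_mul 3) ?_
    · exact (((j1.const_mul R⁻¹).add (j2.const_mul (κ * R⁻¹))).add
        (j3.const_mul (R ^ 3)⁻¹)).integrableOn
    · filter_upwards [ae_restrict_mem measurableSet_closedBall, ae_restrict_of_ae h.bounds]
        with x hx hax
      have ha := h.pos.trans_le hax.1
      obtain ⟨h3, h5⟩ := inv_pow_le_wt hR hx
      have g0 : 0 ≤ gradSq φ x + κ * (a x * φ x ^ 2) := by
        have := gradSq_nonneg (φ := φ) x
        positivity
      have p1 := mul_le_mul_of_nonneg_right h3 g0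
      have p2 := mul_le_mul_of_nonneg_right h5 (sq_nonneg (φ x))
      linarith
  have step2 := setIntegral_le_integral (s := cball R) iL hpos
  rw [integral_const_mul] at step
  linarith

/-- The Morawetz estimate for functions in `H²`. -/
theorem IsCoeff.ballEnergy_le (h : IsCoeff α M a Da) (hw : IsRealH2 w Dw D2w) {κ : ℝ}
    (hκ : 0 ≤ κ) {R : ℝ} (hR : 0 < R) :
    ballEnergy a κ R w Dw ≤
      36 * ∫ x, |∑ i, D2w i i x + κ * (a x * w x)| * energyDensity w Dw x := by
  obtain ⟨φ, hφ, hs, h0, h1, h2, -⟩ := hw.exists_smooth_seq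
  have ham : AEStronglyMeasurable a volume := (h.weak 0).locInt.aestronglyMeasurable
  have hab : ∀ᵐ x, |a x| ≤ M := by
    filter_upwards [h.bounds] with x hx
    rw [abs_of_pos (h.pos.trans_le hx.1)]; exact hx.2
  have one : ∀ {f : ℕ → E3 → ℝ} {g : E3 → ℝ}, TendstoL2 f g →
      Tendsto (fun n => ∫ x in cball R, f n x ^ 2) atTop (𝓝 (∫ x in cball R, g x ^ 2)) :=
    fun hf => by
      simpa using hf.setIntegral (m := fun _ => 1) (C := 1) aestronglyMeasurable_const (by simp) R
  have L : Tendsto (fun n => ballEnergy a κ R (φ n) (fun i => pd i (φ n))) atTop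
      (𝓝 (ballEnergy a κ R w Dw)) :=
    ((((tendsto_finsetSum _ fun i _ => one (h1 i)).const_mul _).add
      ((h0.setIntegral ham hab R).const_mul _))).add ((one h0).const_mul _)
  have F : TendstoL2 (fun n x => |lap (φ n) x + κ * (a x * φ n x)|)
      (fun x => |∑ i, D2w i i x + κ * (a x * w x)|) :=
    ((TendstoL2.sum Finset.univ fun i _ => h2 i i).add ((h0.weight ham hab).const_mul κ)).abs
  have W : TendstoL2 (fun n x => energyDensity (φ n) (fun i => pd i (φ n)) x)
      (fun x => energyDensity w Dw x) :=
    (TendstoL2.sum Finset.univ fun i _ => (h1 i).abs).add (hw.tendstoL2_div_norm hφ hs h1).abs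
  -- The derivatives of a have disappeared from the inequality, so boundedness of a suffices for
  -- both sides to be continuous under the H² approximation.
  exact le_of_tendsto_of_tendsto' L ((F.integral_mul W).const_mul 36) fun n =>
    ballEnergy_smooth_le h (hφ n) (hs n) hκ hR

/-- Integration by parts of a weak derivative against an `H²` function. -/
lemma IsRealH2.integral_D_mul (hw : IsRealH2 w Dw D2w) {i : Fin 3} {u u' : E3 → ℝ}
    (hu : MemLp u 2 volume) (hu' : MemLp u' 2 volume) (h : IsWeakPartial i u u') :
    ∫ x, Dw i x * u x = - ∫ x, w x * u' x := by
  obtain ⟨φ, hφ, hs, h0, h1, -, -⟩ := hw.exists_smooth_seq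
  refine tendsto_nhds_unique ((h1 i).integral_mul (TendstoL2.const hu))
    (((h0.integral_mul (TendstoL2.const hu')).neg).congr fun n => ?_)
  have := h.integral_eq (φ n) (hφ n) (hs n)
  simp only [smul_eq_mul] at this
  rw [← this]
  rfl

/-- Green's formula. -/
lemma IsRealH2.integral_mul_laplacian (hw : IsRealH2 w Dw D2w) {u : E3 → ℝ} {Du : Fin 3 → E3 → ℝ}
    {D2u : Fin 3 → Fin 3 → E3 → ℝ} (hu : IsRealH2 u Du D2u) :
    ∫ x, w x * ∑ i, D2u i i x = - ∑ i, ∫ x, Dw i x * Du i x := by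
  simp only [Finset.mul_sum]
  have hi : ∀ i ∈ Finset.univ, Integrable (fun x => w x * D2u i i x) volume := fun i _ =>
    hw.memLp.integrable_mul (hu.memLp_D2 i i)
  rw [integral_finsetSum _ hi, ← Finset.sum_neg_distrib]
  refine Finset.sum_congr rfl fun i _ => ?_
  rw [hw.integral_D_mul (hu.memLp_D i) (hu.memLp_D2 i i) (hu.weak_D2 i i), neg_neg]

/-- Integration in polar coordinates. -/
lemma lintegral_polar {f : E3 → ℝ≥0∞} (hf : Measurable f) :
    ∫⁻ x, f x = ∫⁻ θ : Metric.sphere (0 : E3) 1, ∫⁻ r in Ioi (0 : ℝ),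
      ENNReal.ofReal (r ^ 2) * f (r • (θ : E3)) ∂volume ∂((volume : Measure E3).toSphere) := by
  have hne : ({(0 : E3)}ᶜ : Set E3) =ᵐ[volume] univ := by simp [ae_eq_univ]
  have hmp := (volume : Measure E3).measurePreserving_homeomorphUnitSphereProd
  have hdim : Module.finrank ℝ E3 - 1 = 2 := by simp
  rw [hdim] at hmp
  have h1 : ∫⁻ x, f x = ∫⁻ x : ({(0 : E3)}ᶜ : Set E3), f (x : E3) ∂(Measure.comap Subtype.val volume) := by
    rw [lintegral_subtype_comap (measurableSet_singleton _).compl, setLIntegral_congr hne,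
      Measure.restrict_univ]
  have h2 : ∫⁻ x : ({(0 : E3)}ᶜ : Set E3), f (x : E3) ∂(Measure.comap Subtype.val volume)
      = ∫⁻ p : Metric.sphere (0 : E3) 1 × Ioi (0 : ℝ), f ((p.2 : ℝ) • (p.1 : E3))
        ∂((volume : Measure E3).toSphere.prod (Measure.volumeIoiPow 2)) := by
    rw [← hmp.lintegral_comp (f := fun p : Metric.sphere (0 : E3) 1 × Ioi (0 : ℝ) =>
      f ((p.2 : ℝ) • (p.1 : E3)))]
    · refine lintegral_congr fun x => ?_
      congr 1
      have hx : ‖(x : E3)‖ ≠ 0 := norm_ne_zero_iff.2 x.2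
      simp [homeomorphUnitSphereProd, smul_smul, hx]
    · exact hf.comp (by fun_prop)
  rw [h1, h2, lintegral_prod]
  · refine lintegral_congr fun θ => ?_
    have hg : Measurable fun r : Ioi (0 : ℝ) => f ((r : ℝ) • (θ : E3)) := hf.comp (by fun_prop)
    have hd : Measurable fun r : Ioi (0 : ℝ) => ENNReal.ofReal ((r : ℝ) ^ 2) := by fun_prop
    rw [Measure.volumeIoiPow]
    refine (lintegral_withDensity_eq_lintegral_mul _ hd hg).trans ?_
    exact lintegral_subtype_comap measurableSet_Ioi (fun r : ℝ =>
      ENNReal.ofReal (r ^ 2) * f (r • (θ : E3)))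
  · exact (hf.comp (by fun_prop)).aemeasurable

lemma setLIntegral_cball_polar {f : E3 → ℝ≥0∞} (hf : Measurable f) (R : ℝ) :
    ∫⁻ x in cball R, f x = ∫⁻ θ : Metric.sphere (0 : E3) 1, ∫⁻ r in Ioc (0 : ℝ) R,
      ENNReal.ofReal (r ^ 2) * f (r • (θ : E3)) ∂volume ∂((volume : Measure E3).toSphere) := by
  have hB : MeasurableSet (cball R) := measurableSet_closedBall
  rw [← lintegral_indicator hB, lintegral_polar (hf.indicator hB)]
  refine lintegral_congr fun θ => ?_
  have : Ioc (0 : ℝ) R = Iic R ∩ Ioi 0 := by ext; simp [and_comm]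
  rw [this, ← Measure.restrict_restrict measurableSet_Iic, ← lintegral_indicator measurableSet_Iic]
  refine setLIntegral_congr_fun measurableSet_Ioi fun r hr => ?_
  have hr0 : 0 < r := hr
  have hn : ‖r • (θ : E3)‖ = r := by rw [norm_smul]; simp [abs_of_pos hr0]
  by_cases h : r ≤ R
  · have : r • (θ : E3) ∈ cball R := by simpa [hn] using h
    simp [this, h]
  · have : r • (θ : E3) ∉ cball R := by simpa [hn] using h
    simp [this, h]

/-- The one-dimensional trace inequality along a ray. -/
lemma trace_ray {φ : E3 → ℝ} (hφ : ContDiff ℝ ∞ φ) {θ : E3} (hθ : ‖θ‖ = 1) {R : ℝ} (hR : 0 < R) :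
    ENNReal.ofReal (R ^ 3 * φ (R • θ) ^ 2) ≤ ∫⁻ r in Ioc (0 : ℝ) R, ENNReal.ofReal (r ^ 2) *
      ENNReal.ofReal (4 * φ (r • θ) ^ 2 + R ^ 2 * gradSq φ (r • θ)) := by
  have hcg := (contDiff_gradSq hφ).continuous
  have hc := hφ.continuous
  set g : ℝ → ℝ := fun r => φ (r • θ) with hg
  set g' : ℝ → ℝ := fun r => fderiv ℝ φ (r • θ) θ with hg'
  have hd : ∀ r, HasDerivAt g (g' r) r := fun r => by
    have h1 : HasDerivAt (fun r : ℝ => r • θ) θ r := by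
      simpa using (hasDerivAt_id r).smul_const θ
    exact (hφ.differentiable (by norm_num) (r • θ)).hasFDerivAt.comp_hasDerivAt r h1
  have hgc : Continuous g := by fun_prop
  have hgc' : Continuous g' :=
    ((hφ.continuous_fderiv (by norm_num)).comp (by fun_prop)).clm_apply continuous_const
  have hgr : ∀ r, g' r ^ 2 ≤ gradSq φ (r • θ) := fun r => by
    have h1 : g' r = ∑ i, θ i * pd i φ (r • θ) := by
      have h2 : θ = ∑ i, θ i • EuclideanSpace.single i (1 : ℝ) := by
        ext k; simp [Pi.single_apply]
      have h3 : g' r = fderiv ℝ φ (r • θ) (∑ i, θ i • EuclideanSpace.single i (1 : ℝ)) := by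
        rw [← h2]
      rw [h3, map_sum]
      simp [pd]
    rw [h1]
    refine (Finset.sum_mul_sq_le_sq_mul_sq Finset.univ (fun i => θ i)
      (fun i => pd i φ (r • θ))).trans (le_of_eq ?_)
    have h4 : ∑ i, θ i ^ 2 = 1 := by
      have := EuclideanSpace.norm_sq_eq θ
      rw [hθ] at this
      simpa using this.symm
    rw [h4, one_mul, gradSq]
  -- The factor r³ kills the endpoint 0 and leaves in the derivative the polar Jacobian r² times 3g²
  -- + 2rgg', which is at most 4g² + r²g'².
  have hF : ∀ r ∈ uIcc 0 R, HasDerivAt (fun r => r ^ 3 * g r ^ 2)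
      (3 * r ^ 2 * g r ^ 2 + r ^ 3 * (2 * g r * g' r)) r := fun r _ => by
    have := ((hasDerivAt_id r).fun_pow 3).fun_mul ((hd r).fun_pow 2)
    simpa using this
  have hFTC := intervalIntegral.integral_eq_sub_of_hasDerivAt hF
    (Continuous.intervalIntegrable (by fun_prop) _ _)
  have hle : R ^ 3 * g R ^ 2 ≤ ∫ r in (0 : ℝ)..R,
      r ^ 2 * (4 * φ (r • θ) ^ 2 + R ^ 2 * gradSq φ (r • θ)) := by
    have e : R ^ 3 * g R ^ 2 = R ^ 3 * g R ^ 2 - 0 ^ 3 * g 0 ^ 2 := by ring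
    rw [e, ← hFTC]
    refine intervalIntegral.integral_mono_on hR.le (Continuous.intervalIntegrable (by fun_prop) _ _)
      (Continuous.intervalIntegrable (by fun_prop) _ _) fun r hr => ?_
    have h1 := hgr r
    have h2 : r ^ 2 ≤ R ^ 2 := by
      have := hr.1
      have := hr.2
      gcongr
    have h3 : r ^ 2 * g' r ^ 2 ≤ R ^ 2 * gradSq φ (r • θ) :=
      mul_le_mul h2 h1 (sq_nonneg _) (sq_nonneg _)
    have h4 : 2 * (r * (g r * g' r)) ≤ g r ^ 2 + r ^ 2 * g' r ^ 2 := by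
      nlinarith [sq_nonneg (g r - r * g' r)]
    have h5 : 3 * g r ^ 2 + r * (2 * g r * g' r) ≤ 4 * φ (r • θ) ^ 2 + R ^ 2 * gradSq φ (r • θ) := by
      have : g r = φ (r • θ) := rfl
      rw [← this]
      linarith
    have h6 := mul_le_mul_of_nonneg_left h5 (sq_nonneg r)
    linarith
  have hint : IntegrableOn (fun r : ℝ =>
      r ^ 2 * (4 * φ (r • θ) ^ 2 + R ^ 2 * gradSq φ (r • θ))) (Ioc 0 R) volume :=
    (intervalIntegrable_iff_integrableOn_Ioc_of_le hR.le).1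
      (Continuous.intervalIntegrable (by fun_prop) _ _)
  rw [intervalIntegral.integral_of_le hR.le] at hle
  refine (ENNReal.ofReal_le_ofReal hle).trans (le_of_eq ?_)
  rw [ofReal_integral_eq_lintegral_ofReal hint]
  · exact lintegral_congr fun r => ENNReal.ofReal_mul (sq_nonneg r)
  · refine Eventually.of_forall fun r => ?_
    have := gradSq_nonneg (φ := φ) (r • θ)
    dsimp only [Pi.zero_apply]
    positivity

/-- The trace inequality on spheres. -/
theorem IsRealH2.trace (hw : IsRealH2 w Dw D2w) (hc : Continuous w) {R : ℝ} (hR : 0 < R) :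
    ∫⁻ θ : Metric.sphere (0 : E3) 1, ENNReal.ofReal (w (R • (θ : E3)) ^ 2)
        ∂((volume : Measure E3).toSphere) ≤
      ENNReal.ofReal (4 * ((R ^ 3)⁻¹ * ∫ x in cball R, w x ^ 2)
        + R⁻¹ * ∑ i, ∫ x in cball R, Dw i x ^ 2) := by
  obtain ⟨φ, hφ, hs, h0, h1, -, hp⟩ := hw.exists_smooth_seq
  have one : ∀ {f : ℕ → E3 → ℝ} {g : E3 → ℝ}, TendstoL2 f g →
      Tendsto (fun n => ∫ x in cball R, f n x ^ 2) atTop (𝓝 (∫ x in cball R, g x ^ 2)) :=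
    fun hf => by
      simpa using hf.setIntegral (m := fun _ => 1) (C := 1) aestronglyMeasurable_const (by simp) R
  have hsm : ∀ n, ∫⁻ θ : Metric.sphere (0 : E3) 1, ENNReal.ofReal (φ n (R • (θ : E3)) ^ 2)
        ∂((volume : Measure E3).toSphere) ≤
      ENNReal.ofReal (4 * ((R ^ 3)⁻¹ * ∫ x in cball R, φ n x ^ 2)
        + R⁻¹ * ∑ i, ∫ x in cball R, pd i (φ n) x ^ 2) := fun n => by
    have hcg := (contDiff_gradSq (hφ n)).continuous
    have hcn := (hφ n).continuous
    have hR3 : 0 < R ^ 3 := by positivity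
    have k1 : Integrable (fun x => φ n x ^ 2) (volume.restrict (cball R)) :=
      (h0.memLp n).integrable_sq.integrableOn
    have k2 : ∀ i, Integrable (fun x => pd i (φ n) x ^ 2) (volume.restrict (cball R)) := fun i =>
      ((h1 i).memLp n).integrable_sq.integrableOn
    have k3 : Integrable (gradSq (φ n)) (volume.restrict (cball R)) :=
      integrable_finsetSum _ fun i _ => k2 i
    have e : ENNReal.ofReal (4 * ((R ^ 3)⁻¹ * ∫ x in cball R, φ n x ^ 2)
        + R⁻¹ * ∑ i, ∫ x in cball R, pd i (φ n) x ^ 2)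
        = ENNReal.ofReal (R ^ 3)⁻¹ * ∫⁻ x in cball R,
          ENNReal.ofReal (4 * φ n x ^ 2 + R ^ 2 * gradSq (φ n) x) := by
      have k4 : Integrable (fun x => 4 * φ n x ^ 2 + R ^ 2 * gradSq (φ n) x)
        (volume.restrict (cball R)) := (k1.const_mul 4).add (k3.const_mul (R ^ 2))
      rw [← ofReal_integral_eq_lintegral_ofReal k4 (Eventually.of_forall fun x => by
        have := gradSq_nonneg (φ := φ n) x
        dsimp only [Pi.zero_apply]
        positivity), ← ENNReal.ofReal_mul (by positivity)]
      congr 1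
      rw [integral_add (k1.const_mul 4) (k3.const_mul (R ^ 2)), integral_const_mul,
        integral_const_mul]
      unfold gradSq
      rw [integral_finsetSum _ fun i _ => k2 i]
      field_simp
    rw [e, setLIntegral_cball_polar (by fun_prop), ← lintegral_const_mul']
    · refine lintegral_mono fun θ => ?_
      have hθ : ‖(θ : E3)‖ = 1 := by simp
      have := trace_ray (hφ n) hθ hR
      calc ENNReal.ofReal (φ n (R • (θ : E3)) ^ 2)
          = ENNReal.ofReal (R ^ 3)⁻¹ * ENNReal.ofReal (R ^ 3 * φ n (R • (θ : E3)) ^ 2) := by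
            rw [← ENNReal.ofReal_mul (by positivity)]
            congr 1
            field_simp
        _ ≤ _ := by gcongr
    · exact ENNReal.ofReal_ne_top
  have hlim : Tendsto (fun n => ENNReal.ofReal (4 * ((R ^ 3)⁻¹ * ∫ x in cball R, φ n x ^ 2)
        + R⁻¹ * ∑ i, ∫ x in cball R, pd i (φ n) x ^ 2)) atTop
      (𝓝 (ENNReal.ofReal (4 * ((R ^ 3)⁻¹ * ∫ x in cball R, w x ^ 2)
        + R⁻¹ * ∑ i, ∫ x in cball R, Dw i x ^ 2))) :=
    ENNReal.tendsto_ofReal ((((one h0).const_mul _).const_mul _).add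
      ((tendsto_finsetSum _ fun i _ => one (h1 i)).const_mul _))
  -- On a fixed sphere only pointwise convergence is available, so the left side passes to the limit
  -- by Fatou.
  rw [← hlim.liminf_eq]
  calc _ = ∫⁻ θ : Metric.sphere (0 : E3) 1,
          liminf (fun n => ENNReal.ofReal (φ n (R • (θ : E3)) ^ 2)) atTop
          ∂((volume : Measure E3).toSphere) := by
        refine lintegral_congr fun θ => ?_
        exact (ENNReal.tendsto_ofReal ((hp hc (R • (θ : E3))).pow 2)).liminf_eq.symm
    _ ≤ liminf (fun n => ∫⁻ θ : Metric.sphere (0 : E3) 1,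
          ENNReal.ofReal (φ n (R • (θ : E3)) ^ 2) ∂((volume : Measure E3).toSphere)) atTop := by
        refine lintegral_liminf_le fun n => ?_
        have := (hφ n).continuous
        have h3 : Continuous fun θ : Metric.sphere (0 : E3) 1 => φ n (R • (θ : E3)) ^ 2 := by fun_prop
        exact h3.measurable.ennreal_ofReal
    _ ≤ _ := liminf_le_liminf (Eventually.of_forall hsm)

end Morawetz

/-! ### The norms of Y and Y*: duality and weighted bounds. -/

namespace Morawetz

open Filter Topology

section normY

variable {F : Type*} [NormedAddCommGroup F] {g : E3 → F}

lemma lintegral_cball_eq (hg : MemLp g 2 volume) (R : ℝ) :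
    ∫⁻ x in cball R, ‖g x‖ₑ ^ 2 = ENNReal.ofReal (∫ x in cball R, ‖g x‖ ^ 2) := by
  rw [ofReal_integral_eq_lintegral_ofReal hg.norm.integrable_sq.integrableOn
    (Eventually.of_forall fun x => sq_nonneg _)]
  refine lintegral_congr fun x => ?_
  rw [ENNReal.ofReal_pow (norm_nonneg _), ofReal_norm]

lemma normY_le_ofReal (hg : MemLp g 2 volume) {B : ℝ} (hB : 0 ≤ B)
    (h : ∀ R, 0 < R → ∫ x in cball R, ‖g x‖ ^ 2 ≤ bra R * B ^ 2) :
    normY g ≤ ENNReal.ofReal B := by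
  have h1 : (⨆ (R : ℝ) (_ : 0 < R),
      ENNReal.ofReal (1 / bra R) * ∫⁻ x in cball R, ‖g x‖ₑ ^ 2) ≤ ENNReal.ofReal (B ^ 2) := by
    refine iSup₂_le fun R hR => ?_
    rw [lintegral_cball_eq hg, ← ENNReal.ofReal_mul (by have := bra_pos R; positivity)]
    refine ENNReal.ofReal_le_ofReal ?_
    have := bra_pos R
    rw [one_div, inv_mul_le_iff₀ this]
    exact h R hR
  calc normY g ≤ ENNReal.ofReal (B ^ 2) ^ (1 / 2 : ℝ) := ENNReal.rpow_le_rpow h1 (by norm_num)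
    _ = ENNReal.ofReal B := by
      rw [ENNReal.ofReal_rpow_of_nonneg (by positivity) (by norm_num), ← Real.sqrt_eq_rpow,
        Real.sqrt_sq hB]

/-- Since ⟨R⟩ ≥ 1, L² embeds in Y. Finiteness is what later permits absorbing Y norms into the
left-hand side. -/
lemma normY_ne_top (hg : MemLp g 2 volume) : normY g ≠ ⊤ := by
  have hI : 0 ≤ ∫ x, ‖g x‖ ^ 2 := integral_nonneg fun x => sq_nonneg _
  refine ((normY_le_ofReal hg (Real.sqrt_nonneg (∫ x, ‖g x‖ ^ 2)) fun R _ => ?_).trans_lt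
    ENNReal.ofReal_lt_top).ne
  rw [Real.sq_sqrt hI]
  refine (setIntegral_le_integral hg.norm.integrable_sq
    (Eventually.of_forall fun x => sq_nonneg _)).trans ?_
  exact le_mul_of_one_le_left hI (one_le_bra R)

lemma integral_cball_le (hg : MemLp g 2 volume) {R : ℝ} (hR : 0 < R) :
    ∫ x in cball R, ‖g x‖ ^ 2 ≤ bra R * (normY g).toReal ^ 2 := by
  have hb := bra_pos R
  set S := ⨆ (R : ℝ) (_ : 0 < R), ENNReal.ofReal (1 / bra R) * ∫⁻ x in cball R, ‖g x‖ₑ ^ 2 with hS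
  have hN : normY g ^ (2 : ℝ) = S := by
    change (S ^ (1 / 2 : ℝ)) ^ (2 : ℝ) = S
    rw [← ENNReal.rpow_mul]; norm_num
  have h1 : ENNReal.ofReal (1 / bra R) * ∫⁻ x in cball R, ‖g x‖ₑ ^ 2 ≤ S :=
    le_iSup₂ (f := fun (R : ℝ) (_ : 0 < R) =>
      ENNReal.ofReal (1 / bra R) * ∫⁻ x in cball R, ‖g x‖ₑ ^ 2) R hR
  rw [← hN, lintegral_cball_eq hg, ← ENNReal.ofReal_mul (by positivity)] at h1
  have h2 := ENNReal.toReal_mono (by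
    exact ENNReal.rpow_ne_top_of_nonneg (by norm_num) (normY_ne_top hg)) h1
  rw [ENNReal.toReal_ofReal (mul_nonneg (by positivity)
    (setIntegral_nonneg measurableSet_closedBall fun x _ => sq_nonneg _)), ← ENNReal.toReal_rpow,
    Real.rpow_two, one_div, inv_mul_le_iff₀ hb] at h2
  exact h2

lemma normY_congr_norm {G : Type*} [NormedAddCommGroup G] {h : E3 → G}
    (e : ∀ x, ‖g x‖ = ‖h x‖) : normY g = normY h := by
  have : ∀ x, ‖g x‖ₑ = ‖h x‖ₑ := fun x => by rw [← ofReal_norm, e, ofReal_norm]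
  simp only [normY, this]

end normY

/-- Duality between `Y` and `Y*`. -/
lemma integral_mul_le_normYstar {f g : E3 → ℂ} (hf : MemLp f 2 volume) (hg : MemLp g 2 volume)
    (hs : normYstar f ≠ ⊤) :
    ∫ x, ‖f x‖ * ‖g x‖ ≤ (normYstar f).toReal * (normY g).toReal := by
  have hfg : Integrable (fun x => ‖f x‖ * ‖g x‖) volume := hf.norm.integrable_mul hg.norm
  set t := (normY g).toReal with ht
  have ht0 : 0 ≤ t := ENNReal.toReal_nonneg
  -- It suffices to test with `g / τ` for every `τ > t`.
  have key : ∀ τ, t < τ → ∫ x, ‖f x‖ * ‖g x‖ ≤ (normYstar f).toReal * τ := fun τ hτ => by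
    have hτ0 : 0 < τ := ht0.trans_lt hτ
    have hmem : MemLp (fun x => ((τ⁻¹ : ℝ) : ℂ) * g x) 2 volume := hg.const_mul _
    have hn : ∀ x, ‖((τ⁻¹ : ℝ) : ℂ) * g x‖ = τ⁻¹ * ‖g x‖ := fun x => by
      rw [norm_mul, Complex.norm_real, Real.norm_of_nonneg (by positivity)]
    have h1 : normY (fun x => ((τ⁻¹ : ℝ) : ℂ) * g x) ≤ 1 := by
      rw [← ENNReal.ofReal_one]
      refine normY_le_ofReal hmem zero_le_one fun R hR => ?_
      simp only [hn, mul_pow]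
      rw [integral_const_mul]
      have h2 := integral_cball_le hg hR
      have hb := bra_pos R
      have h3 : bra R * t ^ 2 ≤ bra R * τ ^ 2 := by gcongr
      rw [inv_pow, inv_mul_le_iff₀ (by positivity)]
      linarith
    have h2 : ∫⁻ x, ‖f x‖ₑ * ‖((τ⁻¹ : ℝ) : ℂ) * g x‖ₑ ≤ normYstar f :=
      le_iSup_of_le (fun x => ((τ⁻¹ : ℝ) : ℂ) * g x)
        (le_iSup_of_le hmem.1 (le_iSup_of_le h1 le_rfl))
    have h3 : ∫⁻ x, ‖f x‖ₑ * ‖((τ⁻¹ : ℝ) : ℂ) * g x‖ₑ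
        = ENNReal.ofReal (τ⁻¹ * ∫ x, ‖f x‖ * ‖g x‖) := by
      rw [← integral_const_mul, ofReal_integral_eq_lintegral_ofReal (hfg.const_mul _)
        (Eventually.of_forall fun x => by dsimp only [Pi.zero_apply]; positivity)]
      refine lintegral_congr fun x => ?_
      rw [← ofReal_norm, ← ofReal_norm, ← ENNReal.ofReal_mul (norm_nonneg _), hn]
      congr 1; ring
    rw [h3] at h2
    have h4 := ENNReal.toReal_mono hs h2
    rw [ENNReal.toReal_ofReal (mul_nonneg (by positivity)
      (integral_nonneg fun x => by positivity)), inv_mul_le_iff₀ hτ0] at h4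
    linarith
  have hlim : Tendsto (fun τ => (normYstar f).toReal * τ) (𝓝[>] t)
      (𝓝 ((normYstar f).toReal * t)) :=
    (tendsto_id.mono_left nhdsWithin_le_nhds).const_mul _
  exact ge_of_tendsto hlim (by filter_upwards [self_mem_nhdsWithin] with τ hτ using key τ hτ)

/-- The constant in the weighted `L²` bound by the `Y` norm. -/
def weightConst (δ : ℝ) : ℝ := 2 * 2 ^ (1 + δ) * (1 - 2 ^ (-δ))⁻¹

lemma weightConst_pos {δ : ℝ} (hδ : 0 < δ) : 0 < weightConst δ := by
  have h : (2 : ℝ) ^ (-δ) < 1 := Real.rpow_lt_one_of_one_lt_of_neg one_lt_two (by linarith)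
  have : 0 < 1 - (2 : ℝ) ^ (-δ) := by linarith
  unfold weightConst
  positivity

/-- On every shell ⟨x⟩ ≥ 2^{j-1}: for j ≥ 1 from |x| ≥ 2^{j-1}, for j = 0 from ⟨x⟩ ≥ 1. -/
lemma bra_rpow_le_of_mem_shell {δ : ℝ} (hδ : 0 < δ) {j : ℕ} {x : E3} (hx : x ∈ shell j) :
    bra ‖x‖ ^ (-1 - δ) ≤ 2 ^ (1 + δ) * ((2 : ℝ) ^ j) ^ (-1 - δ) := by
  have h2 : (2 : ℝ) ^ j / 2 ≤ bra ‖x‖ := by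
    cases j with
    | zero => have := one_le_bra ‖x‖; norm_num; linarith
    | succ j =>
      have h1 : (2 : ℝ) ^ j ≤ ‖x‖ := hx.1
      have := le_bra ‖x‖
      rw [pow_succ]; linarith
  have h3 : bra ‖x‖ ^ (-1 - δ) ≤ ((2 : ℝ) ^ j / 2) ^ (-1 - δ) :=
    Real.rpow_le_rpow_of_nonpos (by positivity) h2 (by linarith)
  refine h3.trans (le_of_eq ?_)
  rw [Real.div_rpow (by positivity) (by norm_num), div_eq_mul_inv, ← Real.rpow_neg (by norm_num),
    mul_comm]
  congr 2; ring

lemma shell_subset_cball (j : ℕ) : shell j ⊆ cball (2 ^ j) := by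
  intro x hx
  cases j with
  | zero => simpa [shell] using hx
  | succ j => simpa using hx.2

/-- Weighted `L²` bounds by the `Y` norm. -/
lemma integral_weight_le {F : Type*} [NormedAddCommGroup F] {g : E3 → F} (hg : MemLp g 2 volume)
    {δ : ℝ} (hδ : 0 < δ) :
    ∫ x, bra ‖x‖ ^ (-1 - δ) * ‖g x‖ ^ 2 ≤ weightConst δ * (normY g).toReal ^ 2 := by
  set D := (normY g).toReal
  have hb : Continuous fun x : E3 => bra ‖x‖ := by unfold bra; fun_prop
  have hnn : ∀ x, 0 ≤ bra ‖x‖ ^ (-1 - δ) * ‖g x‖ ^ 2 := fun x => by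
    have := bra_pos ‖x‖
    positivity
  have hm : AEStronglyMeasurable (fun x => bra ‖x‖ ^ (-1 - δ) * ‖g x‖ ^ 2) volume :=
    (hb.measurable.pow_const _).aestronglyMeasurable.mul (hg.1.norm.pow 2)
  have hcov : (⋃ j, shell j) = univ := by
    refine eq_univ_of_forall fun x => mem_iUnion.2 ?_
    obtain ⟨N, hN⟩ := pow_unbounded_of_one_lt ‖x‖ (one_lt_two (α := ℝ))
    obtain ⟨j, -, hj⟩ := exists_mem_shell hN.le
    exact ⟨j, hj⟩
  have hr0 : (0 : ℝ) < 2 ^ (-δ) := by positivity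
  have hr1 : (2 : ℝ) ^ (-δ) < 1 := Real.rpow_lt_one_of_one_lt_of_neg one_lt_two (by linarith)
  -- The weight is of order 2^{-(1+δ)j} on the shell and the mass of the ball is at most ⟨2^j⟩D² ≤
  -- 2·2^j D². What remains is geometric with ratio 2^{-δ} < 1; this is where δ > 0 matters.
  have hterm : ∀ j, ∫⁻ x in shell j, ENNReal.ofReal (bra ‖x‖ ^ (-1 - δ) * ‖g x‖ ^ 2)
      ≤ ENNReal.ofReal (2 * 2 ^ (1 + δ) * D ^ 2 * ((2 : ℝ) ^ (-δ)) ^ j) := fun j => by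
    have hρ : (0 : ℝ) < 2 ^ j := by positivity
    set K : ℝ := 2 ^ (1 + δ) * ((2 : ℝ) ^ j) ^ (-1 - δ) with hK
    calc ∫⁻ x in shell j, ENNReal.ofReal (bra ‖x‖ ^ (-1 - δ) * ‖g x‖ ^ 2)
        ≤ ∫⁻ x in shell j, ENNReal.ofReal K * ‖g x‖ₑ ^ 2 := by
          refine setLIntegral_mono' (measurableSet_shell j) fun x hx => ?_
          rw [← ofReal_norm, ← ENNReal.ofReal_pow (norm_nonneg _),
            ← ENNReal.ofReal_mul (by positivity)]
          refine ENNReal.ofReal_le_ofReal ?_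
          gcongr
          exact bra_rpow_le_of_mem_shell hδ hx
      _ ≤ ∫⁻ x in cball (2 ^ j), ENNReal.ofReal K * ‖g x‖ₑ ^ 2 :=
          lintegral_mono_set (shell_subset_cball j)
      _ = ENNReal.ofReal (K * ∫ x in cball (2 ^ j), ‖g x‖ ^ 2) := by
          rw [lintegral_const_mul' _ _ ENNReal.ofReal_ne_top, lintegral_cball_eq hg,
            ← ENNReal.ofReal_mul (by positivity)]
      _ ≤ _ := by
          refine ENNReal.ofReal_le_ofReal ?_
          have h1 := integral_cball_le hg hρ
          have h2 : bra (2 ^ j) ≤ 2 * 2 ^ j := by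
            have := bra_sq (2 ^ j)
            have h3 : (1 : ℝ) ≤ 2 ^ j := one_le_pow₀ (by norm_num)
            nlinarith [bra_pos (2 ^ j)]
          have h3 : ((2 : ℝ) ^ j) ^ (-1 - δ) * 2 ^ j = ((2 : ℝ) ^ (-δ)) ^ j := by
            rw [← Real.rpow_natCast, ← Real.rpow_natCast, ← Real.rpow_mul (by norm_num),
              ← Real.rpow_mul (by norm_num), ← Real.rpow_add (by norm_num)]
            congr 1; ring
          calc K * ∫ x in cball (2 ^ j), ‖g x‖ ^ 2 ≤ K * (2 * 2 ^ j * D ^ 2) := by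
                gcongr
                exact h1.trans (by gcongr)
            _ = 2 * 2 ^ (1 + δ) * D ^ 2 * (((2 : ℝ) ^ j) ^ (-1 - δ) * 2 ^ j) := by rw [hK]; ring
            _ = _ := by rw [h3]
  have hsum : HasSum (fun j : ℕ => 2 * 2 ^ (1 + δ) * D ^ 2 * ((2 : ℝ) ^ (-δ)) ^ j)
      (2 * 2 ^ (1 + δ) * D ^ 2 * (1 - 2 ^ (-δ))⁻¹) :=
    (hasSum_geometric_of_lt_one hr0.le hr1).mul_left _
  have htot : ∫⁻ x, ENNReal.ofReal (bra ‖x‖ ^ (-1 - δ) * ‖g x‖ ^ 2)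
      ≤ ENNReal.ofReal (weightConst δ * D ^ 2) := by
    calc _ = ∫⁻ x in ⋃ j, shell j, ENNReal.ofReal (bra ‖x‖ ^ (-1 - δ) * ‖g x‖ ^ 2) := by
          rw [hcov, Measure.restrict_univ]
      _ ≤ ∑' j, ∫⁻ x in shell j, ENNReal.ofReal (bra ‖x‖ ^ (-1 - δ) * ‖g x‖ ^ 2) :=
          lintegral_iUnion_le _ _
      _ ≤ ∑' j, ENNReal.ofReal (2 * 2 ^ (1 + δ) * D ^ 2 * ((2 : ℝ) ^ (-δ)) ^ j) :=
          ENNReal.tsum_le_tsum hterm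
      _ = ENNReal.ofReal (2 * 2 ^ (1 + δ) * D ^ 2 * (1 - 2 ^ (-δ))⁻¹) := by
          rw [← ENNReal.ofReal_tsum_of_nonneg (fun j => by positivity) hsum.summable, hsum.tsum_eq]
      _ = _ := by unfold weightConst; congr 1; ring
  rw [integral_eq_lintegral_of_nonneg_ae (Eventually.of_forall hnn) hm]
  have hC := weightConst_pos hδ
  have := ENNReal.toReal_mono ENNReal.ofReal_ne_top htot
  rwa [ENNReal.toReal_ofReal (by positivity)] at this

lemma abs_bra_rpow_le_one {δ : ℝ} (hδ : 0 < δ) (x : E3) : |bra ‖x‖ ^ (-1 - δ)| ≤ 1 := by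
  have := bra_pos ‖x‖
  rw [abs_of_nonneg (by positivity)]
  exact Real.rpow_le_one_of_one_le_of_nonpos (one_le_bra _) (by linarith)

variable {w : E3 → ℝ} {Dw : Fin 3 → E3 → ℝ} {D2w : Fin 3 → Fin 3 → E3 → ℝ}

/-- Bounds on all spheres imply bounds of `w / |x|` on balls. -/
lemma IsRealH2.integral_div_norm_le (hw : IsRealH2 w Dw D2w) (hc : Continuous w) {B : ℝ}
    (hB0 : 0 ≤ B)
    (hB : ∀ r : ℝ, 0 < r → ∫⁻ θ : Metric.sphere (0 : E3) 1, ENNReal.ofReal (w (r • (θ : E3)) ^ 2)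
        ∂((volume : Measure E3).toSphere) ≤ ENNReal.ofReal B) {R : ℝ} (hR : 0 < R) :
    ∫ x in cball R, (w x / ‖x‖) ^ 2 ≤ R * B := by
  have hmeas : Measurable fun x : E3 => ENNReal.ofReal ((w x / ‖x‖) ^ 2) :=
    ((hc.measurable.div measurable_norm).pow_const 2).ennreal_ofReal
  have h1 : ∫⁻ x in cball R, ENNReal.ofReal ((w x / ‖x‖) ^ 2) ≤ ENNReal.ofReal (R * B) := by
    rw [setLIntegral_cball_polar hmeas]
    -- The Jacobian r² cancels 1/|x|², so after Fubini the sphere bounds are integrated over radii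
    -- of total length R.
    have e : ∀ θ : Metric.sphere (0 : E3) 1, ∫⁻ r in Ioc (0 : ℝ) R, ENNReal.ofReal (r ^ 2) *
        ENNReal.ofReal ((w (r • (θ : E3)) / ‖r • (θ : E3)‖) ^ 2)
        = ∫⁻ r in Ioc (0 : ℝ) R, ENNReal.ofReal (w (r • (θ : E3)) ^ 2) := fun θ => by
      refine setLIntegral_congr_fun measurableSet_Ioc fun r hr => ?_
      have hr0 : 0 < r := hr.1
      have hn : ‖r • (θ : E3)‖ = r := by rw [norm_smul]; simp [abs_of_pos hr0]
      simp only [hn]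
      rw [← ENNReal.ofReal_mul (sq_nonneg r)]
      congr 1
      field_simp
    simp only [e]
    rw [lintegral_lintegral_swap]
    · calc _ ≤ ∫⁻ _ in Ioc (0 : ℝ) R, ENNReal.ofReal B :=
            setLIntegral_mono' measurableSet_Ioc fun r hr => hB r hr.1
        _ = ENNReal.ofReal (R * B) := by
            rw [setLIntegral_const, Real.volume_Ioc, sub_zero, mul_comm, ENNReal.ofReal_mul hR.le]
    · have : Continuous fun p : Metric.sphere (0 : E3) 1 × ℝ => w (p.2 • (p.1 : E3)) ^ 2 := by
        fun_prop
      exact this.measurable.ennreal_ofReal.aemeasurable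
  have h2 := hw.hardy.1.integrable_sq.integrableOn (s := cball R)
  rw [← ofReal_integral_eq_lintegral_ofReal h2 (Eventually.of_forall fun x => sq_nonneg _)] at h1
  exact (ENNReal.ofReal_le_ofReal_iff (by positivity)).1 h1

end Morawetz

/-! ### Complex-valued functions: energy identities and the source term. -/

namespace Morawetz

open Filter Topology

lemma IsWeakPartial.clm {i : Fin 3} {u g : E3 → ℂ} (h : IsWeakPartial i u g) (L : ℂ →L[ℝ] ℝ) :
    IsWeakPartial i (fun x => L (u x)) (fun x => L (g x)) where
  locInt x := (h.locInt x).imp fun _ hs => ⟨hs.1, L.integrable_comp hs.2⟩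
  locInt_deriv x := (h.locInt_deriv x).imp fun _ hs => ⟨hs.1, L.integrable_comp hs.2⟩
  integral_eq φ hφ hs := by
    have h1 := congrArg L (h.integral_eq φ hφ hs)
    have e1 := L.integral_comp_comm (h.locInt.integrable_smul_left_of_hasCompactSupport
      (contDiff_pd hφ i).continuous (hasCompactSupport_pd hs i))
    have e2 := L.integral_comp_comm (h.locInt_deriv.integrable_smul_left_of_hasCompactSupport
      hφ.continuous hs)
    simp only [pd] at e1
    rw [map_neg, ← e1, ← e2] at h1
    simpa only [map_smul] using h1

variable {v : E3 → ℂ} {Dv : Fin 3 → E3 → ℂ} {D2v : Fin 3 → Fin 3 → E3 → ℂ}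

lemma IsH2.clm (h : IsH2 v Dv D2v) (L : ℂ →L[ℝ] ℝ) :
    IsRealH2 (fun x => L (v x)) (fun i x => L (Dv i x)) (fun i j x => L (D2v i j x)) :=
  ⟨L.comp_memLp' h.memLp, fun i => L.comp_memLp' (h.memLp_D i),
    fun i j => L.comp_memLp' (h.memLp_D2 i j), fun i => (h.weak_D i).clm L,
    fun i j => (h.weak_D2 i j).clm L⟩

lemma IsH2.re (h : IsH2 v Dv D2v) :
    IsRealH2 (fun x => (v x).re) (fun i x => (Dv i x).re) (fun i j x => (D2v i j x).re) :=
  h.clm Complex.reCLM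

lemma IsH2.im (h : IsH2 v Dv D2v) :
    IsRealH2 (fun x => (v x).im) (fun i x => (Dv i x).im) (fun i j x => (D2v i j x).im) :=
  h.clm Complex.imCLM

/-- The Cauchy–Schwarz inequality. -/
lemma sq_integral_mul_le {f g : E3 → ℝ} (hf : MemLp f 2 volume) (hg : MemLp g 2 volume) :
    (∫ x, f x * g x) ^ 2 ≤ (∫ x, f x ^ 2) * ∫ x, g x ^ 2 := by
  have e : ∀ {u v : E3 → ℝ} (hu : MemLp u 2 volume) (hv : MemLp v 2 volume),
      inner ℝ (hu.toLp u) (hv.toLp v) = ∫ x, u x * v x := fun hu hv => by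
    rw [L2.inner_def]
    refine integral_congr_ae ?_
    filter_upwards [hu.coeFn_toLp, hv.coeFn_toLp] with x h1 h2
    rw [h1, h2]; simp [mul_comm]
  have h := real_inner_mul_inner_self_le (hf.toLp f) (hg.toLp g)
  rw [e, e, e] at h
  simpa [sq] using h

lemma norm_sq_complex (c : ℂ) : ‖c‖ ^ 2 = c.re ^ 2 + c.im ^ 2 := by
  rw [Complex.sq_norm, Complex.normSq_apply]; ring

/-- The operator without its first-order part. -/
def helm (a : E3 → ℝ) (z : ℂ) (v : E3 → ℂ) (D2v : Fin 3 → Fin 3 → E3 → ℂ) (x : E3) : ℂ :=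
  laplacian D2v x + z ^ 2 * (a x : ℂ) * v x

/-- The full energy density of a complex-valued function. -/
def cDensity (v : E3 → ℂ) (Dv : Fin 3 → E3 → ℂ) (x : E3) : ℝ :=
  energyDensity (fun x => (v x).re) (fun i x => (Dv i x).re) x
    + energyDensity (fun x => (v x).im) (fun i x => (Dv i x).im) x

/-- The sum of the local energies of the real and imaginary parts. -/
def cBallEnergy (a : E3 → ℝ) (κ R : ℝ) (v : E3 → ℂ) (Dv : Fin 3 → E3 → ℂ) : ℝ :=
  ballEnergy a κ R (fun x => (v x).re) (fun i x => (Dv i x).re)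
    + ballEnergy a κ R (fun x => (v x).im) (fun i x => (Dv i x).im)

/-- The Dirichlet integral. -/
def dirichlet (Dv : Fin 3 → E3 → ℂ) : ℝ :=
  (∑ i, ∫ x, (Dv i x).re ^ 2) + ∑ i, ∫ x, (Dv i x).im ^ 2

lemma dirichlet_nonneg (Dv : Fin 3 → E3 → ℂ) : 0 ≤ dirichlet Dv :=
  add_nonneg (Finset.sum_nonneg fun _ _ => integral_nonneg fun _ => sq_nonneg _)
    (Finset.sum_nonneg fun _ _ => integral_nonneg fun _ => sq_nonneg _)

lemma IsH2.memLp_cDensity (h : IsH2 v Dv D2v) : MemLp (cDensity v Dv) 2 volume :=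
  h.re.memLp_energyDensity.add h.im.memLp_energyDensity

lemma cDensity_nonneg (v : E3 → ℂ) (Dv : Fin 3 → E3 → ℂ) (x : E3) : 0 ≤ cDensity v Dv x :=
  add_nonneg (energyDensity_nonneg _ _ _) (energyDensity_nonneg _ _ _)

lemma energyDensity_sq_le (w : E3 → ℝ) (Dw : Fin 3 → E3 → ℝ) (x : E3) :
    energyDensity w Dw x ^ 2 ≤ 4 * (∑ i, Dw i x ^ 2 + (w x / ‖x‖) ^ 2) := by
  unfold energyDensity
  rw [Fin.sum_univ_three, Fin.sum_univ_three, ← sq_abs (Dw 0 x), ← sq_abs (Dw 1 x),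
    ← sq_abs (Dw 2 x), ← sq_abs (w x / ‖x‖)]
  nlinarith [sq_nonneg (|Dw 0 x| - |Dw 1 x|), sq_nonneg (|Dw 0 x| - |Dw 2 x|),
    sq_nonneg (|Dw 1 x| - |Dw 2 x|), sq_nonneg (|Dw 0 x| - |w x / ‖x‖|),
    sq_nonneg (|Dw 1 x| - |w x / ‖x‖|), sq_nonneg (|Dw 2 x| - |w x / ‖x‖|)]

/-- Integrated form of the pointwise bound for the energy density, on an arbitrary set. -/
lemma IsH2.integral_cDensity_sq_le (h : IsH2 v Dv D2v) (s : Set E3) :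
    ∫ x in s, cDensity v Dv x ^ 2 ≤
      8 * ((∑ i, ∫ x in s, (Dv i x).re ^ 2) + (∑ i, ∫ x in s, (Dv i x).im ^ 2)
        + (∫ x in s, ((v x).re / ‖x‖) ^ 2) + ∫ x in s, ((v x).im / ‖x‖) ^ 2) := by
  have k1 : ∀ i ∈ Finset.univ, Integrable (fun x => (Dv i x).re ^ 2) (volume.restrict s) :=
    fun i _ => (h.re.memLp_D i).integrable_sq.integrableOn
  have k2 : ∀ i ∈ Finset.univ, Integrable (fun x => (Dv i x).im ^ 2) (volume.restrict s) :=
    fun i _ => (h.im.memLp_D i).integrable_sq.integrableOn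
  have k3 : Integrable (fun x => ((v x).re / ‖x‖) ^ 2) (volume.restrict s) :=
    h.re.hardy.1.integrable_sq.integrableOn
  have k4 : Integrable (fun x => ((v x).im / ‖x‖) ^ 2) (volume.restrict s) :=
    h.im.hardy.1.integrable_sq.integrableOn
  have k12 : Integrable (fun x => ∑ i, (Dv i x).re ^ 2 + ∑ i, (Dv i x).im ^ 2)
    (volume.restrict s) := (integrable_finsetSum _ k1).add (integrable_finsetSum _ k2)
  have k123 : Integrable (fun x => ∑ i, (Dv i x).re ^ 2 + ∑ i, (Dv i x).im ^ 2
    + ((v x).re / ‖x‖) ^ 2) (volume.restrict s) := k12.add k3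
  have k : Integrable (fun x => ∑ i, (Dv i x).re ^ 2 + ∑ i, (Dv i x).im ^ 2
    + ((v x).re / ‖x‖) ^ 2 + ((v x).im / ‖x‖) ^ 2) (volume.restrict s) := k123.add k4
  rw [← integral_finsetSum _ k1, ← integral_finsetSum _ k2,
    ← integral_add (integrable_finsetSum _ k1) (integrable_finsetSum _ k2),
    ← integral_add k12 k3, ← integral_add k123 k4, ← integral_const_mul]
  refine integral_mono h.memLp_cDensity.integrable_sq.integrableOn (k.const_mul 8) fun x => ?_
  have h1 := energyDensity_sq_le (fun x => (v x).re) (fun i x => (Dv i x).re) x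
  have h2 := energyDensity_sq_le (fun x => (v x).im) (fun i x => (Dv i x).im) x
  dsimp only [cDensity]
  nlinarith [sq_nonneg (energyDensity (fun x => (v x).re) (fun i x => (Dv i x).re) x
    - energyDensity (fun x => (v x).im) (fun i x => (Dv i x).im) x)]

/-- Hardy bounds the quotient terms by four Dirichlet integrals, and 8(1 + 4) = 40. -/
lemma IsH2.integral_cDensity_sq_le_dirichlet (h : IsH2 v Dv D2v) :
    ∫ x, cDensity v Dv x ^ 2 ≤ 40 * dirichlet Dv := by
  have h1 := h.integral_cDensity_sq_le univ
  simp only [Measure.restrict_univ] at h1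
  have h2 := h.re.hardy.2
  have h3 := h.im.hardy.2
  unfold dirichlet
  linarith

variable {α M : ℝ} {a : E3 → ℝ} {Da : Fin 3 → E3 → ℝ}

lemma IsCoeff.memLp_cmul (ha : IsCoeff α M a Da) {f : E3 → ℂ} (hf : MemLp f 2 volume) :
    MemLp (fun x => (a x : ℂ) * f x) 2 volume := by
  have ham : AEStronglyMeasurable a volume := (ha.weak 0).locInt.aestronglyMeasurable
  refine MemLp.of_le_mul (c := M) hf
    ((Complex.continuous_ofReal.comp_aestronglyMeasurable ham).mul hf.1) ?_
  filter_upwards [ha.bounds] with x hx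
  rw [norm_mul, Complex.norm_real, Real.norm_of_nonneg (ha.pos.trans_le hx.1).le]
  gcongr
  exact hx.2

lemma IsCoeff.memLp_helm (ha : IsCoeff α M a Da) (h : IsH2 v Dv D2v) (z : ℂ) :
    MemLp (helm a z v D2v) 2 volume := by
  refine (memLp_finsetSum Finset.univ fun i _ => h.memLp_D2 i i).add ?_
  have := (ha.memLp_cmul h.memLp).const_mul (z ^ 2)
  simpa only [mul_assoc] using this

/-- The energy identities: testing the equation with `v`. -/
lemma IsCoeff.energy (ha : IsCoeff α M a Da) (h : IsH2 v Dv D2v) (z : ℂ) :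
    |(z ^ 2).im| * (∫ x, a x * ‖v x‖ ^ 2) ≤ ∫ x, ‖helm a z v D2v x‖ * ‖v x‖ ∧
    dirichlet Dv ≤ (z ^ 2).re * (∫ x, a x * ‖v x‖ ^ 2) + ∫ x, ‖helm a z v D2v x‖ * ‖v x‖ := by
  set p := (z ^ 2).re with hp
  set τ := (z ^ 2).im with hτ
  set F := helm a z v D2v with hF
  have hFm : MemLp F 2 volume := ha.memLp_helm h z
  set P := ∫ x, a x * ‖v x‖ ^ 2 with hP
  have hr := h.re
  have hi := h.im
  have lr : MemLp (fun x => ∑ i, (D2v i i x).re) 2 volume :=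
    memLp_finsetSum Finset.univ fun i _ => hr.memLp_D2 i i
  have li : MemLp (fun x => ∑ i, (D2v i i x).im) 2 volume :=
    memLp_finsetSum Finset.univ fun i _ => hi.memLp_D2 i i
  have iP : Integrable (fun x => a x * ‖v x‖ ^ 2) volume := by
    refine ((ha.memLp_mul h.memLp.norm).integrable_mul h.memLp.norm).congr
      (Eventually.of_forall fun x => ?_)
    simp only [Pi.mul_apply]; ring
  have iA : Integrable (fun x => ‖F x‖ * ‖v x‖) volume := hFm.norm.integrable_mul h.memLp.norm
  have irr : Integrable (fun x => (v x).re * ∑ i, (D2v i i x).re) volume :=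
    hr.memLp.integrable_mul lr
  have iii : Integrable (fun x => (v x).im * ∑ i, (D2v i i x).im) volume :=
    hi.memLp.integrable_mul li
  have iri : Integrable (fun x => (v x).re * ∑ i, (D2v i i x).im) volume :=
    hr.memLp.integrable_mul li
  have iir : Integrable (fun x => (v x).im * ∑ i, (D2v i i x).re) volume :=
    hi.memLp.integrable_mul lr
  have Fre : ∀ x, (F x).re = ∑ i, (D2v i i x).re + a x * (p * (v x).re - τ * (v x).im) := fun x => by
    simp only [hF, helm, laplacian, Complex.add_re, Complex.re_sum, Complex.mul_re, Complex.mul_im,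
      Complex.ofReal_re, Complex.ofReal_im, ← hp, ← hτ]
    ring
  have Fim : ∀ x, (F x).im = ∑ i, (D2v i i x).im + a x * (p * (v x).im + τ * (v x).re) := fun x => by
    simp only [hF, helm, laplacian, Complex.add_im, Complex.im_sum, Complex.mul_re, Complex.mul_im,
      Complex.ofReal_re, Complex.ofReal_im, ← hp, ← hτ]
    ring
  have cs : ∀ c d : ℂ, |c.re * d.re + c.im * d.im| ≤ ‖c‖ * ‖d‖ ∧
      |c.im * d.re - c.re * d.im| ≤ ‖c‖ * ‖d‖ := fun c d => by
    have h1 := norm_sq_complex c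
    have h2 := norm_sq_complex d
    have h0 : 0 ≤ ‖c‖ * ‖d‖ := by positivity
    have h3 : (‖c‖ * ‖d‖) ^ 2 = (c.re ^ 2 + c.im ^ 2) * (d.re ^ 2 + d.im ^ 2) := by
      rw [mul_pow, h1, h2]
    constructor <;> refine abs_le_of_sq_le_sq ?_ h0 <;> rw [h3]
    · nlinarith [sq_nonneg (c.im * d.re - c.re * d.im)]
    · nlinarith [sq_nonneg (c.re * d.re + c.im * d.im)]
  -- In the imaginary part of F times the conjugate of v the Laplacian drops out: by Green both
  -- mixed terms equal the same integral of ∇Re v·∇Im v, with opposite signs.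
  have eim : ∫ x, ((F x).im * (v x).re - (F x).re * (v x).im) = τ * P := by
    have e : ∀ x, (F x).im * (v x).re - (F x).re * (v x).im
        = (v x).re * ∑ i, (D2v i i x).im - (v x).im * ∑ i, (D2v i i x).re
          + τ * (a x * ‖v x‖ ^ 2) := fun x => by
      rw [Fre, Fim, norm_sq_complex]; ring
    simp only [e]
    have k : Integrable (fun x => (v x).re * ∑ i, (D2v i i x).im
      - (v x).im * ∑ i, (D2v i i x).re) volume := iri.sub iir
    rw [integral_add k (iP.const_mul τ), integral_sub iri iir, integral_const_mul,
      hr.integral_mul_laplacian hi, hi.integral_mul_laplacian hr]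
    have : ∀ i, ∫ x, (Dv i x).re * (Dv i x).im = ∫ x, (Dv i x).im * (Dv i x).re := fun i =>
      integral_congr_ae (Eventually.of_forall fun x => mul_comm _ _)
    simp only [this]
    ring
  have ere : ∫ x, ((F x).re * (v x).re + (F x).im * (v x).im) = -dirichlet Dv + p * P := by
    have e : ∀ x, (F x).re * (v x).re + (F x).im * (v x).im
        = (v x).re * ∑ i, (D2v i i x).re + (v x).im * ∑ i, (D2v i i x).im
          + p * (a x * ‖v x‖ ^ 2) := fun x => by
      rw [Fre, Fim, norm_sq_complex]; ring
    simp only [e]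
    have k : Integrable (fun x => (v x).re * ∑ i, (D2v i i x).re
      + (v x).im * ∑ i, (D2v i i x).im) volume := irr.add iii
    rw [integral_add k (iP.const_mul p), integral_add irr iii, integral_const_mul, ← hP,
      hr.integral_mul_laplacian hr, hi.integral_mul_laplacian hi]
    simp only [dirichlet, sq]
    ring
  have hP0 : 0 ≤ P := integral_nonneg_of_ae (by
    filter_upwards [ha.bounds] with x hx
    have := ha.pos.trans_le hx.1
    dsimp only [Pi.zero_apply]
    positivity)
  constructor
  · rw [← abs_of_nonneg hP0, ← abs_mul, ← eim]
    exact abs_integral_le_integral_abs.trans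
      (integral_mono_of_nonneg (Eventually.of_forall fun x => abs_nonneg _) iA
        (Eventually.of_forall fun x => (cs (F x) (v x)).2))
  · have h1 : |∫ x, ((F x).re * (v x).re + (F x).im * (v x).im)| ≤ ∫ x, ‖F x‖ * ‖v x‖ :=
      abs_integral_le_integral_abs.trans
        (integral_mono_of_nonneg (Eventually.of_forall fun x => abs_nonneg _) iA
          (Eventually.of_forall fun x => (cs (F x) (v x)).1))
    rw [ere] at h1
    linarith [(abs_le.1 h1).1]

/-- The size of the part of `z²` that is treated as a source term. -/
def defect (z : ℂ) : ℝ := |(z ^ 2).re - max (z ^ 2).re 0| + |(z ^ 2).im|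

lemma defect_nonneg (z : ℂ) : 0 ≤ defect z := by unfold defect; positivity

lemma norm_sub_le_defect (z : ℂ) : ‖z ^ 2 - (max (z ^ 2).re 0 : ℝ)‖ ≤ defect z := by
  refine (Complex.norm_le_abs_re_add_abs_im _).trans (le_of_eq ?_)
  simp [defect]

lemma re_sq_le (z : ℂ) : max (z ^ 2).re 0 ≤ ‖z‖ ^ 2 := by
  rw [← norm_pow]
  exact max_le (Complex.re_le_norm _) (norm_nonneg _)

lemma defect_le (z : ℂ) : defect z ≤ 2 * ‖z‖ ^ 2 := by
  rw [← norm_pow]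
  unfold defect
  have h1 := Complex.abs_re_le_norm (z ^ 2)
  have h2 := Complex.abs_im_le_norm (z ^ 2)
  rcases le_total (z ^ 2).re 0 with h | h
  · rw [max_eq_right h, sub_zero]; linarith
  · rw [max_eq_left h, sub_self, abs_zero]; linarith [norm_nonneg (z ^ 2)]

lemma sq_norm_le (z : ℂ) : ‖z‖ ^ 2 ≤ max (z ^ 2).re 0 + defect z := by
  rw [← norm_pow]
  have h1 := norm_sub_le_defect z
  have h2 : ‖z ^ 2‖ ≤ ‖z ^ 2 - (max (z ^ 2).re 0 : ℝ)‖ + ‖((max (z ^ 2).re 0 : ℝ) : ℂ)‖ := by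
    have := norm_add_le (z ^ 2 - ((max (z ^ 2).re 0 : ℝ) : ℂ)) ((max (z ^ 2).re 0 : ℝ) : ℂ)
    rwa [sub_add_cancel] at this
  rw [Complex.norm_real, Real.norm_of_nonneg (le_max_right _ _)] at h2
  linarith

/-- Consequences of the energy identities for the source term. -/
lemma IsCoeff.defect_energy (ha : IsCoeff α M a Da) (h : IsH2 v Dv D2v) (z : ℂ) :
    defect z * (∫ x, a x * ‖v x‖ ^ 2) ≤ 2 * ∫ x, ‖helm a z v D2v x‖ * ‖v x‖ ∧
    defect z ^ 2 * (∫ x, a x * ‖v x‖ ^ 2) * dirichlet Dv ≤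
      8 * (‖z‖ * ∫ x, ‖helm a z v D2v x‖ * ‖v x‖) ^ 2 := by
  obtain ⟨h1, h2⟩ := ha.energy h z
  have hG := dirichlet_nonneg Dv
  set P := ∫ x, a x * ‖v x‖ ^ 2 with hP
  set A := ∫ x, ‖helm a z v D2v x‖ * ‖v x‖ with hA
  have hP0 : 0 ≤ P := integral_nonneg_of_ae (by
    filter_upwards [ha.bounds] with x hx
    have := ha.pos.trans_le hx.1
    dsimp only [Pi.zero_apply]
    positivity)
  have hA0 : 0 ≤ A := integral_nonneg fun x => by positivity
  have hμ0 := defect_nonneg z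
  have hκ0 : 0 ≤ max (z ^ 2).re 0 := le_max_right _ _
  have hκ := re_sq_le z
  have hμ := defect_le z
  -- If Re z² ≤ 0, the second energy inequality also bounds |Re z²|P by A; otherwise the defect is
  -- just |Im z²|.
  have k1 : defect z * P ≤ 2 * A := by
    unfold defect
    rcases le_total (z ^ 2).re 0 with hp | hp
    · rw [max_eq_right hp, sub_zero, abs_of_nonpos hp]
      nlinarith
    · rw [max_eq_left hp, sub_self, abs_zero]
      linarith
  refine ⟨k1, ?_⟩
  set κ := max (z ^ 2).re 0 with hκdef
  set μ := defect z with hμdef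
  have k2 : dirichlet Dv ≤ κ * P + A := by
    have : (z ^ 2).re * P ≤ κ * P := by gcongr; exact le_max_left _ _
    linarith
  -- In μ(κP + A) the first term uses μP ≤ 2A and κ ≤ |z|², the second μ ≤ 2|z|². Two powers of |z|
  -- are produced, so the square root in `source_le` carries exactly one.
  have k3 : μ * dirichlet Dv ≤ 4 * ‖z‖ ^ 2 * A := by
    calc μ * dirichlet Dv ≤ μ * (κ * P + A) := by gcongr
      _ = κ * (μ * P) + μ * A := by ring
      _ ≤ ‖z‖ ^ 2 * (2 * A) + 2 * ‖z‖ ^ 2 * A := by gcongr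
      _ = _ := by ring
  calc μ ^ 2 * P * dirichlet Dv = (μ * P) * (μ * dirichlet Dv) := by ring
    _ ≤ (2 * A) * (4 * ‖z‖ ^ 2 * A) := by gcongr
    _ = _ := by ring

/-- Cauchy–Schwarz with (a|v|)² ≤ Ma|v|² and the factor 40 for the energy density gives the square
bound 40 · 8 = 320 ≤ 18² times M. The single factor |z| on the right turns the integral into a
pairing with zv. -/
lemma IsCoeff.source_le (ha : IsCoeff α M a Da) (hM : 0 < M) (h : IsH2 v Dv D2v) (z : ℂ) :
    defect z * (∫ x, (a x * ‖v x‖) * cDensity v Dv x) ≤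
      18 * Real.sqrt M * (‖z‖ * ∫ x, ‖helm a z v D2v x‖ * ‖v x‖) := by
  obtain ⟨-, h2⟩ := ha.defect_energy h z
  have hA0 : 0 ≤ ∫ x, ‖helm a z v D2v x‖ * ‖v x‖ := integral_nonneg fun x => by positivity
  have hav : MemLp (fun x => a x * ‖v x‖) 2 volume := ha.memLp_mul h.memLp.norm
  have hcs := sq_integral_mul_le hav h.memLp_cDensity
  have hW := h.integral_cDensity_sq_le_dirichlet
  have iP : Integrable (fun x => a x * ‖v x‖ ^ 2) volume := by
    refine (hav.integrable_mul h.memLp.norm).congr (Eventually.of_forall fun x => ?_)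
    simp only [Pi.mul_apply]; ring
  have hMP : ∫ x, (a x * ‖v x‖) ^ 2 ≤ M * ∫ x, a x * ‖v x‖ ^ 2 := by
    rw [← integral_const_mul]
    refine integral_mono_ae hav.integrable_sq (iP.const_mul M) ?_
    filter_upwards [ha.bounds] with x hx
    have h0 := ha.pos.trans_le hx.1
    calc (a x * ‖v x‖) ^ 2 = a x * (a x * ‖v x‖ ^ 2) := by ring
      _ ≤ M * (a x * ‖v x‖ ^ 2) := by gcongr; exact hx.2
  have hP0 : 0 ≤ ∫ x, (a x * ‖v x‖) ^ 2 := integral_nonneg fun x => sq_nonneg _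
  have hMP0 := hP0.trans hMP
  have hW0 : 0 ≤ ∫ x, cDensity v Dv x ^ 2 := integral_nonneg fun x => sq_nonneg _
  have hμ0 := defect_nonneg z
  have hG := dirichlet_nonneg Dv
  refine le_of_sq_le_sq ?_ (by positivity)
  have e : (18 * Real.sqrt M * (‖z‖ * ∫ x, ‖helm a z v D2v x‖ * ‖v x‖)) ^ 2
      = 324 * M * (‖z‖ * ∫ x, ‖helm a z v D2v x‖ * ‖v x‖) ^ 2 := by
    rw [mul_pow, mul_pow, Real.sq_sqrt hM.le]; norm_num
  rw [e]
  calc (defect z * ∫ x, (a x * ‖v x‖) * cDensity v Dv x) ^ 2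
      = defect z ^ 2 * (∫ x, (a x * ‖v x‖) * cDensity v Dv x) ^ 2 := by ring
    _ ≤ defect z ^ 2 * ((∫ x, (a x * ‖v x‖) ^ 2) * ∫ x, cDensity v Dv x ^ 2) := by gcongr
    _ ≤ defect z ^ 2 * ((M * ∫ x, a x * ‖v x‖ ^ 2) * (40 * dirichlet Dv)) := by gcongr
    _ = 40 * M * (defect z ^ 2 * (∫ x, a x * ‖v x‖ ^ 2) * dirichlet Dv) := by ring
    _ ≤ 40 * M * (8 * (‖z‖ * ∫ x, ‖helm a z v D2v x‖ * ‖v x‖) ^ 2) := by gcongr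
    _ ≤ _ := by
      have : 0 ≤ M * (‖z‖ * ∫ x, ‖helm a z v D2v x‖ * ‖v x‖) ^ 2 := by positivity
      linarith

/-- The local energy estimate for the operator without its first-order part. -/
theorem IsCoeff.cBallEnergy_le (ha : IsCoeff α M a Da) (hM : 0 < M) (h : IsH2 v Dv D2v) (z : ℂ)
    {R : ℝ} (hR : 0 < R) :
    cBallEnergy a (max (z ^ 2).re 0) R v Dv ≤
      36 * ((∫ x, ‖helm a z v D2v x‖ * cDensity v Dv x)
        + 18 * Real.sqrt M * (‖z‖ * ∫ x, ‖helm a z v D2v x‖ * ‖v x‖)) := by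
  set κ := max (z ^ 2).re 0 with hκdef
  have hκ : 0 ≤ κ := le_max_right _ _
  have hr := h.re
  have hi := h.im
  have e1 := ha.ballEnergy_le hr hκ hR
  have e2 := ha.ballEnergy_le hi hκ hR
  have hF := ha.memLp_helm h z
  have hav : MemLp (fun x => a x * ‖v x‖) 2 volume := ha.memLp_mul h.memLp.norm
  have m1 : MemLp (fun x => ∑ i, (D2v i i x).re + κ * (a x * (v x).re)) 2 volume :=
    (memLp_finsetSum Finset.univ fun i _ => hr.memLp_D2 i i).add
      ((ha.memLp_mul hr.memLp).const_mul κ)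
  have m2 : MemLp (fun x => ∑ i, (D2v i i x).im + κ * (a x * (v x).im)) 2 volume :=
    (memLp_finsetSum Finset.univ fun i _ => hi.memLp_D2 i i).add
      ((ha.memLp_mul hi.memLp).const_mul κ)
  have i1 : Integrable (fun x => |∑ i, (D2v i i x).re + κ * (a x * (v x).re)|
      * energyDensity (fun x => (v x).re) (fun i x => (Dv i x).re) x) volume :=
    m1.abs.integrable_mul hr.memLp_energyDensity
  have i2 : Integrable (fun x => |∑ i, (D2v i i x).im + κ * (a x * (v x).im)|
      * energyDensity (fun x => (v x).im) (fun i x => (Dv i x).im) x) volume :=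
    m2.abs.integrable_mul hi.memLp_energyDensity
  have i3 : Integrable (fun x => ‖helm a z v D2v x‖ * cDensity v Dv x) volume :=
    hF.norm.integrable_mul h.memLp_cDensity
  have i4 : Integrable (fun x => (a x * ‖v x‖) * cDensity v Dv x) volume :=
    hav.integrable_mul h.memLp_cDensity
  have hsum : (∫ x, |∑ i, (D2v i i x).re + κ * (a x * (v x).re)|
      * energyDensity (fun x => (v x).re) (fun i x => (Dv i x).re) x)
      + (∫ x, |∑ i, (D2v i i x).im + κ * (a x * (v x).im)|
      * energyDensity (fun x => (v x).im) (fun i x => (Dv i x).im) x)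
      ≤ (∫ x, ‖helm a z v D2v x‖ * cDensity v Dv x)
        + defect z * ∫ x, (a x * ‖v x‖) * cDensity v Dv x := by
    rw [← integral_const_mul, ← integral_add i1 i2, ← integral_add i3 (i4.const_mul _)]
    refine integral_mono_ae (i1.add i2) (i3.add (i4.const_mul _)) ?_
    filter_upwards [ha.bounds] with x hx
    have h0 := ha.pos.trans_le hx.1
    -- L is Δv + κav with κ real, so its real and imaginary parts are the operators applied to Re v
    -- and Im v.
    set L : ℂ := helm a z v D2v x - (z ^ 2 - (κ : ℝ)) * ((a x : ℂ) * v x) with hL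
    have hLn : ‖L‖ ≤ ‖helm a z v D2v x‖ + defect z * (a x * ‖v x‖) := by
      refine (norm_sub_le _ _).trans ?_
      rw [norm_mul, norm_mul, Complex.norm_real, Real.norm_of_nonneg h0.le]
      gcongr
      exact norm_sub_le_defect z
    have hL' : L = laplacian D2v x + (κ : ℂ) * ((a x : ℂ) * v x) := by
      rw [hL, helm]; ring
    have hLr : ∑ i, (D2v i i x).re + κ * (a x * (v x).re) = L.re := by
      rw [hL']
      simp [laplacian]
    have hLi : ∑ i, (D2v i i x).im + κ * (a x * (v x).im) = L.im := by
      rw [hL']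
      simp [laplacian]
    rw [hLr, hLi]
    have w1 := energyDensity_nonneg (fun x => (v x).re) (fun i x => (Dv i x).re) x
    have w2 := energyDensity_nonneg (fun x => (v x).im) (fun i x => (Dv i x).im) x
    have b1 := (Complex.abs_re_le_norm L).trans hLn
    have b2 := (Complex.abs_im_le_norm L).trans hLn
    have p1 := mul_le_mul_of_nonneg_right b1 w1
    have p2 := mul_le_mul_of_nonneg_right b2 w2
    dsimp only [cDensity]
    linarith
  have hs := ha.source_le hM h z
  unfold cBallEnergy
  linarith

end Morawetz

/-! ### From local energy to the norms, and the first-order terms. -/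

namespace Morawetz

open Filter Topology

variable {α M : ℝ} {a : E3 → ℝ} {Da : Fin 3 → E3 → ℝ}

section ballEnergy

variable {w : E3 → ℝ} {Dw : Fin 3 → E3 → ℝ} {D2w : Fin 3 → Fin 3 → E3 → ℝ}

lemma IsCoeff.setIntegral_mul_sq_nonneg (ha : IsCoeff α M a Da) (w : E3 → ℝ) (R : ℝ) :
    0 ≤ ∫ x in cball R, a x * w x ^ 2 :=
  integral_nonneg_of_ae (ae_restrict_of_ae (by
    filter_upwards [ha.bounds] with x hx
    have := ha.pos.trans_le hx.1
    dsimp only [Pi.zero_apply]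
    positivity))

lemma IsCoeff.ballEnergy_nonneg (ha : IsCoeff α M a Da) {κ R : ℝ} (hκ : 0 ≤ κ) (hR : 0 < R)
    (w : E3 → ℝ) (Dw : Fin 3 → E3 → ℝ) : 0 ≤ ballEnergy a κ R w Dw := by
  have h1 := ha.setIntegral_mul_sq_nonneg w R
  have h2 : 0 ≤ ∑ i, ∫ x in cball R, Dw i x ^ 2 :=
    Finset.sum_nonneg fun i _ => integral_nonneg fun x => sq_nonneg _
  have h3 : 0 ≤ ∫ x in cball R, w x ^ 2 := integral_nonneg fun x => sq_nonneg _
  unfold ballEnergy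
  positivity

/-- The 4 comes from the zero-order term of the trace inequality; the κ term of the energy is
nonnegative and is discarded. -/
lemma IsCoeff.lintegral_sphere_le (ha : IsCoeff α M a Da) (hw : IsRealH2 w Dw D2w)
    (hc : Continuous w) {κ R : ℝ} (hκ : 0 ≤ κ) (hR : 0 < R) :
    ∫⁻ θ : Metric.sphere (0 : E3) 1, ENNReal.ofReal (w (R • (θ : E3)) ^ 2)
      ∂((volume : Measure E3).toSphere) ≤ ENNReal.ofReal (4 * ballEnergy a κ R w Dw) := by
  refine (hw.trace hc hR).trans (ENNReal.ofReal_le_ofReal ?_)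
  have h1 : 0 ≤ κ * R⁻¹ * ∫ x in cball R, a x * w x ^ 2 :=
    mul_nonneg (by positivity) (ha.setIntegral_mul_sq_nonneg w R)
  have h2 : 0 ≤ R⁻¹ * ∑ i, ∫ x in cball R, Dw i x ^ 2 := mul_nonneg (by positivity)
    (Finset.sum_nonneg fun i _ => integral_nonneg fun x => sq_nonneg _)
  unfold ballEnergy
  linarith

end ballEnergy

variable {v : E3 → ℂ} {Dv : Fin 3 → E3 → ℂ} {D2v : Fin 3 → Fin 3 → E3 → ℂ}

lemma norm_sq_grad (Dv : Fin 3 → E3 → ℂ) (x : E3) :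
    ‖grad Dv x‖ ^ 2 = ∑ i, (Dv i x).re ^ 2 + ∑ i, (Dv i x).im ^ 2 := by
  rw [EuclideanSpace.norm_sq_eq, ← Finset.sum_add_distrib]
  exact Finset.sum_congr rfl fun i _ => norm_sq_complex _

lemma norm_grad_le (Dv : Fin 3 → E3 → ℂ) (x : E3) :
    ‖grad Dv x‖ ≤ ∑ i, |(Dv i x).re| + ∑ i, |(Dv i x).im| := by
  refine le_of_sq_le_sq ?_ (by positivity)
  rw [norm_sq_grad]
  have k : ∀ u : Fin 3 → ℝ, ∑ i, u i ^ 2 ≤ (∑ i, |u i|) ^ 2 := fun u => by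
    simp only [← sq_abs (u _)]
    exact Finset.sum_sq_le_sq_sum_of_nonneg fun i _ => abs_nonneg _
  have h1 := k fun i => (Dv i x).re
  have h2 := k fun i => (Dv i x).im
  have h3 : 0 ≤ (∑ i, |(Dv i x).re|) * ∑ i, |(Dv i x).im| := by positivity
  nlinarith

lemma IsH2.memLp_grad (h : IsH2 v Dv D2v) : MemLp (grad Dv) 2 volume := by
  have hm : AEStronglyMeasurable (grad Dv) volume :=
    (PiLp.continuous_toLp 2 fun _ : Fin 3 => ℂ).comp_aestronglyMeasurable
      (aemeasurable_pi_iff.2 fun i => (h.memLp_D i).1.aemeasurable).aestronglyMeasurable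
  have hs : MemLp (fun x => ∑ i, |(Dv i x).re| + ∑ i, |(Dv i x).im|) 2 volume :=
    (memLp_finsetSum Finset.univ fun i _ => (h.re.memLp_D i).abs).add
      (memLp_finsetSum Finset.univ fun i _ => (h.im.memLp_D i).abs)
  exact hs.mono hm (Eventually.of_forall fun x => (norm_grad_le Dv x).trans (le_abs_self _))

/-- The local quantities that the local energy controls. -/
lemma IsCoeff.setIntegral_le_of_cBallEnergy_le (ha : IsCoeff α M a Da) (h : IsH2 v Dv D2v)
    {κ R Q : ℝ} (hκ : 0 ≤ κ) (hR : 0 < R) (hQ : cBallEnergy a κ R v Dv ≤ Q) :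
    ∫ x in cball R, ‖grad Dv x‖ ^ 2 ≤ R * Q ∧
    κ * (∫ x in cball R, ‖v x‖ ^ 2) ≤ α⁻¹ * (R * Q) ∧
    ∫ x in cball R, ‖v x‖ ^ 2 ≤ R ^ 3 * Q := by
  have hα := ha.pos
  have hr := h.re
  have hi := h.im
  have kr : ∀ i ∈ Finset.univ, Integrable (fun x => (Dv i x).re ^ 2) (volume.restrict (cball R)) :=
    fun i _ => (hr.memLp_D i).integrable_sq.integrableOn
  have ki : ∀ i ∈ Finset.univ, Integrable (fun x => (Dv i x).im ^ 2) (volume.restrict (cball R)) :=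
    fun i _ => (hi.memLp_D i).integrable_sq.integrableOn
  have eG : ∫ x in cball R, ‖grad Dv x‖ ^ 2
      = (∑ i, ∫ x in cball R, (Dv i x).re ^ 2) + ∑ i, ∫ x in cball R, (Dv i x).im ^ 2 := by
    simp only [norm_sq_grad]
    rw [integral_add (integrable_finsetSum _ kr) (integrable_finsetSum _ ki),
      integral_finsetSum _ kr, integral_finsetSum _ ki]
  have eV : ∫ x in cball R, ‖v x‖ ^ 2
      = (∫ x in cball R, (v x).re ^ 2) + ∫ x in cball R, (v x).im ^ 2 := by
    simp only [norm_sq_complex]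
    exact integral_add hr.memLp.integrable_sq.integrableOn hi.memLp.integrable_sq.integrableOn
  have hP : ∀ {w : E3 → ℝ}, MemLp w 2 volume →
      α * (∫ x in cball R, w x ^ 2) ≤ ∫ x in cball R, a x * w x ^ 2 := fun {w} hw => by
    have i1 : Integrable (fun x => a x * w x ^ 2) volume := by
      refine ((ha.memLp_mul hw).integrable_mul hw).congr (Eventually.of_forall fun x => ?_)
      simp only [Pi.mul_apply]; ring
    rw [← integral_const_mul]
    refine integral_mono_ae (hw.integrable_sq.integrableOn.const_mul α) i1.integrableOn
      (ae_restrict_of_ae ?_)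
    filter_upwards [ha.bounds] with x hx
    have := hx.1
    gcongr
  have hPr := hP hr.memLp
  have hPi := hP hi.memLp
  have hG0 : 0 ≤ ∫ x in cball R, ‖grad Dv x‖ ^ 2 := integral_nonneg fun x => sq_nonneg _
  have hV0 : 0 ≤ ∫ x in cball R, ‖v x‖ ^ 2 := integral_nonneg fun x => sq_nonneg _
  have e : R⁻¹ * (∫ x in cball R, ‖grad Dv x‖ ^ 2)
      + R⁻¹ * (κ * (α * ∫ x in cball R, ‖v x‖ ^ 2)) + (R ^ 3)⁻¹ * ∫ x in cball R, ‖v x‖ ^ 2 ≤ Q := by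
    refine le_trans ?_ hQ
    have h1 := mul_le_mul_of_nonneg_left hPr (show 0 ≤ κ * R⁻¹ by positivity)
    have h2 := mul_le_mul_of_nonneg_left hPi (show 0 ≤ κ * R⁻¹ by positivity)
    unfold cBallEnergy ballEnergy
    rw [eG, eV]
    linarith
  have t1 : 0 ≤ R⁻¹ * (∫ x in cball R, ‖grad Dv x‖ ^ 2) := by positivity
  have t2 : 0 ≤ R⁻¹ * (κ * (α * ∫ x in cball R, ‖v x‖ ^ 2)) := by positivity
  have t3 : 0 ≤ (R ^ 3)⁻¹ * ∫ x in cball R, ‖v x‖ ^ 2 := by positivity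
  refine ⟨(inv_mul_le_iff₀ hR).1 (by linarith), ?_, (inv_mul_le_iff₀ (by positivity)).1
    (by linarith)⟩
  have := (inv_mul_le_iff₀ hR).1 (show R⁻¹ * (κ * (α * ∫ x in cball R, ‖v x‖ ^ 2)) ≤ Q by linarith)
  rw [le_inv_mul_iff₀ hα]
  linarith

/-- Local energy bounds control the norm of `Ẋ`. -/
lemma IsCoeff.normXdot_le (ha : IsCoeff α M a Da) (h : IsH2 v Dv D2v) (hc : Continuous v)
    {κ Q : ℝ} (hκ : 0 ≤ κ) (hQ0 : 0 ≤ Q) (hQ : ∀ R, 0 < R → cBallEnergy a κ R v Dv ≤ Q) :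
    normXdot v ≤ ENNReal.ofReal (2 * Real.sqrt Q) := by
  have hcr : Continuous fun x => (v x).re := Complex.continuous_re.comp hc
  have hci : Continuous fun x => (v x).im := Complex.continuous_im.comp hc
  have h1 : (⨆ (R : ℝ) (_ : 0 < R), ENNReal.ofReal (1 / R ^ 2) * sphereIntegralSq v R)
      ≤ ENNReal.ofReal ((2 * Real.sqrt Q) ^ 2) := by
    refine iSup₂_le fun R hR => ?_
    have e : ∀ θ : Metric.sphere (0 : E3) 1, ‖v (R • (θ : E3))‖ₑ ^ 2
        = ENNReal.ofReal ((v (R • (θ : E3))).re ^ 2)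
          + ENNReal.ofReal ((v (R • (θ : E3))).im ^ 2) := fun θ => by
      rw [← ofReal_norm, ← ENNReal.ofReal_pow (norm_nonneg _), norm_sq_complex,
        ENNReal.ofReal_add (sq_nonneg _) (sq_nonneg _)]
    have hm : Measurable fun θ : Metric.sphere (0 : E3) 1 =>
        ENNReal.ofReal ((v (R • (θ : E3))).re ^ 2) :=
      (Continuous.measurable (by fun_prop)).ennreal_ofReal
    unfold sphereIntegralSq
    rw [← mul_assoc, ← ENNReal.ofReal_mul (by positivity), one_div_mul_cancel (by positivity),
      ENNReal.ofReal_one, one_mul]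
    simp only [e]
    rw [lintegral_add_left hm]
    refine (add_le_add (ha.lintegral_sphere_le h.re hcr hκ hR)
      (ha.lintegral_sphere_le h.im hci hκ hR)).trans ?_
    rw [← ENNReal.ofReal_add (mul_nonneg (by norm_num) (ha.ballEnergy_nonneg hκ hR _ _))
      (mul_nonneg (by norm_num) (ha.ballEnergy_nonneg hκ hR _ _))]
    refine ENNReal.ofReal_le_ofReal ?_
    have := hQ R hR
    unfold cBallEnergy at this
    rw [mul_pow, Real.sq_sqrt hQ0]
    linarith
  calc normXdot v ≤ ENNReal.ofReal ((2 * Real.sqrt Q) ^ 2) ^ (1 / 2 : ℝ) :=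
        ENNReal.rpow_le_rpow h1 (by norm_num)
    _ = ENNReal.ofReal (2 * Real.sqrt Q) := by
      rw [ENNReal.ofReal_rpow_of_nonneg (by positivity) (by norm_num), ← Real.sqrt_eq_rpow,
        Real.sqrt_sq (by positivity)]

lemma mul_le_bra_mul_sqrt_sq {R Q : ℝ} (hQ : 0 ≤ Q) : R * Q ≤ bra R * Real.sqrt Q ^ 2 := by
  rw [Real.sq_sqrt hQ]
  exact mul_le_mul_of_nonneg_right (le_bra R) hQ

/-- Local energy bounds control the gradient in `Y`. -/
lemma IsCoeff.normY_grad_le (ha : IsCoeff α M a Da) (h : IsH2 v Dv D2v)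
    {κ Q : ℝ} (hκ : 0 ≤ κ) (hQ0 : 0 ≤ Q) (hQ : ∀ R, 0 < R → cBallEnergy a κ R v Dv ≤ Q) :
    normY (grad Dv) ≤ ENNReal.ofReal (Real.sqrt Q) :=
  normY_le_ofReal h.memLp_grad (Real.sqrt_nonneg _) fun R hR =>
    (ha.setIntegral_le_of_cBallEnergy_le h hκ hR (hQ R hR)).1.trans (mul_le_bra_mul_sqrt_sq hQ0)

/-- Local energy bounds control the energy density in `Y`. -/
lemma IsCoeff.normY_cDensity_le (ha : IsCoeff α M a Da) (h : IsH2 v Dv D2v) (hc : Continuous v)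
    {κ Q : ℝ} (hκ : 0 ≤ κ) (hQ0 : 0 ≤ Q) (hQ : ∀ R, 0 < R → cBallEnergy a κ R v Dv ≤ Q) :
    normY (cDensity v Dv) ≤ ENNReal.ofReal (Real.sqrt (72 * Q)) := by
  have hcr : Continuous fun x => (v x).re := Complex.continuous_re.comp hc
  have hci : Continuous fun x => (v x).im := Complex.continuous_im.comp hc
  refine normY_le_ofReal h.memLp_cDensity (Real.sqrt_nonneg _) fun R hR => ?_
  refine le_trans ?_ (mul_le_bra_mul_sqrt_sq (by positivity))
  have b : ∀ r, 0 < r →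
      ballEnergy a κ r (fun x => (v x).re) (fun i x => (Dv i x).re) ≤ Q ∧
      ballEnergy a κ r (fun x => (v x).im) (fun i x => (Dv i x).im) ≤ Q := fun r hr => by
    have h1 := ha.ballEnergy_nonneg hκ hr (fun x => (v x).re) (fun i x => (Dv i x).re)
    have h2 := ha.ballEnergy_nonneg hκ hr (fun x => (v x).im) (fun i x => (Dv i x).im)
    have h3 := hQ r hr
    unfold cBallEnergy at h3
    constructor <;> linarith
  have tr := h.re.integral_div_norm_le hcr (B := 4 * Q) (by positivity) (fun r hr =>
    (ha.lintegral_sphere_le h.re hcr hκ hr).trans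
      (ENNReal.ofReal_le_ofReal (by linarith [(b r hr).1]))) hR
  have ti := h.im.integral_div_norm_le hci (B := 4 * Q) (by positivity) (fun r hr =>
    (ha.lintegral_sphere_le h.im hci hκ hr).trans
      (ENNReal.ofReal_le_ofReal (by linarith [(b r hr).2]))) hR
  have g := (ha.setIntegral_le_of_cBallEnergy_le h hκ hR (hQ R hR)).1
  have eG : ∫ x in cball R, ‖grad Dv x‖ ^ 2
      = (∑ i, ∫ x in cball R, (Dv i x).re ^ 2) + ∑ i, ∫ x in cball R, (Dv i x).im ^ 2 := by
    simp only [norm_sq_grad]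
    rw [integral_add, integral_finsetSum, integral_finsetSum]
    · exact fun i _ => (h.im.memLp_D i).integrable_sq.integrableOn
    · exact fun i _ => (h.re.memLp_D i).integrable_sq.integrableOn
    · exact integrable_finsetSum _ fun i _ => (h.re.memLp_D i).integrable_sq.integrableOn
    · exact integrable_finsetSum _ fun i _ => (h.im.memLp_D i).integrable_sq.integrableOn
  rw [eG] at g
  simp only [Real.norm_eq_abs, sq_abs]
  -- Gradient, real quotient and imaginary quotient contribute 8(1 + 4 + 4) = 72.
  have := h.integral_cDensity_sq_le (cball R)
  linarith

/-- Local energy bounds and the energy identities control `z v` in `Y`. -/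
lemma IsCoeff.normY_mul_le (ha : IsCoeff α M a Da) (h : IsH2 v Dv D2v) (z : ℂ) {Q : ℝ}
    (hQ0 : 0 ≤ Q) (hQ : ∀ R, 0 < R → cBallEnergy a (max (z ^ 2).re 0) R v Dv ≤ Q) :
    normY (fun x => z * v x) ≤ ENNReal.ofReal (Real.sqrt ((1 + α⁻¹) * Q
      + 2 * α⁻¹ * (‖z‖ * ∫ x, ‖helm a z v D2v x‖ * ‖v x‖))) := by
  have hα := ha.pos
  have hκ : 0 ≤ max (z ^ 2).re 0 := le_max_right _ _
  set A := ∫ x, ‖helm a z v D2v x‖ * ‖v x‖ with hA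
  have hA0 : 0 ≤ A := integral_nonneg fun x => by positivity
  refine normY_le_ofReal (h.memLp.const_mul z) (Real.sqrt_nonneg _) fun R hR => ?_
  refine le_trans ?_ (mul_le_bra_mul_sqrt_sq (by positivity))
  simp only [norm_mul, mul_pow]
  rw [integral_const_mul]
  obtain ⟨-, h1, h2⟩ := ha.setIntegral_le_of_cBallEnergy_le h hκ hR (hQ R hR)
  set V := ∫ x in cball R, ‖v x‖ ^ 2 with hV
  have hV0 : 0 ≤ V := integral_nonneg fun x => sq_nonneg _
  -- On balls with R|z| < 1 the R⁻³∫|v|² part of the energy suffices. On larger balls |z|² ≤ κ +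
  -- defect: the κ part is in the energy, and the defect part is at most 2A/α by the global
  -- identity, where 1 ≤ R|z| supplies the missing factor.
  rcases lt_or_ge (R * ‖z‖) 1 with hz | hz
  · have h3 : (R * ‖z‖) ^ 2 ≤ 1 := pow_le_one₀ (by positivity) hz.le
    have h4 : 0 ≤ R * (α⁻¹ * Q) := by positivity
    have h5 : 0 ≤ R * (2 * α⁻¹ * (‖z‖ * A)) := by positivity
    calc ‖z‖ ^ 2 * V ≤ ‖z‖ ^ 2 * (R ^ 3 * Q) := by gcongr
      _ = (R * ‖z‖) ^ 2 * (R * Q) := by ring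
      _ ≤ 1 * (R * Q) := by gcongr
      _ ≤ _ := by linarith
  · have h3 := (ha.defect_energy h z).1
    have iP : Integrable (fun x => a x * ‖v x‖ ^ 2) volume := by
      refine ((ha.memLp_mul h.memLp.norm).integrable_mul h.memLp.norm).congr
        (Eventually.of_forall fun x => ?_)
      simp only [Pi.mul_apply]; ring
    have h4 : α * V ≤ ∫ x, a x * ‖v x‖ ^ 2 := by
      calc α * V ≤ α * ∫ x, ‖v x‖ ^ 2 := by
            gcongr
            exact setIntegral_le_integral h.memLp.norm.integrable_sq
              (Eventually.of_forall fun x => sq_nonneg _)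
        _ = ∫ x, α * ‖v x‖ ^ 2 := (integral_const_mul _ _).symm
        _ ≤ _ := by
            refine integral_mono_ae (h.memLp.norm.integrable_sq.const_mul α) iP ?_
            filter_upwards [ha.bounds] with x hx
            have := hx.1
            gcongr
    have hμ := defect_nonneg z
    have h5 : defect z * V ≤ α⁻¹ * (2 * A) := by
      rw [le_inv_mul_iff₀ hα]
      calc α * (defect z * V) = defect z * (α * V) := by ring
        _ ≤ defect z * ∫ x, a x * ‖v x‖ ^ 2 := by gcongr
        _ ≤ _ := h3
    have h6 : α⁻¹ * (2 * A) ≤ R * (2 * α⁻¹ * (‖z‖ * A)) := by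
      calc α⁻¹ * (2 * A) = 1 * (α⁻¹ * (2 * A)) := by ring
        _ ≤ (R * ‖z‖) * (α⁻¹ * (2 * A)) := by gcongr
        _ = _ := by ring
    have h7 : 0 ≤ R * Q := by positivity
    calc ‖z‖ ^ 2 * V ≤ (max (z ^ 2).re 0 + defect z) * V := by gcongr; exact sq_norm_le z
      _ = max (z ^ 2).re 0 * V + defect z * V := by ring
      _ ≤ _ := by linarith

/-- The first-order terms are bounded by the weighted energy density. -/
lemma FirstOrderBound.norm_le {σ δ : ℝ} {b₀ : E3 → ℂ} {b₁ : Fin 3 → E3 → ℂ}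
    (hb : FirstOrderBound σ δ b₀ b₁) (hσ : 0 ≤ σ) (h : IsH2 v Dv D2v) :
    ∀ᵐ x, ‖firstOrder b₀ b₁ v Dv x‖ ≤ σ * (bra ‖x‖ ^ (-1 - δ) * cDensity v Dv x) := by
  have h0 : ∀ᵐ x : E3, x ≠ 0 := by simp [ae_iff]
  filter_upwards [hb v Dv D2v h, h0] with x hx hx0
  refine hx.trans (mul_le_mul_of_nonneg_left ?_ hσ)
  have hn : 0 < ‖x‖ := norm_pos_iff.2 hx0
  have hbr := bra_pos ‖x‖
  -- One power of ⟨x⟩⁻¹ is given up for |x|⁻¹, so that the zero-order term joins |v|/|x| in the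
  -- energy density.
  have e1 : bra ‖x‖ ^ (-2 - δ) ≤ bra ‖x‖ ^ (-1 - δ) * ‖x‖⁻¹ := by
    rw [show -2 - δ = (-1 - δ) + (-1) by ring, Real.rpow_add hbr, Real.rpow_neg_one]
    have := le_bra ‖x‖
    gcongr
  have e2 : ‖v x‖ * ‖x‖⁻¹ ≤ |(v x).re / ‖x‖| + |(v x).im / ‖x‖| := by
    rw [abs_div, abs_div, abs_norm, ← add_div, ← div_eq_mul_inv]
    gcongr
    exact Complex.norm_le_abs_re_add_abs_im _
  have e3 := norm_grad_le Dv x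
  calc bra ‖x‖ ^ (-2 - δ) * ‖v x‖ + bra ‖x‖ ^ (-1 - δ) * ‖grad Dv x‖
      ≤ bra ‖x‖ ^ (-1 - δ) * ‖x‖⁻¹ * ‖v x‖ + bra ‖x‖ ^ (-1 - δ) * ‖grad Dv x‖ := by gcongr
    _ = bra ‖x‖ ^ (-1 - δ) * (‖v x‖ * ‖x‖⁻¹ + ‖grad Dv x‖) := by ring
    _ ≤ bra ‖x‖ ^ (-1 - δ) * cDensity v Dv x := by
      gcongr
      unfold cDensity energyDensity
      linarith

/-- Pairing with a function that is a `Y*` function up to a weighted remainder. -/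
lemma integral_mul_le_of_norm_le {F f G : E3 → ℂ} {W : E3 → ℝ} (hF : MemLp F 2 volume)
    (hf : MemLp f 2 volume) (hs : normYstar f ≠ ⊤) (hG : MemLp G 2 volume)
    (hW : MemLp W 2 volume) {σ δ : ℝ} (hσ : 0 ≤ σ) (hδ : 0 < δ)
    (hFf : ∀ᵐ x, ‖F x‖ ≤ ‖f x‖ + σ * (bra ‖x‖ ^ (-1 - δ) * W x)) :
    ∫ x, ‖F x‖ * ‖G x‖ ≤ (normYstar f).toReal * (normY G).toReal
      + σ * weightConst δ * ((normY W).toReal ^ 2 + (normY G).toReal ^ 2) / 2 := by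
  have hb : Continuous fun x : E3 => bra ‖x‖ := by unfold bra; fun_prop
  have hwm : AEStronglyMeasurable (fun x : E3 => bra ‖x‖ ^ (-1 - δ)) volume :=
    (hb.measurable.pow_const _).aestronglyMeasurable
  have iw : ∀ {E : Type} [NormedAddCommGroup E] {g : E3 → E}, MemLp g 2 volume →
      Integrable (fun x => bra ‖x‖ ^ (-1 - δ) * ‖g x‖ ^ 2) volume := fun {E} _ {g} hg =>
    hg.norm.integrable_sq.bdd_mul (c := 1) hwm (Eventually.of_forall fun x => abs_bra_rpow_le_one hδ x)
  have i1 : Integrable (fun x => ‖F x‖ * ‖G x‖) volume := hF.norm.integrable_mul hG.norm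
  have i2 : Integrable (fun x => ‖f x‖ * ‖G x‖) volume := hf.norm.integrable_mul hG.norm
  have i3 := iw hW
  have i4 := iw hG
  have i5 : Integrable (fun x => σ / 2 * (bra ‖x‖ ^ (-1 - δ) * ‖W x‖ ^ 2
      + bra ‖x‖ ^ (-1 - δ) * ‖G x‖ ^ 2)) volume := (i3.add i4).const_mul _
  have key : ∫ x, ‖F x‖ * ‖G x‖ ≤ (∫ x, ‖f x‖ * ‖G x‖)
      + σ / 2 * ((∫ x, bra ‖x‖ ^ (-1 - δ) * ‖W x‖ ^ 2) + ∫ x, bra ‖x‖ ^ (-1 - δ) * ‖G x‖ ^ 2) := by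
    rw [← integral_add i3 i4, ← integral_const_mul, ← integral_add i2 i5]
    refine integral_mono_ae i1 (i2.add i5) ?_
    filter_upwards [hFf] with x hx
    have hb0 : 0 ≤ bra ‖x‖ ^ (-1 - δ) := by have := bra_pos ‖x‖; positivity
    have h1 := mul_le_mul_of_nonneg_right hx (norm_nonneg (G x))
    have h2 : W x * ‖G x‖ ≤ (‖W x‖ ^ 2 + ‖G x‖ ^ 2) / 2 := by
      rw [Real.norm_eq_abs, sq_abs]
      nlinarith [sq_nonneg (W x - ‖G x‖)]
    have h3 := mul_le_mul_of_nonneg_left h2 (mul_nonneg hσ hb0)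
    linarith
  have k1 := integral_mul_le_normYstar hf hG hs
  have k2 := integral_weight_le hW hδ
  have k3 := integral_weight_le hG hδ
  have k4 := mul_le_mul_of_nonneg_left (add_le_add k2 k3) (show 0 ≤ σ / 2 by positivity)
  linarith

/-- Absorption of the quadratic terms. -/
lemma absorb {s D y Q Z I K L m c : ℝ} (hs : 0 ≤ s) (hD : 0 ≤ D) (hy : 0 ≤ y)
    (hK : 0 ≤ K) (hL : 0 ≤ L) (hm : 0 ≤ m) (hZ : 0 ≤ Z) (hI : 0 ≤ I) (hc : 0 ≤ c)
    (hQ : Q = 36 * (I + 18 * K * Z))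
    (hDQ : D ^ 2 ≤ 72 * Q) (hyQ : y ^ 2 ≤ (1 + L) * Q + 2 * L * Z)
    (hIs : I ≤ s * D + c * D ^ 2) (hZs : Z ≤ s * y + c * (D ^ 2 + y ^ 2) / 2)
    (hmK : m = 72 * (36 * (1 + 18 * K)) + (1 + L) * (36 * (1 + 18 * K)) + 2 * L)
    (hcm : 4 * c * m ≤ 1) :
    y ≤ 4 * m * s ∧ Q ≤ 8 * (36 * (1 + 18 * K)) * m * s ^ 2 := by
  -- The loop to be closed is N ≤ mE with E = s(D + y) + 2cN. As 4cm ≤ 1, half of N is absorbed;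
  -- then (D + y)² ≤ 2N makes N a linear rather than quadratic unknown, giving D + y ≤ 4ms.
  set K₁ := 36 * (1 + 18 * K) with hK₁
  set N := D ^ 2 + y ^ 2 with hN
  set E := s * (D + y) + 2 * c * N with hE
  have hK₁0 : 0 ≤ K₁ := by positivity
  have hN0 : 0 ≤ N := by positivity
  have hT0 : 0 ≤ s * (D + y) := by positivity
  have hcD : 0 ≤ c * D ^ 2 := by positivity
  have hcy : 0 ≤ c * y ^ 2 := by positivity
  have hIZ : I + Z ≤ E := by
    rw [hE, hN]
    linarith
  have hQE : Q ≤ K₁ * E := by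
    have h1 : K₁ * (I + Z) ≤ K₁ * E := by gcongr
    have h2 : 0 ≤ K * I := by positivity
    rw [hK₁] at h1 ⊢
    linarith
  have hNE : N ≤ m * E := by
    have h1 : L * Q ≤ L * (K₁ * E) := by gcongr
    have h2 : L * Z ≤ L * E := mul_le_mul_of_nonneg_left (by linarith) hL
    rw [hmK, hN]
    linarith
  have hcN : 4 * c * m * N ≤ N := mul_le_of_le_one_left hN0 hcm
  have hNs : N ≤ 2 * m * (s * (D + y)) := by
    rw [hE] at hNE
    linarith
  have hsum : D + y ≤ 4 * m * s := by
    rcases (add_nonneg hD hy).eq_or_lt with h0 | h0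
    · rw [← h0]; positivity
    · refine le_of_mul_le_mul_right ?_ h0
      have : (D + y) * (D + y) ≤ 2 * N := by
        rw [hN]
        linarith [sq_nonneg (D - y)]
      linarith
  have hEs : E ≤ 8 * m * s ^ 2 := by
    have h1 : 2 * c * N ≤ 2 * c * (2 * m * (s * (D + y))) := by gcongr
    have h2 : 4 * c * m * (s * (D + y)) ≤ s * (D + y) := mul_le_of_le_one_left hT0 hcm
    have h3 : s * (D + y) ≤ s * (4 * m * s) := by gcongr
    rw [hE]
    linarith
  refine ⟨by linarith, hQE.trans ?_⟩
  calc K₁ * E ≤ K₁ * (8 * m * s ^ 2) := by gcongr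
    _ = _ := by ring

end Morawetz
end

/-! ### Assembly of the resolvent-type estimate. -/

theorem proposition3p1 (α M δ : ℝ) (hα : 0 < α) (hM : 0 < M) (hδ : 0 < δ) :
    ∃ σ₀ : ℝ, 0 < σ₀ ∧ ∀ σ : ℝ, 0 < σ → σ ≤ σ₀ → ∃ C : ℝ, 0 < C ∧
      ∀ (a : Morawetz.E3 → ℝ) (Da : Fin 3 → Morawetz.E3 → ℝ)
        (b₀ : Morawetz.E3 → ℂ) (b₁ : Fin 3 → Morawetz.E3 → ℂ),
        (∀ i, Morawetz.IsWeakPartial i a (Da i)) →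
        (∀ᵐ x, α ≤ a x ∧ a x ≤ M) →
        Morawetz.normL1Linfty
          (fun x => Morawetz.bra ‖x‖ * (a x)⁻¹ * Morawetz.radialDerivNeg Da x) ≤
            ENNReal.ofReal (1 / 4) →
        AEStronglyMeasurable b₀ volume →
        (∀ j, AEStronglyMeasurable (b₁ j) volume) →
        Morawetz.FirstOrderBound σ δ b₀ b₁ →
        ∀ z : ℂ, 0 ≤ z.im →
        ∀ (v : Morawetz.E3 → ℂ) (Dv : Fin 3 → Morawetz.E3 → ℂ)
          (D2v : Fin 3 → Fin 3 → Morawetz.E3 → ℂ),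
          Morawetz.IsH2 v Dv D2v → Continuous v →
          Morawetz.normXdot v + Morawetz.normY (fun x => z * v x)
              + Morawetz.normY (Morawetz.grad Dv) ≤
            ENNReal.ofReal C * Morawetz.normYstar
              (fun x => Morawetz.laplacian D2v x + z ^ 2 * (a x : ℂ) * v x
                + Morawetz.firstOrder b₀ b₁ v Dv x) := by
  set K := Real.sqrt M with hK
  have hK0 : 0 ≤ K := Real.sqrt_nonneg M
  set K₁ := 36 * (1 + 18 * K) with hK₁
  have hK₁0 : 0 < K₁ := by positivity
  set m := 72 * K₁ + (1 + α⁻¹) * K₁ + 2 * α⁻¹ with hm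
  have hm0 : 0 < m := by positivity
  set c := Morawetz.weightConst δ with hc
  have hc0 : 0 < c := Morawetz.weightConst_pos hδ
  -- This σ₀ is the smallness condition in `absorb` with σc for c. In C, the Ẋ norm contributes
  -- twice and the gradient once a bound for √Q, and zv contributes 4m.
  refine ⟨(4 * c * m)⁻¹, by positivity, fun σ hσ hσle => ⟨3 * Real.sqrt (8 * K₁ * m) + 4 * m,
    by positivity, ?_⟩⟩
  intro a Da b₀ b₁ hweak hbd hdy hb₀ hb₁ hfo z _ v Dv D2v h hvc
  set C := 3 * Real.sqrt (8 * K₁ * m) + 4 * m with hC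
  have hC0 : 0 < C := by positivity
  set f : Morawetz.E3 → ℂ := fun x => Morawetz.laplacian D2v x + z ^ 2 * (a x : ℂ) * v x
    + Morawetz.firstOrder b₀ b₁ v Dv x with hf
  by_cases htop : Morawetz.normYstar f = ⊤
  · rw [htop, ENNReal.mul_top (by simpa using hC0)]
    exact le_top
  have ha : Morawetz.IsCoeff α M a Da := ⟨hα, hweak, hbd, hdy⟩
  have hfob := hfo.norm_le hσ.le h
  have hF := ha.memLp_helm h z
  have hW := h.memLp_cDensity
  -- The duality estimate is applied to f, which therefore has to be in L²; the first-order part is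
  -- dominated by σ times the energy density.
  have hfoL : MemLp (Morawetz.firstOrder b₀ b₁ v Dv) 2 volume := by
    refine MemLp.of_le_mul (c := σ) hW ?_ ?_
    · unfold Morawetz.firstOrder
      exact (hb₀.mul h.memLp.1).add (Finset.aestronglyMeasurable_fun_sum _ fun j _ =>
        (hb₁ j).mul (h.memLp_D j).1)
    · filter_upwards [hfob] with x hx
      refine hx.trans ?_
      have hW0 := Morawetz.cDensity_nonneg v Dv x
      rw [Real.norm_of_nonneg hW0]
      gcongr
      exact mul_le_of_le_one_left hW0
        ((le_abs_self _).trans (Morawetz.abs_bra_rpow_le_one hδ x))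
  have hfL : MemLp f 2 volume := hF.add hfoL
  have hFf : ∀ᵐ x, ‖Morawetz.helm a z v D2v x‖ ≤
      ‖f x‖ + σ * (Morawetz.bra ‖x‖ ^ (-1 - δ) * Morawetz.cDensity v Dv x) := by
    filter_upwards [hfob] with x hx
    have e : Morawetz.helm a z v D2v x = f x - Morawetz.firstOrder b₀ b₁ v Dv x := by
      simp only [hf, Morawetz.helm, add_sub_cancel_right]
    rw [e]
    exact (norm_sub_le _ _).trans (by gcongr)
  have hWc : MemLp (fun x => (Morawetz.cDensity v Dv x : ℂ)) 2 volume := hW.ofReal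
  have hzv : MemLp (fun x => z * v x) 2 volume := h.memLp.const_mul z
  have nW : ∀ x, ‖(Morawetz.cDensity v Dv x : ℂ)‖ = ‖Morawetz.cDensity v Dv x‖ := fun x =>
    Complex.norm_real _
  -- These are the two pairings on the right of the energy estimate: F with the energy density, and
  -- F with zv.
  have p1 := Morawetz.integral_mul_le_of_norm_le hF hfL htop hWc hW hσ.le hδ hFf
  have p2 := Morawetz.integral_mul_le_of_norm_le hF hfL htop hzv hW hσ.le hδ hFf
  rw [Morawetz.normY_congr_norm nW] at p1
  have e1 : ∫ x, ‖Morawetz.helm a z v D2v x‖ * ‖(Morawetz.cDensity v Dv x : ℂ)‖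
      = ∫ x, ‖Morawetz.helm a z v D2v x‖ * Morawetz.cDensity v Dv x := by
    simp only [nW, Real.norm_of_nonneg (Morawetz.cDensity_nonneg v Dv _)]
  have e2 : ∫ x, ‖Morawetz.helm a z v D2v x‖ * ‖z * v x‖
      = ‖z‖ * ∫ x, ‖Morawetz.helm a z v D2v x‖ * ‖v x‖ := by
    rw [← integral_const_mul]
    simp only [norm_mul]
    congr 1
    funext x
    ring
  rw [e1] at p1
  rw [e2] at p2
  have hE := fun R hR => ha.cBallEnergy_le hM h z (R := R) hR
  set s := (Morawetz.normYstar f).toReal with hs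
  set D := (Morawetz.normY (Morawetz.cDensity v Dv)).toReal with hD
  set y := (Morawetz.normY (fun x => z * v x)).toReal with hy
  set I := ∫ x, ‖Morawetz.helm a z v D2v x‖ * Morawetz.cDensity v Dv x with hI
  set Z := ‖z‖ * ∫ x, ‖Morawetz.helm a z v D2v x‖ * ‖v x‖ with hZ
  have hs0 : 0 ≤ s := ENNReal.toReal_nonneg
  have hD0 : 0 ≤ D := ENNReal.toReal_nonneg
  have hy0 : 0 ≤ y := ENNReal.toReal_nonneg
  have hI0 : 0 ≤ I := integral_nonneg fun x =>
    mul_nonneg (norm_nonneg _) (Morawetz.cDensity_nonneg v Dv x)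
  have hZ0 : 0 ≤ Z := mul_nonneg (norm_nonneg _) (integral_nonneg fun x => by positivity)
  obtain ⟨Q, hQ⟩ : ∃ Q, Q = 36 * (I + 18 * K * Z) := ⟨_, rfl⟩
  rw [← hQ] at hE
  have hQ0 : 0 ≤ Q := by rw [hQ]; positivity
  have hκ : 0 ≤ max (z ^ 2).re 0 := le_max_right _ _
  have n1 := ha.normXdot_le h hvc hκ hQ0 hE
  have n2 := ha.normY_grad_le h hκ hQ0 hE
  have n3 := ha.normY_cDensity_le h hvc hκ hQ0 hE
  have n4 := ha.normY_mul_le h z hQ0 hE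
  have sqb : ∀ {N : ℝ≥0∞} {B : ℝ}, 0 ≤ B → N ≤ ENNReal.ofReal (Real.sqrt B) →
      N.toReal ^ 2 ≤ B := fun {N B} hB hN => by
    have := ENNReal.toReal_mono ENNReal.ofReal_ne_top hN
    rw [ENNReal.toReal_ofReal (Real.sqrt_nonneg _)] at this
    exact (Real.le_sqrt ENNReal.toReal_nonneg hB).1 this
  have q3 : D ^ 2 ≤ 72 * Q := sqb (by positivity) n3
  have q4 : y ^ 2 ≤ (1 + α⁻¹) * Q + 2 * α⁻¹ * Z := sqb (by positivity) n4
  have hcm : 4 * (σ * c) * m ≤ 1 := by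
    rw [← one_div, le_div_iff₀ (by positivity)] at hσle
    linarith
  obtain ⟨r1, r2⟩ := Morawetz.absorb hs0 hD0 hy0 hK0 (inv_nonneg.2 hα.le) hm0.le hZ0 hI0
    (c := σ * c) (by positivity) hQ q3 q4 (by linarith) (by linarith) hm hcm
  have r3 : Real.sqrt Q ≤ Real.sqrt (8 * K₁ * m) * s := by
    rw [← Real.sqrt_sq hs0, ← Real.sqrt_mul (by positivity)]
    exact Real.sqrt_le_sqrt r2
  calc Morawetz.normXdot v + Morawetz.normY (fun x => z * v x) + Morawetz.normY (Morawetz.grad Dv)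
      ≤ ENNReal.ofReal (2 * Real.sqrt Q) + ENNReal.ofReal y + ENNReal.ofReal (Real.sqrt Q) := by
        rw [hy, ENNReal.ofReal_toReal (Morawetz.normY_ne_top hzv)]
        gcongr
    _ = ENNReal.ofReal (2 * Real.sqrt Q + y + Real.sqrt Q) := by
        rw [ENNReal.ofReal_add (by positivity) (by positivity),
          ENNReal.ofReal_add (by positivity) hy0]
    _ ≤ ENNReal.ofReal (C * s) := by
        refine ENNReal.ofReal_le_ofReal ?_
        rw [hC]
        linarith
    _ = ENNReal.ofReal C * Morawetz.normYstar f := by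
        rw [ENNReal.ofReal_mul hC0.le, hs, ENNReal.ofReal_toReal htop]
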